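/- Let $n\ge 1$. A cube $Q\subset\mathbb{R}^n$ is a product of bounded intervals (open, closed or half-open) of a common length $l\in(0,\infty)$. Let $p(\cdot):\mathbb{R}^n\to(0,\infty)$ be a measurable exponent with $\operatorname{ess\,inf}_{x\in\mathbb{R}^n}p(x)>0$ (that is, $p(\cdot)\in\mathcal{P}_0$, finite valued) which is globally log-Hölder continuous ($p(\cdot)\in LH$): there are positive constants $C_0,p_\infty,C_\infty$ such that $|p(x)-p(y)|\le -C_0/\log(|x-y|)$ whenever $|x-y|<\frac12$, and $|p(x)-p_\infty|\le C_\infty/\log(e+|x|)$ for all $x\in\mathbb{R}^n$. For an exponent $q(\cdot):\mathbb{R}^n\to(0,\infty)$ and a measurable $f:\mathbb{R}^n\to\mathbb{R}$ put $$\|f\|_{L^{q(\cdot)}}:=\inf\left\{\lambda\in(0,\infty):\int_{\mathbb{R}^n}\left(\frac{|f(x)|}{\lambda}\right)^{q(x)}\,dx\le 1\right\}\in[0,\infty],\qquad \inf\emptyset:=\infty .$$ A scalar weight is a non-negative measurable function $w:\mathbb{R}^n\to[0,\infty)$ that is positive almost everywhere. A scalar weight $w$ is an $\mathcal{A}_{p(\cdot),\infty}$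 weight, written $w\in\mathcal{A}_{p(\cdot),\infty}$, if $\log(w^{-1})$ is integrable on every cube and $$[w]_{\mathcal{A}_{p(\cdot),\infty}}:=\sup_Q\frac{\|w\mathbf{1}_Q\|_{L^{p(\cdot)}}}{\|\mathbf{1}_Q\|_{L^{p(\cdot)}}}\exp\left(\frac1{|Q|}\int_Q\log\left(w^{-1}(y)\right)dy\right)<\infty,$$ where the supremum is taken over all cubes $Q$. Then, for every scalar weight $w$, the following two statements are equivalent: (i) $w\in\mathcal{A}_{p(\cdot),\infty}$; (ii) there exist constants $r\in(1,\infty)$ and $C\in(0,\infty)$ such that, for every cube $Q$ in $\mathbb{R}^n$, $\|w\mathbf{1}_Q\|_{L^{p(\cdot)}}<\infty$ and $$\frac{\|w\mathbf{1}_Q\|_{L^{rp(\cdot)}}}{\|\mathbf{1}_Q\|_{L^{rp(\cdot)}}}\le C\,\frac{\|w\mathbf{1}_Q\|_{L^{p(\cdot)}}}{\|\mathbf{1}_Q\|_{L^{p(\cdot)}}}.$$ -/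

import Mathlib

open MeasureTheory Set
open scoped ENNReal

namespace VariableWeights

/-- Cubes in `ℝⁿ`: products of bounded intervals with a common length `l > 0`. Each of these
intervals may be open, closed or half-open. -/
def IsCube {n : ℕ} (Q : Set (EuclideanSpace ℝ (Fin n))) : Prop :=
  ∃ (a : Fin n → ℝ) (l : ℝ) (I : Fin n → Set ℝ), 0 < l ∧
    (∀ i, Ioo (a i) (a i + l) ⊆ I i ∧ I i ⊆ Icc (a i) (a i + l)) ∧
    Q = {x | ∀ i, x i ∈ I i}

/-- The class `𝒫₀` for finite-valued exponents: Lebesgue measurable functions `p : ℝⁿ → (0, ∞)`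
whose essential infimum is positive. -/
structure IsExponent {n : ℕ} (p : EuclideanSpace ℝ (Fin n) → ℝ) : Prop where
  aemeasurable : AEMeasurable p volume
  pos : ∀ x, 0 < p x
  essInf_pos : ∃ c : ℝ, 0 < c ∧ ∀ᵐ x ∂(volume : Measure (EuclideanSpace ℝ (Fin n))), c ≤ p x

/-- Local log-Hölder continuity. For `x = y` both sides are `0`. -/
def LogHolderLocal {n : ℕ} (p : EuclideanSpace ℝ (Fin n) → ℝ) : Prop :=
  ∃ C₀ : ℝ, 0 < C₀ ∧ ∀ x y, ‖x - y‖ < 1 / 2 → |p x - p y| ≤ -C₀ / Real.log ‖x - y‖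

/-- Log-Hölder continuity at infinity. -/
def LogHolderInfty {n : ℕ} (p : EuclideanSpace ℝ (Fin n) → ℝ) : Prop :=
  ∃ pinf Cinf : ℝ, 0 < pinf ∧ 0 < Cinf ∧
    ∀ x, |p x - pinf| ≤ Cinf / Real.log (Real.exp 1 + ‖x‖)

/-- Global log-Hölder continuity, the class `LH`. -/
def LogHolder {n : ℕ} (p : EuclideanSpace ℝ (Fin n) → ℝ) : Prop :=
  LogHolderLocal p ∧ LogHolderInfty p

/-- The modular `∫ |f(x)|^{p(x)} dx`, with values in `[0, ∞]`. -/
noncomputable def modular {n : ℕ} (p f : EuclideanSpace ℝ (Fin n) → ℝ) : ℝ≥0∞ :=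
  ∫⁻ x, ENNReal.ofReal (|f x| ^ p x)

/-- The Luxemburg (quasi-)norm of `L^{p(·)}`, with values in `[0, ∞]`; it is `∞` when no `t > 0`
is admissible. -/
noncomputable def lpNorm {n : ℕ} (p f : EuclideanSpace ℝ (Fin n) → ℝ) : ℝ≥0∞ :=
  ⨅ (t : ℝ) (_ : 0 < t) (_ : modular p (fun x => f x / t) ≤ 1), ENNReal.ofReal t

/-- The normalized quantity `‖f 1_Q‖_{L^{p(·)}} / ‖1_Q‖_{L^{p(·)}}`. -/
noncomputable def lpMean {n : ℕ} (p f : EuclideanSpace ℝ (Fin n) → ℝ)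
    (Q : Set (EuclideanSpace ℝ (Fin n))) : ℝ≥0∞ :=
  lpNorm p (Q.indicator f) / lpNorm p (Q.indicator fun _ => 1)

/-- Scalar weights: non-negative Lebesgue measurable functions that are positive almost
everywhere. -/
structure IsWeight {n : ℕ} (w : EuclideanSpace ℝ (Fin n) → ℝ) : Prop where
  aemeasurable : AEMeasurable w volume
  nonneg : ∀ x, 0 ≤ w x
  ae_pos : ∀ᵐ x ∂(volume : Measure (EuclideanSpace ℝ (Fin n))), 0 < w x

/-- The constant `[w]_{p(·),∞}`, the supremum over all cubes `Q` of
`(‖w 1_Q‖ / ‖1_Q‖) * exp (⨍_Q log (w⁻¹))`. -/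
noncomputable def apInftyConst {n : ℕ} (p w : EuclideanSpace ℝ (Fin n) → ℝ) : ℝ≥0∞ :=
  ⨆ (Q : Set (EuclideanSpace ℝ (Fin n))) (_ : IsCube Q),
    lpMean p w Q * ENNReal.ofReal (Real.exp (⨍ y in Q, Real.log (w y)⁻¹))

/-- The class of `A_{p(·),∞}` weights. The averages of `log (w⁻¹)` over cubes are required to
exist as real numbers and the supremum is required to be finite. For a weight with
`0 < ‖w 1_Q‖ < ∞` the integral of `log (w⁻¹)` over `Q` always exists in `(-∞, ∞]`, and the
value `+∞` makes the supremum infinite, so the first requirement only excludes undefined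
averages and products of the form `∞ * 0`. -/
structure IsApInfty {n : ℕ} (p w : EuclideanSpace ℝ (Fin n) → ℝ) : Prop where
  weight : IsWeight w
  integrable_log : ∀ Q : Set (EuclideanSpace ℝ (Fin n)), IsCube Q →
    IntegrableOn (fun y => Real.log (w y)⁻¹) Q volume
  const_lt_top : apInftyConst p w < ∞

end VariableWeights

/-! Write `w = exp b` almost everywhere. Let `exp τ` be a proxy for the norm of `1_Q`: `τ = log |Q|`
divided by the limit exponent for sides at least 1, and by the exponent at a corner for smaller
ones. Dividing `w 1_Q` by `exp (m + τ / r)` and taking the modular with exponent `r p` gives the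
integral over `Q` of `exp (r p (b - m) - p τ)`, which is `cubeModular`. A bound for it amounts to a
bound `C exp m` for the normalized norm. Log-Hölder continuity makes `exp (-p τ)` comparable to `1 /
|Q|` outside a small neighbourhood of the origin (`exists_exceptional`). So both statements concern
`b`: (i) says that `cubeModular` with `r = 1` is bounded when `m` is the average of `b`
(`LogCondition`); (ii) says that some `m = m(Q)` bounds it for an `r > 1` and keeps it away from
zero for `r = 1` (`ReverseHolderCondition`).

From (ii) to (i): the two bounds force `b ≥ m - H` on a fixed fraction of `Q`
(`exists_lower_fraction`), while `b ≤ m + H` off a set of small density. Hence `m` can only grow by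
a constant when a cube is slightly enlarged, and, iterating, when its side is doubled. A
John–Nirenberg stopping argument for `-b` against `-m` makes `exp (s (m - b))` integrable on
average. So `m` exceeds the average of `b` by at most a constant, and the average can replace `m`.

From (i) to (ii): the inequality `t ≤ exp t` shows that `b` has bounded mean oscillation. On cubes
with `log l` bounded by a multiple of `log (e + |x|)`, the function `exp (p (b - m))` satisfies a
dyadic reverse Hölder inequality. The exponent may be frozen on each grid cube, because averages of
`b` drift linearly in the generation while the oscillation of `p` decays like its reciprocal. On a
large cube meeting the region near the origin this fails, and an induction on scales replaces it
(`exists_scale_step`). Averages of `b` at a scale `ρ` between `√l` and `l` satisfy a reverse Hölder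
inequality with the constant limit exponent. Subcubes of side `ρ` away from the origin are then
handled by the previous case. Those near the origin occupy boundedly many times the volume `ρ ^ n`
and inherit the bound at scale `ρ` with a factor that decays geometrically in the number of
generations, so the induction closes with one constant. -/

namespace VariableWeights

/-! ### Half-open cubes and their dyadic grids -/

/-- The half-open cube with corner `a` and side length `l`. -/
def cube {n : ℕ} (a : EuclideanSpace ℝ (Fin n)) (l : ℝ) : Set (EuclideanSpace ℝ (Fin n)) :=
  {x | ∀ i, x i ∈ Ico (a i) (a i + l)}

/-- The integer position of `x` in the `k`-th dyadic grid attached to `cube a l`. -/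
noncomputable def gridIndex {n : ℕ} (a : EuclideanSpace ℝ (Fin n)) (l : ℝ) (k : ℕ)
    (x : EuclideanSpace ℝ (Fin n)) : Fin n → ℤ :=
  fun i => ⌊(x i - a i) * 2 ^ k / l⌋

/-- The corner of the cube of the `k`-th dyadic grid that contains `x`. -/
noncomputable def gridCorner {n : ℕ} (a : EuclideanSpace ℝ (Fin n)) (l : ℝ) (k : ℕ)
    (x : EuclideanSpace ℝ (Fin n)) : EuclideanSpace ℝ (Fin n) :=
  WithLp.toLp 2 fun i => a i + l / 2 ^ k * gridIndex a l k x i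

/-- The cube of the `k`-th dyadic grid attached to `cube a l` that contains `x`. -/
noncomputable def gridCube {n : ℕ} (a : EuclideanSpace ℝ (Fin n)) (l : ℝ) (k : ℕ)
    (x : EuclideanSpace ℝ (Fin n)) : Set (EuclideanSpace ℝ (Fin n)) :=
  cube (gridCorner a l k x) (l / 2 ^ k)

section cubes

variable {n : ℕ} {a x y z : EuclideanSpace ℝ (Fin n)} {l : ℝ}

lemma self_mem_cube (hl : 0 < l) : a ∈ cube a l := fun i => ⟨le_rfl, by linarith⟩

lemma measurableSet_cube : MeasurableSet (cube a l) := by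
  have : cube a l = ⋂ i, (fun x : EuclideanSpace ℝ (Fin n) => x i) ⁻¹' Ico (a i) (a i + l) := by
    ext x; simp [cube]
  rw [this]
  exact MeasurableSet.iInter fun i => (by fun_prop : Measurable
    fun x : EuclideanSpace ℝ (Fin n) => x i) measurableSet_Ico

lemma volume_setOf_forall_mem (I : Fin n → Set ℝ) :
    volume {x : EuclideanSpace ℝ (Fin n) | ∀ i, x i ∈ I i} = ∏ i, volume (I i) := by
  have h := (EuclideanSpace.volume_preserving_symm_measurableEquiv_toLp (Fin n)).measure_preimage_equiv
    (Set.univ.pi I)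
  rw [volume_pi_pi] at h
  rw [← h]
  congr 1
  ext x
  simp

lemma volume_cube (hl : 0 < l) : volume (cube a l) = ENNReal.ofReal (l ^ n) := by
  have := volume_setOf_forall_mem (n := n) fun i => Ico (a i) (a i + l)
  rw [cube, this]
  simp [ENNReal.ofReal_pow hl.le]

lemma volume_cube_ne_top (hl : 0 < l) : volume (cube a l) ≠ ∞ := by
  rw [volume_cube hl]; exact ENNReal.ofReal_ne_top

lemma volume_cube_ne_zero (hl : 0 < l) : volume (cube a l) ≠ 0 := by
  rw [volume_cube hl]; simpa using pow_pos hl n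

lemma volume_real_cube (hl : 0 < l) : volume.real (cube a l) = l ^ n := by
  rw [Measure.real, volume_cube hl, ENNReal.toReal_ofReal (pow_pos hl n).le]

lemma isCube_cube (hl : 0 < l) : IsCube (cube a l) :=
  ⟨a, l, fun i => Ico (a i) (a i + l), hl, fun _ => ⟨Ioo_subset_Ico_self, Ico_subset_Icc_self⟩, rfl⟩

/-- Faces are null, since the open and the closed box have the same volume. Norms and averages do
not see them, so half-open cubes suffice from here on. -/
lemma IsCube.exists_ae_eq_cube {Q : Set (EuclideanSpace ℝ (Fin n))} (hQ : IsCube Q) :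
    ∃ (a : EuclideanSpace ℝ (Fin n)) (l : ℝ), 0 < l ∧
      Q =ᵐ[(volume : Measure (EuclideanSpace ℝ (Fin n)))] cube a l := by
  obtain ⟨a, l, I, hl, hI, rfl⟩ := hQ
  refine ⟨WithLp.toLp 2 a, l, hl, ?_⟩
  have key : ∀ J : Fin n → Set ℝ, (∀ i, Ioo (a i) (a i + l) ⊆ J i ∧ J i ⊆ Icc (a i) (a i + l)) →
      {x : EuclideanSpace ℝ (Fin n) | ∀ i, x i ∈ Ioo (a i) (a i + l)} =ᵐ[volume]
      {x : EuclideanSpace ℝ (Fin n) | ∀ i, x i ∈ J i} := by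
    intro J hJ
    have hv : ∀ i, volume (J i) = ENNReal.ofReal l := fun i => by
      apply le_antisymm
      · exact (measure_mono (hJ i).2).trans_eq (by simp)
      · refine le_trans (le_of_eq ?_) (measure_mono (hJ i).1); simp
    have hopen : MeasurableSet {x : EuclideanSpace ℝ (Fin n) | ∀ i, x i ∈ Ioo (a i) (a i + l)} := by
      rw [ofPred_forall]
      exact MeasurableSet.iInter fun i => (by fun_prop : Measurable
        fun x : EuclideanSpace ℝ (Fin n) => x i) measurableSet_Ioo
    refine ae_eq_of_subset_of_measure_ge (fun x hx i => (hJ i).1 (hx i)) ?_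
      hopen.nullMeasurableSet ?_
    · rw [volume_setOf_forall_mem, volume_setOf_forall_mem]
      simp [hv]
    · rw [volume_setOf_forall_mem]
      exact ENNReal.prod_ne_top fun i _ => by simp [hv]
  exact (key I hI).symm.trans (key _ fun i => ⟨Ioo_subset_Ico_self, Ico_subset_Icc_self⟩)

lemma norm_sub_le_of_mem_cube (hx : x ∈ cube a l) (hy : y ∈ cube a l) : ‖x - y‖ ≤ n * l := by
  have h1 : ∀ i, |x i - y i| ≤ l := fun i => by
    have := hx i; have := hy i
    simp only [mem_Ico] at *
    rw [abs_le]; constructor <;> linarith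
  calc ‖x - y‖ ≤ ∑ i, ‖(x - y) i‖ := by
        rw [EuclideanSpace.norm_eq]
        apply Real.sqrt_le_iff.2
        refine ⟨Finset.sum_nonneg fun i _ => norm_nonneg _, ?_⟩
        exact Finset.sum_sq_le_sq_sum_of_nonneg fun i _ => norm_nonneg _
    _ ≤ ∑ _i : Fin n, l := Finset.sum_le_sum fun i _ => by simpa using h1 i
    _ = n * l := by simp

lemma mem_gridCube (hl : 0 < l) (k : ℕ) :
    y ∈ gridCube a l k x ↔ gridIndex a l k y = gridIndex a l k x := by
  have h2 : (0 : ℝ) < 2 ^ k := by positivity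
  simp only [gridCube, cube, gridCorner, mem_ofPred_eq, funext_iff]
  refine forall_congr' fun i => ?_
  rw [show gridIndex a l k y i = ⌊(y i - a i) * 2 ^ k / l⌋ from rfl, Int.floor_eq_iff,
    le_div_iff₀ hl, div_lt_iff₀ hl, mem_Ico]
  generalize (gridIndex a l k x i : ℝ) = m
  have e1 : a i + l / 2 ^ k * m ≤ y i ↔ m * l ≤ (y i - a i) * 2 ^ k := by
    rw [← le_sub_iff_add_le', div_mul_eq_mul_div, div_le_iff₀ h2, mul_comm l m]
  have e2 : y i < a i + l / 2 ^ k * m + l / 2 ^ k ↔ (y i - a i) * 2 ^ k < (m + 1) * l := by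
    rw [show a i + l / 2 ^ k * m + l / 2 ^ k = a i + (m + 1) * l / 2 ^ k by ring,
      ← sub_lt_iff_lt_add', lt_div_iff₀ h2]
  rw [← e1, ← e2]

lemma self_mem_gridCube (hl : 0 < l) (k : ℕ) : x ∈ gridCube a l k x := (mem_gridCube hl k).2 rfl

lemma gridCorner_congr (hl : 0 < l) {k : ℕ} (h : y ∈ gridCube a l k x) :
    gridCorner a l k y = gridCorner a l k x := by
  rw [mem_gridCube hl] at h
  simp [gridCorner, h]

lemma gridCube_congr (hl : 0 < l) {k : ℕ} (h : y ∈ gridCube a l k x) :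
    gridCube a l k y = gridCube a l k x := by
  simp [gridCube, gridCorner_congr hl h]

lemma gridIndex_eq_div (hl : 0 < l) (k : ℕ) (i : Fin n) :
    gridIndex a l k x i = gridIndex a l (k + 1) x i / 2 := by
  have h := Int.floor_div_natCast ((x i - a i) * 2 ^ (k + 1) / l) 2
  simp only [gridIndex]
  push_cast at h
  rw [← h]
  congr 1
  field_simp
  ring

lemma gridCube_succ_subset (hl : 0 < l) (k : ℕ) : gridCube a l (k + 1) x ⊆ gridCube a l k x := by
  intro y hy
  rw [mem_gridCube hl] at hy ⊢
  ext i
  rw [gridIndex_eq_div hl k, gridIndex_eq_div hl k, hy]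

lemma gridCube_antitone (hl : 0 < l) : Antitone fun k => gridCube a l k x :=
  antitone_nat_of_succ_le fun k => gridCube_succ_subset hl k

lemma gridCube_zero (hl : 0 < l) (hx : x ∈ cube a l) : gridCube a l 0 x = cube a l := by
  have : gridCorner a l 0 x = a := by
    ext i
    have := hx i
    have h0 : ⌊(x i - a i) / l⌋ = 0 := by
      rw [Int.floor_eq_iff]
      simp only [mem_Ico] at this
      constructor
      · simp only [Int.cast_zero]; exact div_nonneg (by linarith) hl.le
      · rw [div_lt_iff₀ hl]; simp; linarith
    simp [gridCorner, gridIndex, h0]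
  simp [gridCube, this]

lemma gridCube_subset_cube (hl : 0 < l) (hx : x ∈ cube a l) (k : ℕ) :
    gridCube a l k x ⊆ cube a l := by
  rw [← gridCube_zero hl hx]; exact gridCube_antitone hl (Nat.zero_le k)

lemma gridSide_pos (hl : 0 < l) (k : ℕ) : 0 < l / 2 ^ k := by positivity

lemma measurableSet_gridCube (k : ℕ) : MeasurableSet (gridCube a l k x) := measurableSet_cube

lemma volume_gridCube (hl : 0 < l) (k : ℕ) :
    volume (gridCube a l k x) = ENNReal.ofReal ((l / 2 ^ k) ^ n) := volume_cube (gridSide_pos hl k)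

lemma volume_gridCube_ne_top (hl : 0 < l) (k : ℕ) : volume (gridCube a l k x) ≠ ∞ :=
  volume_cube_ne_top (gridSide_pos hl k)

lemma countable_range_gridCube : (range fun q : ℕ × EuclideanSpace ℝ (Fin n) =>
    gridCube a l q.1 q.2).Countable := by
  refine (countable_range fun q : ℕ × (Fin n → ℤ) => cube (WithLp.toLp 2 fun i =>
    a i + l / 2 ^ q.1 * q.2 i) (l / 2 ^ q.1)).mono ?_
  rintro _ ⟨⟨k, x⟩, rfl⟩
  exact ⟨(k, gridIndex a l k x), rfl⟩

/-- Two measures that compare on all cubes of a stopping family compare on their union. -/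
lemma measure_le_of_gridCube (hl : 0 < l) {μ ν : Measure (EuclideanSpace ℝ (Fin n))}
    {U : Set (EuclideanSpace ℝ (Fin n))} (κ : EuclideanSpace ℝ (Fin n) → ℕ)
    (hκ : ∀ y ∈ U, ∀ z ∈ gridCube a l (κ y) y, z ∈ U ∧ κ z = κ y)
    (h : ∀ y ∈ U, μ (gridCube a l (κ y) y) ≤ ν (gridCube a l (κ y) y)) : μ U ≤ ν U := by
  set S : Set (Set (EuclideanSpace ℝ (Fin n))) := (fun y => gridCube a l (κ y) y) '' U with hS
  have hc : S.Countable := countable_range_gridCube.mono (by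
    rintro _ ⟨y, -, rfl⟩; exact ⟨(κ y, y), rfl⟩)
  have hU : U = ⋃₀ S := by
    apply subset_antisymm
    · intro y hy
      exact ⟨_, ⟨y, hy, rfl⟩, self_mem_gridCube hl _⟩
    · rintro z ⟨_, ⟨y, hy, rfl⟩, hz⟩
      exact (hκ y hy z hz).1
  have hd : S.PairwiseDisjoint id := by
    rintro _ ⟨y, hy, rfl⟩ _ ⟨y', hy', rfl⟩ hne
    refine Set.disjoint_left.2 fun z hz hz' => hne ?_
    have h1 := (hκ y hy z hz).2
    have h2 := (hκ y' hy' z hz').2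
    have e1 := gridCube_congr hl hz
    have e2 := gridCube_congr hl hz'
    simp only
    rw [← e1, ← e2, ← h1, ← h2]
  have hm : ∀ s ∈ S, MeasurableSet s := by
    rintro _ ⟨y, -, rfl⟩; exact measurableSet_gridCube _
  rw [hU, measure_sUnion hc hd hm, measure_sUnion hc hd hm]
  refine ENNReal.tsum_le_tsum ?_
  rintro ⟨_, y, hy, rfl⟩
  exact h y hy

lemma exists_gridCube_subset (hl : 0 < l) {U : Set (EuclideanSpace ℝ (Fin n))} (hU : IsOpen U)
    (hx : x ∈ U) : ∃ k, gridCube a l k x ⊆ U := by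
  obtain ⟨ε, hε, hb⟩ := Metric.isOpen_iff.1 hU x hx
  have ht : Filter.Tendsto (fun k : ℕ => n * (l / 2 ^ k)) Filter.atTop (nhds 0) := by
    have := (tendsto_pow_atTop_nhds_zero_of_lt_one (r := (1 / 2 : ℝ)) (by norm_num)
      (by norm_num)).const_mul (n * l)
    simp only [mul_zero] at this
    refine this.congr fun k => ?_
    rw [one_div, inv_pow]; ring
  obtain ⟨k, hk⟩ := (ht.eventually (gt_mem_nhds hε)).exists
  refine ⟨k, fun y hy => hb ?_⟩
  rw [Metric.mem_ball, dist_eq_norm]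
  exact (norm_sub_le_of_mem_cube hy (self_mem_gridCube hl k)).trans_lt hk

/-- A set whose density in all grid cubes around its points is at most `γ < 1` is null. -/
lemma measure_eq_zero_of_density_le (hl : 0 < l) {E : Set (EuclideanSpace ℝ (Fin n))}
    (hfin : volume E ≠ ∞) {γ : ℝ≥0∞} (hγ : γ < 1)
    (h : ∀ x ∈ E, ∀ k, volume (E ∩ gridCube a l k x) ≤ γ * volume (gridCube a l k x)) :
    volume E = 0 := by
  classical
  have key : ∀ U, E ⊆ U → IsOpen U → volume E ≤ γ * volume U := by
    intro U hEU hU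
    have hex : ∀ y ∈ U, ∃ k, gridCube a l k y ⊆ U := fun y hy => exists_gridCube_subset hl hU hy
    -- The first generation whose cube lies in `U`: these cubes tile the open set `U`, and the
    -- density hypothesis applies to each one that meets `E`.
    set κ : EuclideanSpace ℝ (Fin n) → ℕ := fun y =>
      if hy : ∃ k, gridCube a l k y ⊆ U then Nat.find hy else 0 with hκ
    have hsub : ∀ y ∈ U, gridCube a l (κ y) y ⊆ U := fun y hy => by
      simp only [hκ, dif_pos (hex y hy)]; exact Nat.find_spec (hex y hy)
    have := measure_le_of_gridCube (a := a) hl (μ := volume.restrict E) (ν := γ • volume) (U := U) κ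
      (fun y hy z hz => by
        have hzU := hsub y hy hz
        refine ⟨hzU, ?_⟩
        simp only [hκ, dif_pos (hex y hy), dif_pos (hex z hzU)] at hz ⊢
        rw [Nat.find_eq_iff]
        refine ⟨by rw [gridCube_congr hl hz]; exact Nat.find_spec (hex y hy), fun m hm => ?_⟩
        rw [gridCube_congr hl (gridCube_antitone hl hm.le hz)]
        exact Nat.find_min (hex y hy) hm)
      (fun y hy => by
        rw [Measure.restrict_apply (measurableSet_gridCube _), inter_comm]
        rcases (E ∩ gridCube a l (κ y) y).eq_empty_or_nonempty with he | ⟨x, hxE, hx⟩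
        · simp [he]
        · have := h x hxE (κ y)
          rw [gridCube_congr hl hx] at this
          simpa using this)
    rw [Measure.restrict_apply hU.measurableSet, inter_eq_right.2 hEU] at this
    simpa using this
  by_contra hne
  have hlt : γ * volume E < volume E := by
    calc γ * volume E < 1 * volume E := by
          rw [ENNReal.mul_lt_mul_iff_left hne hfin]; exact hγ
      _ = volume E := one_mul _
  rcases eq_or_ne γ 0 with rfl | hγ0
  · exact hne (le_antisymm (by simpa using key univ (subset_univ _) isOpen_univ) zero_le)
  -- Outer regularity supplies an open `U ⊇ E` of volume below `|E| / γ`, against `|E| ≤ γ |U|`.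
  have hlt' : volume E < volume E / γ := by
    rw [ENNReal.lt_div_iff_mul_lt (Or.inl hγ0) (Or.inl hγ.ne_top), mul_comm]; exact hlt
  obtain ⟨U, hEU, hU, hv⟩ := E.exists_isOpen_lt_of_lt _ hlt'
  have h1 := key U hEU hU
  rw [ENNReal.lt_div_iff_mul_lt (Or.inl hγ0) (Or.inl hγ.ne_top), mul_comm] at hv
  exact absurd h1 (not_le.2 hv)

end cubes

end VariableWeights

/-! ### Stopping times on the grid and a John–Nirenberg argument -/

namespace VariableWeights

section stopping

variable {n : ℕ} {a x y z : EuclideanSpace ℝ (Fin n)} {l : ℝ}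

lemma measurableSet_of_gridCube_subset (k : ℕ) (hl : 0 < l)
    {U : Set (EuclideanSpace ℝ (Fin n))} (h : ∀ y ∈ U, gridCube a l k y ⊆ U) :
    MeasurableSet U := by
  have hU : U = ⋃₀ ((fun y => gridCube a l k y) '' U) := by
    apply subset_antisymm
    · exact fun y hy => ⟨_, ⟨y, hy, rfl⟩, self_mem_gridCube hl _⟩
    · rintro z ⟨_, ⟨y, hy, rfl⟩, hz⟩
      exact h y hy hz
  rw [hU]
  refine MeasurableSet.sUnion ((countable_range_gridCube (a := a) (l := l)).mono ?_) ?_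
  · rintro _ ⟨y, -, rfl⟩; exact ⟨(k, y), rfl⟩
  · rintro _ ⟨y, -, rfl⟩; exact measurableSet_gridCube _

variable {φ : ℕ → EuclideanSpace ℝ (Fin n) → ℝ}

lemma measurable_of_gridCube (hl : 0 < l) {g : EuclideanSpace ℝ (Fin n) → ℝ} (k : ℕ)
    (hg : ∀ x, ∀ y ∈ gridCube a l k x, g y = g x) : Measurable g := by
  intro s _
  refine measurableSet_of_gridCube_subset (a := a) (l := l) k hl fun y hy z hz => ?_
  rw [mem_preimage, hg y z hz]; exact hy

lemma measurableSet_exists_lt (hl : 0 < l) (hφ : ∀ k x, ∀ y ∈ gridCube a l k x, φ k y = φ k x)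
    (k : ℕ) (t : ℝ) : MeasurableSet {y | ∃ j, k ≤ j ∧ t < φ j y} := by
  have : {y | ∃ j, k ≤ j ∧ t < φ j y} = ⋃ j, ⋃ (_ : k ≤ j), {y | t < φ j y} := by
    ext y; simp
  rw [this]
  exact MeasurableSet.iUnion fun j => MeasurableSet.iUnion fun _ =>
    measurableSet_lt measurable_const (measurable_of_gridCube hl j (hφ j))

/-- The first generation at least `k` at which `φ` exceeds `t`. -/
noncomputable def firstTime (φ : ℕ → EuclideanSpace ℝ (Fin n) → ℝ) (k : ℕ) (t : ℝ)
    (y : EuclideanSpace ℝ (Fin n)) : ℕ :=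
  open Classical in if h : ∃ j, k ≤ j ∧ t < φ j y then Nat.find h else 0

lemma firstTime_spec {k : ℕ} {t : ℝ} (h : ∃ j, k ≤ j ∧ t < φ j y) :
    k ≤ firstTime φ k t y ∧ t < φ (firstTime φ k t y) y := by
  classical
  simp only [firstTime, dif_pos h]
  convert Nat.find_spec h

lemma firstTime_le {k j : ℕ} {t : ℝ} (hj : k ≤ j) (ht : t < φ j y) : firstTime φ k t y ≤ j := by
  classical
  have h : ∃ j, k ≤ j ∧ t < φ j y := ⟨j, hj, ht⟩
  simp only [firstTime, dif_pos h]
  convert Nat.find_min' h ⟨hj, ht⟩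

/-- The stopping generation is constant on a stopping cube: `φ j` is constant on cubes of generation
`j` and the cubes are nested. Stopping cubes are therefore disjoint or equal, as
`measure_le_of_gridCube` requires. -/
lemma firstTime_congr (hl : 0 < l) (hφ : ∀ k x, ∀ y ∈ gridCube a l k x, φ k y = φ k x)
    {k : ℕ} {t : ℝ} (h : ∃ j, k ≤ j ∧ t < φ j y)
    (hz : z ∈ gridCube a l (firstTime φ k t y) y) :
    (∃ j, k ≤ j ∧ t < φ j z) ∧ firstTime φ k t z = firstTime φ k t y := by
  obtain ⟨h1, h2⟩ := firstTime_spec h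
  have h3 : t < φ (firstTime φ k t y) z := by rw [hφ _ y z hz]; exact h2
  have h4 := firstTime_le h1 h3
  have hz' : ∃ j, k ≤ j ∧ t < φ j z := ⟨_, h1, h3⟩
  refine ⟨hz', le_antisymm h4 ?_⟩
  obtain ⟨h5, h6⟩ := firstTime_spec hz'
  refine firstTime_le h5 ?_
  rwa [hφ _ y z (gridCube_antitone hl h4 hz)] at h6

/-- Cut the set where `φ` ever exceeds `t` into stopping cubes. On each, `φ` has overshot `t` by at
most one jump `D`, so a point where `φ` later exceeds `t + L + D` lies in the set of density `θ`
that `h2` provides for that cube. -/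
lemma exists_lt_decay (hl : 0 < l) (hφ : ∀ k x, ∀ y ∈ gridCube a l k x, φ k y = φ k x)
    {D L θ : ℝ} (hD : 0 ≤ D) (hL : 0 ≤ L) {μ : Measure (EuclideanSpace ℝ (Fin n))}
    (h1 : ∀ x ∈ cube a l, ∀ k, φ (k + 1) x ≤ φ k x + D)
    (h2 : ∀ x ∈ cube a l, ∀ k, μ (gridCube a l k x ∩ {y | ∃ j, k ≤ j ∧ φ k x + L < φ j y}) ≤
      ENNReal.ofReal θ * μ (gridCube a l k x)) {t : ℝ} (ht : φ 0 a ≤ t) :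
    μ (cube a l ∩ {y | ∃ j, 0 ≤ j ∧ t + (L + D) < φ j y}) ≤
      ENNReal.ofReal θ * μ (cube a l ∩ {y | ∃ j, 0 ≤ j ∧ t < φ j y}) := by
  have hms := fun t => measurableSet_exists_lt hl hφ 0 t
  have key := measure_le_of_gridCube (a := a) hl
    (μ := μ.restrict (cube a l ∩ {y | ∃ j, 0 ≤ j ∧ t + (L + D) < φ j y}))
    (ν := ENNReal.ofReal θ • μ) (U := cube a l ∩ {y | ∃ j, 0 ≤ j ∧ t < φ j y})
    (firstTime φ 0 t)
    (fun y hy z hz => by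
      obtain ⟨h3, h4⟩ := firstTime_congr hl hφ hy.2 hz
      exact ⟨⟨gridCube_subset_cube hl hy.1 _ hz, h3⟩, h4⟩)
    (fun y hy => by
      rw [Measure.restrict_apply (measurableSet_gridCube _), Measure.smul_apply, smul_eq_mul]
      refine le_trans (measure_mono ?_) (h2 y hy.1 _)
      rintro z ⟨hz, hzQ, j, -, hj⟩
      refine ⟨hz, j, ?_, ?_⟩
      · rw [← (firstTime_congr hl hφ hy.2 hz).2]
        exact firstTime_le (Nat.zero_le _) (by linarith)
      · obtain ⟨-, h6⟩ := firstTime_spec hy.2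
        have h5 : φ (firstTime φ 0 t y) y ≤ t + D := by
          -- Stopping at generation 0 is impossible because `φ 0 ≤ t`; otherwise the previous
          -- generation was still at most `t`.
          rcases Nat.eq_zero_or_pos (firstTime φ 0 t y) with h0 | h0
          · rw [h0] at h6 ⊢
            rw [hφ 0 a y (by rw [gridCube_zero hl (self_mem_cube hl)]; exact hy.1)] at h6 ⊢
            linarith
          · obtain ⟨m, hm⟩ := Nat.exists_eq_succ_of_ne_zero h0.ne'
            have h7 : φ m y ≤ t := by
              by_contra hc
              have := firstTime_le (φ := φ) (Nat.zero_le m) (not_le.1 hc)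
              omega
            have := h1 y hy.1 m
            rw [hm]
            linarith
        linarith)
  rw [Measure.restrict_apply (measurableSet_cube.inter (hms t)), Measure.smul_apply,
    smul_eq_mul] at key
  refine le_trans (measure_mono ?_) key
  rintro y ⟨hy, j, hj, h⟩
  exact ⟨⟨hy, j, hj, by linarith⟩, hy, j, hj, h⟩

/-- Exponential integrability from a stopping time argument on the dyadic grid. -/
theorem exists_lintegral_exp_le (n : ℕ) {D L H θ γ : ℝ} (hD : 0 ≤ D) (hL : 0 < L)
    (hθ : 0 ≤ θ) (hθ1 : θ < 1) (hγ : γ < 1) :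
    ∃ s C : ℝ, 0 < s ∧ 0 < C ∧ ∀ (a : EuclideanSpace ℝ (Fin n)) (l : ℝ), 0 < l →
      ∀ (μ : Measure (EuclideanSpace ℝ (Fin n))), μ ≪ volume →
      ∀ (f : EuclideanSpace ℝ (Fin n) → ℝ) (φ : ℕ → EuclideanSpace ℝ (Fin n) → ℝ),
      Measurable f → (∀ k x, ∀ y ∈ gridCube a l k x, φ k y = φ k x) →
      (∀ x ∈ cube a l, ∀ k, φ (k + 1) x ≤ φ k x + D) →
      (∀ x ∈ cube a l, ∀ k, μ (gridCube a l k x ∩ {y | ∃ j, k ≤ j ∧ φ k x + L < φ j y}) ≤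
        ENNReal.ofReal θ * μ (gridCube a l k x)) →
      (∀ x ∈ cube a l, ∀ k, volume (gridCube a l k x ∩ {y | φ k x + H < f y}) ≤
        ENNReal.ofReal γ * volume (gridCube a l k x)) →
      ∫⁻ x in cube a l, ENNReal.ofReal (Real.exp (s * (f x - φ 0 a))) ∂μ ≤
        ENNReal.ofReal C * μ (cube a l) := by
  set M := L + D with hM
  have hMpos : 0 < M := by linarith
  -- Chosen so that `exp (s M) θ = 2 θ / (1 + θ) < 1`, the ratio of the geometric series below.
  set s := Real.log (2 / (1 + θ)) / M with hs
  have hs0 : 0 < s := div_pos (Real.log_pos (by rw [lt_div_iff₀] <;> linarith)) hMpos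
  have hq : Real.exp (s * M) * θ < 1 := by
    rw [hs, div_mul_cancel₀ _ hMpos.ne', Real.exp_log (by positivity), div_mul_eq_mul_div,
      div_lt_one (by linarith)]
    linarith
  have hq0 : 0 ≤ Real.exp (s * M) * θ := by positivity
  set q := Real.exp (s * M) * θ with hqdef
  refine ⟨s, Real.exp (s * H) + Real.exp (s * H + s * M) * (1 - q)⁻¹, hs0,
    add_pos_of_pos_of_nonneg (Real.exp_pos _)
      (mul_nonneg (Real.exp_pos _).le (inv_nonneg.2 (by linarith))), ?_⟩
  intro a l hl μ hμ f φ hf hφ h1 h2 h3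
  set Ω : ℝ → Set (EuclideanSpace ℝ (Fin n)) :=
    fun t => cube a l ∩ {y | ∃ j, 0 ≤ j ∧ t < φ j y} with hΩ
  have hΩm : ∀ t, MeasurableSet (Ω t) := fun t =>
    measurableSet_cube.inter (measurableSet_exists_lt hl hφ 0 t)
  have hdecay : ∀ k : ℕ, μ (Ω (φ 0 a + k * M)) ≤ ENNReal.ofReal (θ ^ k) * μ (cube a l) := by
    intro k
    induction k with
    | zero => simpa using measure_mono inter_subset_left
    | succ k ih =>
      have := exists_lt_decay hl hφ hD hL.le h1 h2 (t := φ 0 a + k * M)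
        (by have : (0 : ℝ) ≤ k * M := by positivity
            linarith)
      rw [show φ 0 a + ((k + 1 : ℕ) : ℝ) * M = φ 0 a + k * M + (L + D) by push_cast; ring]
      refine this.trans ?_
      rw [pow_succ', ENNReal.ofReal_mul hθ, mul_assoc]
      gcongr
  -- Outside `Ω t` every `φ k` stays below `t`, so `f > t + H` has density at most `γ < 1` in each
  -- grid cube around such a point. This turns bounds on `φ` into bounds on `f`, for Lebesgue
  -- measure and hence for `μ`.
  have hnull : ∀ t, volume ((cube a l \ Ω t) ∩ {y | t + H < f y}) = 0 := by
    intro t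
    refine measure_eq_zero_of_density_le (a := a) hl
      (measure_ne_top_of_subset (fun x hx => hx.1.1) (volume_cube_ne_top (a := a) hl))
      (γ := ENNReal.ofReal γ) (by simpa using hγ) fun x hx k => ?_
    refine le_trans (measure_mono ?_) (h3 x hx.1.1 k)
    rintro y ⟨hy, hyx⟩
    refine ⟨hyx, ?_⟩
    have : φ k x ≤ t := by
      by_contra hc
      exact hx.1.2 ⟨hx.1.1, k, Nat.zero_le _, not_le.1 hc⟩
    have h5 : t + H < f y := hy.2
    simp only [mem_ofPred_eq]
    linarith
  have htail : ∀ k : ℕ, μ (cube a l ∩ {y | φ 0 a + k * M + H < f y}) ≤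
      ENNReal.ofReal (θ ^ k) * μ (cube a l) := by
    intro k
    refine le_trans ?_ (hdecay k)
    calc μ (cube a l ∩ {y | φ 0 a + k * M + H < f y})
        ≤ μ (Ω (φ 0 a + k * M) ∪
          (cube a l \ Ω (φ 0 a + k * M)) ∩ {y | φ 0 a + k * M + H < f y}) := by
          refine measure_mono fun y hy => ?_
          by_cases hyΩ : y ∈ Ω (φ 0 a + k * M)
          · exact Or.inl hyΩ
          · exact Or.inr ⟨⟨hy.1, hyΩ⟩, hy.2⟩
      _ ≤ _ := by
          refine (measure_union_le _ _).trans ?_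
          rw [hμ (hnull _), add_zero]
  have hpt : ∀ x, ENNReal.ofReal (Real.exp (s * (f x - φ 0 a))) ≤
      ENNReal.ofReal (Real.exp (s * H)) + ∑' k : ℕ, ({y | φ 0 a + k * M + H < f y}.indicator
        (fun _ => ENNReal.ofReal (Real.exp (s * H + s * M) * Real.exp (s * M) ^ k)) x) := by
    intro x
    rcases le_or_gt (f x) (φ 0 a + H) with hle | hgt
    · refine le_add_right (ENNReal.ofReal_le_ofReal (Real.exp_le_exp.2 ?_))
      gcongr; linarith
    · refine le_add_left ?_
      set u := (f x - φ 0 a - H) / M with hu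
      have hu0 : 0 < u := div_pos (by linarith) hMpos
      -- With `k + 1 = ⌈u⌉` one has `k < u ≤ k + 1`: the strict side puts `x` in the `k`-th level
      -- set, the other bounds the exponential by the `k`-th term.
      have hc : 0 < ⌈u⌉₊ := Nat.ceil_pos.2 hu0
      obtain ⟨k, hk⟩ := Nat.exists_eq_succ_of_ne_zero hc.ne'
      have hk1 : (k : ℝ) < u := by
        apply Nat.lt_ceil.1; omega
      have hk2 : u ≤ k + 1 := by
        have := Nat.le_ceil u
        rw [hk] at this; push_cast at this; exact this
      have hfu : f x - φ 0 a - H = u * M := by rw [hu, div_mul_cancel₀ _ hMpos.ne']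
      have hmem : x ∈ {y | φ 0 a + k * M + H < f y} := by
        simp only [mem_ofPred_eq]
        have := mul_lt_mul_of_pos_right hk1 hMpos
        linarith
      refine le_trans ?_ (ENNReal.le_tsum k)
      rw [indicator_of_mem hmem, ← Real.exp_nat_mul, ← Real.exp_add]
      refine ENNReal.ofReal_le_ofReal (Real.exp_le_exp.2 ?_)
      have h6 : f x - φ 0 a ≤ H + (k + 1) * M := by
        have := mul_le_mul_of_nonneg_right hk2 hMpos.le
        linarith
      have := mul_le_mul_of_nonneg_left h6 hs0.le
      linarith
  have hfm : ∀ t : ℝ, MeasurableSet {y | t < f y} := fun t => measurableSet_lt measurable_const hf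
  calc ∫⁻ x in cube a l, ENNReal.ofReal (Real.exp (s * (f x - φ 0 a))) ∂μ
      ≤ ∫⁻ x in cube a l, (ENNReal.ofReal (Real.exp (s * H)) +
        ∑' k : ℕ, ({y | φ 0 a + k * M + H < f y}.indicator
        (fun _ => ENNReal.ofReal (Real.exp (s * H + s * M) * Real.exp (s * M) ^ k)) x)) ∂μ :=
        lintegral_mono hpt
    _ = ENNReal.ofReal (Real.exp (s * H)) * μ (cube a l) +
        ∑' k : ℕ, ENNReal.ofReal (Real.exp (s * H + s * M) * Real.exp (s * M) ^ k) *
          μ (cube a l ∩ {y | φ 0 a + k * M + H < f y}) := by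
        rw [lintegral_add_left measurable_const, lintegral_tsum fun k =>
          (measurable_const.indicator (hfm _)).aemeasurable]
        simp only [lintegral_const, lintegral_indicator_const (hfm _), Measure.restrict_apply
          MeasurableSet.univ, univ_inter, Measure.restrict_apply (hfm _)]
        simp only [inter_comm]
    _ ≤ ENNReal.ofReal (Real.exp (s * H)) * μ (cube a l) +
        ∑' k : ℕ, ENNReal.ofReal (Real.exp (s * H + s * M)) * (ENNReal.ofReal q ^ k *
          μ (cube a l)) := by
        refine add_le_add le_rfl (ENNReal.tsum_le_tsum fun k => ?_)
        calc _ ≤ ENNReal.ofReal (Real.exp (s * H + s * M) * Real.exp (s * M) ^ k) *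
              (ENNReal.ofReal (θ ^ k) * μ (cube a l)) := by gcongr; exact htail k
          _ = ENNReal.ofReal (Real.exp (s * H + s * M)) * (ENNReal.ofReal q ^ k *
                μ (cube a l)) := by
              rw [hqdef, ENNReal.ofReal_mul (Real.exp_pos _).le,
                ENNReal.ofReal_mul (Real.exp_pos _).le, mul_pow,
                ENNReal.ofReal_pow (Real.exp_pos _).le, ENNReal.ofReal_pow hθ]
              ring
    _ = _ := by
        rw [ENNReal.tsum_mul_left, ENNReal.tsum_mul_right, ENNReal.tsum_geometric,
          ENNReal.ofReal_add (Real.exp_pos _).le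
            (mul_nonneg (Real.exp_pos _).le (inv_nonneg.2 (by linarith))),
          ENNReal.ofReal_mul (p := Real.exp (s * H + s * M)) (Real.exp_pos _).le,
          ENNReal.ofReal_inv_of_pos (x := 1 - q) (by linarith),
          ENNReal.ofReal_sub 1 hq0, ENNReal.ofReal_one]
        ring

/-- The set covered by grid cubes on which `φ` is large is controlled by the set where `f` is
large, if on most of each grid cube `f` is not much smaller than `φ`. -/
lemma measure_exists_lt_le (hl : 0 < l) (hφ : ∀ k x, ∀ y ∈ gridCube a l k x, φ k y = φ k x)
    {f : EuclideanSpace ℝ (Fin n) → ℝ} (hf : Measurable f) {H L ε : ℝ} (hε : 0 ≤ ε)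
    (h : ∀ x ∈ cube a l, ∀ k, volume (gridCube a l k x ∩ {y | f y < φ k x - H}) ≤
      ENNReal.ofReal ε * volume (gridCube a l k x)) (hx : x ∈ cube a l) (k : ℕ) :
    ENNReal.ofReal (1 - ε) * volume (gridCube a l k x ∩ {y | ∃ j, k ≤ j ∧ φ k x + L < φ j y}) ≤
      volume (gridCube a l k x ∩ {y | φ k x + L - H ≤ f y}) := by
  set G := gridCube a l k x ∩ {y | φ k x + L - H ≤ f y} with hG
  have hGm : MeasurableSet G :=
    (measurableSet_gridCube k).inter (measurableSet_le measurable_const hf)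
  -- On a stopping cube of generation `j`, `f ≥ φ j - H > φ k + L - H` off a part of density `ε`;
  -- summing over the stopping cubes gives the claim.
  have key := measure_le_of_gridCube (a := a) hl
    (μ := ENNReal.ofReal (1 - ε) • volume) (ν := volume.restrict G)
    (U := gridCube a l k x ∩ {y | ∃ j, k ≤ j ∧ φ k x + L < φ j y})
    (firstTime φ k (φ k x + L))
    (fun y hy z hz => by
      obtain ⟨h3, h4⟩ := firstTime_congr hl hφ hy.2 hz
      have := gridCube_antitone hl (firstTime_spec hy.2).1 hz
      exact ⟨⟨by simpa only [gridCube_congr hl hy.1] using this, h3⟩, h4⟩)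
    (fun y hy => by
      obtain ⟨h3, h4⟩ := firstTime_spec hy.2
      set j := firstTime φ k (φ k x + L) y
      have hsub : gridCube a l j y ⊆ gridCube a l k x := by
        rw [← gridCube_congr hl hy.1]; exact gridCube_antitone hl h3
      have h5 := h y (gridCube_subset_cube hl hx k hy.1) j
      rw [Measure.restrict_apply (measurableSet_gridCube _), Measure.smul_apply, smul_eq_mul,
        ENNReal.ofReal_sub _ hε, ENNReal.ofReal_one,
        ENNReal.sub_mul fun _ _ => volume_gridCube_ne_top hl j, one_mul]
      refine tsub_le_iff_right.2 ?_
      calc volume (gridCube a l j y) ≤ volume ((gridCube a l j y ∩ G) ∪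
            (gridCube a l j y ∩ {y' | f y' < φ j y - H})) := by
            refine measure_mono fun z hz => ?_
            by_cases hc : f z < φ j y - H
            · exact Or.inr ⟨hz, hc⟩
            · refine Or.inl ⟨hz, hsub hz, ?_⟩
              simp only [mem_ofPred_eq]
              linarith
        _ ≤ _ := (measure_union_le _ _).trans (by gcongr))
  rw [Measure.smul_apply, smul_eq_mul] at key
  refine key.trans ?_
  rw [Measure.restrict_apply' hGm]
  exact measure_mono inter_subset_right

end stopping

end VariableWeights

/-! ### A reverse Hölder inequality from dyadic bounds -/

namespace VariableWeights

section reverse_holder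

variable {n : ℕ} {a x y z : EuclideanSpace ℝ (Fin n)} {l : ℝ}

lemma exp_mul_measure_le_setLIntegral {f : EuclideanSpace ℝ (Fin n) → ℝ} (t : ℝ)
    {S T : Set (EuclideanSpace ℝ (Fin n))} (hT : MeasurableSet T) (hTS : T ⊆ S)
    (h : ∀ y ∈ T, t ≤ f y) :
    ENNReal.ofReal (Real.exp t) * volume T ≤ ∫⁻ y in S, ENNReal.ofReal (Real.exp (f y)) := by
  calc _ = ∫⁻ _ in T, ENNReal.ofReal (Real.exp t) := by simp
    _ ≤ ∫⁻ y in T, ENNReal.ofReal (Real.exp (f y)) :=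
        setLIntegral_mono' hT fun y hy => ENNReal.ofReal_le_ofReal (Real.exp_le_exp.2 (h y hy))
    _ ≤ _ := lintegral_mono_set hTS

/-- A removal estimate: if `V` and `W` have density at most `v` and `w` in `S`, the remaining
points have density at least `1 - v - w`. -/
lemma measure_diff_ge {S V W : Set (EuclideanSpace ℝ (Fin n))} {v w : ℝ} (hv : 0 ≤ v) (hw : 0 ≤ w)
    (hS : volume S ≠ ∞)
    (hV : volume (S ∩ V) ≤ ENNReal.ofReal v * volume S)
    (hW : volume (S ∩ W) ≤ ENNReal.ofReal w * volume S) :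
    ENNReal.ofReal (1 - v - w) * volume S ≤ volume (S \ (V ∪ W)) := by
  rw [sub_sub, ENNReal.ofReal_sub _ (add_nonneg hv hw), ENNReal.ofReal_one,
    ENNReal.sub_mul fun _ _ => hS, one_mul, tsub_le_iff_right, ENNReal.ofReal_add hv hw, add_mul]
  calc volume S ≤ volume ((S \ (V ∪ W)) ∪ ((S ∩ V) ∪ (S ∩ W))) := by
        refine measure_mono fun y hy => ?_
        by_cases h1 : y ∈ V
        · exact Or.inr (Or.inl ⟨hy, h1⟩)
        · by_cases h2 : y ∈ W
          · exact Or.inr (Or.inr ⟨hy, h2⟩)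
          · exact Or.inl ⟨hy, by simp [h1, h2]⟩
    _ ≤ _ := (measure_union_le _ _).trans (by gcongr; exact (measure_union_le _ _).trans (by gcongr))

/-- Reverse Hölder inequality for `exp f` from dyadic bounds on its averages. -/
theorem exists_reverse_holder (n : ℕ) {A H : ℝ} (hA : 1 ≤ A) (hH : 0 ≤ H) :
    ∃ s C : ℝ, 0 < s ∧ 0 < C ∧ ∀ (a : EuclideanSpace ℝ (Fin n)) (l : ℝ), 0 < l →
      ∀ (f : EuclideanSpace ℝ (Fin n) → ℝ) (φ : ℕ → EuclideanSpace ℝ (Fin n) → ℝ),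
      Measurable f → (∀ k x, ∀ y ∈ gridCube a l k x, φ k y = φ k x) →
      (∀ x ∈ cube a l, ∀ k, ∫⁻ y in gridCube a l k x, ENNReal.ofReal (Real.exp (f y)) ≤
        ENNReal.ofReal (A * Real.exp (φ k x)) * volume (gridCube a l k x)) →
      (∀ x ∈ cube a l, ∀ k, volume (gridCube a l k x ∩ {y | f y < φ k x - H}) ≤
        ENNReal.ofReal (1 / 4) * volume (gridCube a l k x)) →
      ∫⁻ x in cube a l, ENNReal.ofReal (Real.exp ((1 + s) * (f x - φ 0 a))) ≤
        ENNReal.ofReal C * volume (cube a l) := by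
  -- The jump to a child: its mass is at least `exp (φ - H) / 2` times its volume, and at most the
  -- mass of the parent, whose volume is `2 ^ n` times larger.
  set D : ℝ := Real.log (2 * A * 2 ^ n) + H with hD
  have hD0 : 0 ≤ D := by
    have : (1 : ℝ) ≤ 2 ^ n := one_le_pow₀ (by norm_num)
    exact add_nonneg (Real.log_nonneg (by nlinarith)) hH
  -- Makes the threshold `φ + L - H` equal to `φ + log (8 A)`, which `f` exceeds on at most one
  -- eighth of the cube by Markov.
  set L : ℝ := Real.log (8 * A) + H with hL
  have hL0 : 0 < L := add_pos_of_pos_of_nonneg (Real.log_pos (by linarith)) hH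
  have hδ : Real.exp (-H) / (2 * A) ≤ 1 := by
    rw [div_le_one (by linarith)]
    have : Real.exp (-H) ≤ 1 := Real.exp_le_one_iff.2 (by linarith)
    linarith
  have hδ0 : 0 < Real.exp (-H) / (2 * A) := by positivity
  obtain ⟨s, C, hs, hC, hStopping⟩ := exists_lintegral_exp_le n (D := D) (L := L)
    (H := Real.log (2 * A)) (θ := 1 - Real.exp (-H) / (2 * A)) (γ := 1 / 2) hD0 hL0
    (by linarith) (by linarith) (by norm_num)
  refine ⟨s, C * A, hs, by positivity, ?_⟩
  intro a l hl f φ hf hφ h1 h2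
  -- The stopping argument is run for `exp f dx`: integrability of `exp (s f)` against it is
  -- integrability of `exp ((1 + s) f)`.
  set μ : Measure (EuclideanSpace ℝ (Fin n)) :=
    volume.withDensity fun y => ENNReal.ofReal (Real.exp (f y)) with hμ
  have hfe : Measurable fun y => ENNReal.ofReal (Real.exp (f y)) := by fun_prop
  have hμa : ∀ S : Set (EuclideanSpace ℝ (Fin n)), MeasurableSet S →
      μ S = ∫⁻ y in S, ENNReal.ofReal (Real.exp (f y)) := fun S hS => withDensity_apply _ hS
  have hχ : ∀ x ∈ cube a l, ∀ k (t : ℝ), ENNReal.ofReal (Real.exp t) *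
      volume (gridCube a l k x ∩ {y | t ≤ f y}) ≤
      ENNReal.ofReal (A * Real.exp (φ k x)) * volume (gridCube a l k x) := fun x hx k t =>
    (exp_mul_measure_le_setLIntegral t ((measurableSet_gridCube k).inter
      (measurableSet_le measurable_const hf)) inter_subset_left fun y hy => hy.2).trans (h1 x hx k)
  have hupper : ∀ x ∈ cube a l, ∀ k (t c : ℝ), A * Real.exp (φ k x) ≤ c * Real.exp t → 0 ≤ c →
      volume (gridCube a l k x ∩ {y | t ≤ f y}) ≤
      ENNReal.ofReal c * volume (gridCube a l k x) := by
    intro x hx k t c hc hc0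
    have h3 := hχ x hx k t
    have h4 : ENNReal.ofReal (A * Real.exp (φ k x)) ≤
        ENNReal.ofReal (Real.exp t) * ENNReal.ofReal c := by
      rw [← ENNReal.ofReal_mul (Real.exp_pos _).le, mul_comm (Real.exp t)]
      exact ENNReal.ofReal_le_ofReal hc
    have h5 : ENNReal.ofReal (Real.exp t) * volume (gridCube a l k x ∩ {y | t ≤ f y}) ≤
        ENNReal.ofReal (Real.exp t) * (ENNReal.ofReal c * volume (gridCube a l k x)) := by
      rw [← mul_assoc]
      exact h3.trans (by gcongr)
    rwa [ENNReal.mul_le_mul_iff_right (by simpa using Real.exp_pos t) ENNReal.ofReal_ne_top] at h5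
  -- After removing a quarter of the cube as `V` and at most a quarter where `f < φ - H`, half of it
  -- remains.
  have hlow : ∀ x ∈ cube a l, ∀ k (V : Set (EuclideanSpace ℝ (Fin n))), MeasurableSet V →
      volume (gridCube a l k x ∩ V) ≤ ENNReal.ofReal (1 / 4) * volume (gridCube a l k x) →
      ENNReal.ofReal (Real.exp (φ k x - H) / 2) * volume (gridCube a l k x) ≤
        μ (gridCube a l k x \ V) := by
    intro x hx k V hVm hV
    have h3 := measure_diff_ge (by norm_num) (by norm_num) (volume_gridCube_ne_top hl k) hV
      (h2 x hx k)
    rw [hμa _ ((measurableSet_gridCube k).diff hVm)]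
    have h4 := exp_mul_measure_le_setLIntegral (f := f) (φ k x - H)
      (S := gridCube a l k x \ V) (T := gridCube a l k x \ (V ∪ {y | f y < φ k x - H}))
      ((measurableSet_gridCube k).diff (hVm.union (measurableSet_lt hf measurable_const)))
      (sdiff_subset_sdiff_right subset_union_left) (fun y hy => by
        by_contra hc
        exact hy.2 (Or.inr (not_le.1 hc)))
    refine le_trans ?_ h4
    rw [div_eq_mul_one_div, ENNReal.ofReal_mul (Real.exp_pos _).le, mul_assoc]
    gcongr
    rwa [show (1 : ℝ) / 2 = 1 - 1 / 4 - 1 / 4 by norm_num]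
  have hchild : ∀ x ∈ cube a l, ∀ k, φ (k + 1) x ≤ φ k x + D := by
    intro x hx k
    have h3 := hlow x hx (k + 1) ∅ MeasurableSet.empty (by simp)
    rw [sdiff_empty] at h3
    have h4 := h3.trans ((measure_mono (gridCube_succ_subset hl k)).trans
      ((hμa _ (measurableSet_gridCube k)).le.trans (h1 x hx k)))
    rw [volume_gridCube hl, volume_gridCube hl, ← ENNReal.ofReal_mul (by positivity),
      ← ENNReal.ofReal_mul (by positivity), ENNReal.ofReal_le_ofReal_iff (by positivity)] at h4
    have e : (l / 2 ^ k) ^ n = 2 ^ n * (l / 2 ^ (k + 1)) ^ n := by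
      rw [← mul_pow]; congr 1; rw [pow_succ]; field_simp
    have hpos : 0 < (l / 2 ^ (k + 1)) ^ n := by positivity
    rw [e, ← mul_assoc, mul_le_mul_iff_left₀ hpos] at h4
    have h5 : Real.exp (φ (k + 1) x - H) ≤ 2 * A * 2 ^ n * Real.exp (φ k x) := by linarith
    rw [← Real.log_le_log_iff (Real.exp_pos _) (by positivity), Real.log_exp,
      Real.log_mul (by positivity) (by positivity), Real.log_exp] at h5
    linarith
  have hZ : ∀ x ∈ cube a l, ∀ k,
      volume (gridCube a l k x ∩ {y | ∃ j, k ≤ j ∧ φ k x + L < φ j y}) ≤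
      ENNReal.ofReal (1 / 4) * volume (gridCube a l k x) := by
    intro x hx k
    have h3 := measure_exists_lt_le hl hφ hf (L := L) (by norm_num) h2 hx k
    have h4 := hupper x hx k (φ k x + L - H) (1 / 8) (by
      rw [show φ k x + L - H = φ k x + Real.log (8 * A) by rw [hL]; ring, Real.exp_add,
        Real.exp_log (by positivity)]
      apply le_of_eq; ring) (by norm_num)
    have h5 := h3.trans h4
    have h6 : ENNReal.ofReal (1 - 1 / 4) * volume (gridCube a l k x ∩
        {y | ∃ j, k ≤ j ∧ φ k x + L < φ j y}) ≤
        ENNReal.ofReal (1 - 1 / 4) * (ENNReal.ofReal (1 / 4) * volume (gridCube a l k x)) := by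
      refine h5.trans ?_
      rw [← mul_assoc, ← ENNReal.ofReal_mul (by norm_num)]
      gcongr
      norm_num
    rwa [ENNReal.mul_le_mul_iff_right (by simp; norm_num) ENNReal.ofReal_ne_top] at h6
  have hμfin : ∀ x ∈ cube a l, ∀ k, μ (gridCube a l k x) ≠ ∞ := fun x hx k => by
    rw [hμa _ (measurableSet_gridCube k)]
    exact ((h1 x hx k).trans_lt (ENNReal.mul_lt_top ENNReal.ofReal_lt_top
      (volume_gridCube_ne_top hl k).lt_top)).ne
  -- The stopped set has Lebesgue density at most a quarter, so its complement keeps, by `hlow`, at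
  -- least the fraction `exp (-H) / (2 A)` of the `μ`-mass, whose total is at most `A exp φ` times
  -- the volume.
  have hθ : ∀ x ∈ cube a l, ∀ k, μ (gridCube a l k x ∩ {y | ∃ j, k ≤ j ∧ φ k x + L < φ j y}) ≤
      ENNReal.ofReal (1 - Real.exp (-H) / (2 * A)) * μ (gridCube a l k x) := by
    intro x hx k
    have hVm := measurableSet_exists_lt hl hφ k (φ k x + L)
    have h3 := hlow x hx k _ hVm (hZ x hx k)
    rw [ENNReal.ofReal_sub _ hδ0.le, ENNReal.ofReal_one,
      ENNReal.sub_mul fun _ _ => hμfin x hx k, one_mul]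
    refine ENNReal.le_sub_of_add_le_right (ENNReal.mul_ne_top ENNReal.ofReal_ne_top
      (hμfin x hx k)) ?_
    rw [← measure_inter_add_sdiff (gridCube a l k x) hVm]
    gcongr
    rw [measure_inter_add_sdiff _ hVm]
    refine le_trans ?_ h3
    rw [hμa _ (measurableSet_gridCube k)]
    calc _ ≤ ENNReal.ofReal (Real.exp (-H) / (2 * A)) *
          (ENNReal.ofReal (A * Real.exp (φ k x)) * volume (gridCube a l k x)) := by
            gcongr; exact h1 x hx k
      _ = _ := by
        rw [← mul_assoc, ← ENNReal.ofReal_mul (by positivity)]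
        congr 2
        rw [sub_eq_add_neg, Real.exp_add]
        field_simp
  have h3 : ∀ x ∈ cube a l, ∀ k, volume (gridCube a l k x ∩ {y | φ k x + Real.log (2 * A) < f y}) ≤
      ENNReal.ofReal (1 / 2) * volume (gridCube a l k x) := by
    intro x hx k
    have hsub : gridCube a l k x ∩ {y | φ k x + Real.log (2 * A) < f y} ⊆
        gridCube a l k x ∩ {y | φ k x + Real.log (2 * A) ≤ f y} := fun y hy => by
      have := hy.2
      simp only [mem_ofPred_eq] at this
      exact ⟨hy.1, this.le⟩
    refine le_trans (measure_mono hsub) (hupper x hx k (φ k x + Real.log (2 * A)) (1 / 2) ?_ (by norm_num))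
    rw [Real.exp_add, Real.exp_log (by positivity)]
    apply le_of_eq; ring
  have hfinal := hStopping a l hl μ (withDensity_absolutelyContinuous _ _) f φ hf hφ hchild hθ h3
  rw [hμ, setLIntegral_withDensity_eq_setLIntegral_mul _ hfe (by fun_prop) measurableSet_cube,
    withDensity_apply _ measurableSet_cube] at hfinal
  have h4 := h1 a (self_mem_cube hl) 0
  rw [gridCube_zero hl (self_mem_cube hl)] at h4
  have h5 := hfinal.trans (mul_le_mul_right h4 _)
  have e : ∀ x, ENNReal.ofReal (Real.exp ((1 + s) * (f x - φ 0 a))) =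
      ENNReal.ofReal (Real.exp (-φ 0 a)) * (((fun y => ENNReal.ofReal (Real.exp (f y))) *
        fun x => ENNReal.ofReal (Real.exp (s * (f x - φ 0 a)))) x) := by
    intro x
    rw [Pi.mul_apply, ← ENNReal.ofReal_mul (Real.exp_pos _).le,
      ← ENNReal.ofReal_mul (Real.exp_pos _).le, ← Real.exp_add, ← Real.exp_add]
    ring_nf
  simp_rw [e]
  rw [lintegral_const_mul _ (by fun_prop)]
  refine (mul_le_mul_right h5 _).trans (le_of_eq ?_)
  rw [← mul_assoc, ← mul_assoc, ← ENNReal.ofReal_mul (Real.exp_pos _).le,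
    ← ENNReal.ofReal_mul (by positivity)]
  congr 2
  rw [Real.exp_neg]
  field_simp

end reverse_holder

end VariableWeights

/-! ### Log-Hölder exponents and the normalization on cubes -/

namespace VariableWeights

/-- Quantitative form of the hypotheses on the exponent. -/
structure RegularExponent {n : ℕ} (p : EuclideanSpace ℝ (Fin n) → ℝ) (c P pinf K : ℝ) : Prop where
  continuous : Continuous p
  c_pos : 0 < c
  pinf_pos : 0 < pinf
  K_nonneg : 0 ≤ K
  ge : ∀ x, c ≤ p x
  le : ∀ x, p x ≤ P
  osc : ∀ x y l, 0 < l → ‖x - y‖ ≤ n * l → |p x - p y| * (1 - Real.log l) ≤ K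
  inf : ∀ x, |p x - pinf| * Real.log (Real.exp 1 + ‖x‖) ≤ K

lemma one_le_log_exp_add {t : ℝ} (ht : 0 ≤ t) : 1 ≤ Real.log (Real.exp 1 + t) := by
  rw [Real.le_log_iff_exp_le (by positivity)]; linarith

lemma LogHolderLocal.continuous {n : ℕ} {p : EuclideanSpace ℝ (Fin n) → ℝ}
    (hp : LogHolderLocal p) : Continuous p := by
  obtain ⟨C, hC, h⟩ := hp
  rw [Metric.continuous_iff]
  intro x ε hε
  refine ⟨min (1 / 2) (Real.exp (-(C / ε) - 1)), by positivity, fun y hy => ?_⟩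
  rw [dist_eq_norm] at hy
  rw [Real.dist_eq]
  rcases eq_or_ne y x with rfl | hne
  · simpa using hε
  have hpos : 0 < ‖y - x‖ := norm_pos_iff.2 (sub_ne_zero.2 hne)
  have h1 := h y x (hy.trans_le (min_le_left _ _))
  have h2 : Real.log ‖y - x‖ < -(C / ε) - 1 := by
    rw [Real.log_lt_iff_lt_exp hpos]; exact hy.trans_le (min_le_right _ _)
  have h3 : 0 < C / ε := by positivity
  refine h1.trans_lt ?_
  rw [← neg_div_neg_eq, neg_neg, div_lt_iff₀ (by linarith)]
  have h4 : C / ε < -Real.log ‖y - x‖ := by linarith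
  rw [div_lt_iff₀ hε] at h4
  linarith

/-- Continuity upgrades the essential lower bound to a pointwise one, and decay at infinity gives
the upper bound. The factor `n` in `osc` bounds the diameter of a cube of side `l`. When `n l ≤ 1/4`
the local condition applies, with logarithms compared up to `2 + log n`; when `n l` is larger, `1 -
log l` is bounded above and so is `p`. -/
lemma exists_regularExponent {n : ℕ} (hn : 1 ≤ n) {p : EuclideanSpace ℝ (Fin n) → ℝ}
    (hp : IsExponent p) (hpLH : LogHolder p) : ∃ c P pinf K : ℝ, RegularExponent p c P pinf K := by
  obtain ⟨⟨C₀, hC₀, h0⟩, pinf, Cinf, hpinf, hCinf, hinf⟩ := hpLH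
  have hcont : Continuous p := LogHolderLocal.continuous ⟨C₀, hC₀, h0⟩
  obtain ⟨c, hc, hcp⟩ := hp.essInf_pos
  have hge : ∀ x, c ≤ p x := by
    have hop : IsOpen {x | p x < c} := isOpen_lt hcont continuous_const
    have h1 : volume {x | p x < c} = 0 := by
      have := ae_iff.1 hcp
      simpa using this
    rw [hop.measure_eq_zero_iff volume] at h1
    intro x
    by_contra hx
    have : x ∈ {x | p x < c} := not_le.1 hx
    rw [h1] at this
    exact this
  have hinf' : ∀ x, |p x - pinf| * Real.log (Real.exp 1 + ‖x‖) ≤ Cinf := fun x => by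
    have h1 := one_le_log_exp_add (norm_nonneg x)
    rw [← le_div_iff₀ (by linarith)]
    exact hinf x
  have hle : ∀ x, p x ≤ pinf + Cinf := fun x => by
    have h1 := one_le_log_exp_add (norm_nonneg x)
    have h2 := hinf' x
    have h3 : |p x - pinf| ≤ Cinf := by
      nlinarith [abs_nonneg (p x - pinf)]
    linarith [(abs_le.1 h3).2]
  have hn' : (1 : ℝ) ≤ n := by exact_mod_cast hn
  have hlogn : 0 ≤ Real.log n := Real.log_nonneg hn'
  have hlog4n : 0 ≤ Real.log (4 * n) := Real.log_nonneg (by linarith)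
  have hK1 : 0 ≤ C₀ * (2 + Real.log n) := by positivity
  have hK2 : 0 ≤ (pinf + Cinf) * (1 + Real.log (4 * n)) := by positivity
  refine ⟨c, pinf + Cinf, pinf, C₀ * (2 + Real.log n) + (pinf + Cinf) * (1 + Real.log (4 * n)) + Cinf,
    hcont, hc, hpinf, by positivity, hge, hle, ?_, fun x => ?_⟩
  · intro x y l hl hxy
    suffices |p x - p y| * (1 - Real.log l) ≤ C₀ * (2 + Real.log n) ∨
        |p x - p y| * (1 - Real.log l) ≤ (pinf + Cinf) * (1 + Real.log (4 * n)) by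
      rcases this with h | h <;> linarith
    have hdiff : |p x - p y| ≤ pinf + Cinf := by
      rw [abs_le]
      constructor <;> linarith [hge x, hge y, hle x, hle y]
    rcases le_or_gt (n * l) (1 / 4) with hsmall | hbig
    · left
      rcases eq_or_ne x y with rfl | hne
      · simpa using hK1
      have hpos : 0 < ‖x - y‖ := norm_pos_iff.2 (sub_ne_zero.2 hne)
      have h1 := h0 x y (by linarith)
      have hnl : 0 < n * l := by positivity
      have h2 : Real.log ‖x - y‖ ≤ Real.log (n * l) := Real.log_le_log hpos hxy
      have h3 : Real.log (n * l) ≤ -1 := by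
        have : Real.log (n * l) ≤ Real.log (1 / 4) := Real.log_le_log hnl hsmall
        have h4 : Real.log (1 / 4) ≤ -1 := by
          rw [Real.log_le_iff_le_exp (by norm_num), Real.exp_neg, one_div]
          exact inv_anti₀ (Real.exp_pos _) (by linarith [Real.exp_one_lt_d9])
        linarith
      have h5 : |p x - p y| * (-Real.log (n * l)) ≤ C₀ := by
        rw [← neg_div_neg_eq, neg_neg, le_div_iff₀ (by linarith)] at h1
        nlinarith [abs_nonneg (p x - p y)]
      have h6 : Real.log (n * l) = Real.log n + Real.log l :=
        Real.log_mul (by positivity) hl.ne'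
      have h7 : 1 - Real.log l ≤ (2 + Real.log n) * (-Real.log (n * l)) := by nlinarith
      calc |p x - p y| * (1 - Real.log l)
          ≤ |p x - p y| * ((2 + Real.log n) * (-Real.log (n * l))) := by gcongr
        _ = (|p x - p y| * (-Real.log (n * l))) * (2 + Real.log n) := by ring
        _ ≤ C₀ * (2 + Real.log n) := by gcongr
    · right
      have h1 : 1 - Real.log l ≤ 1 + Real.log (4 * n) := by
        have : 0 ≤ Real.log (4 * n * l) := Real.log_nonneg (by linarith)
        rw [Real.log_mul (by positivity) hl.ne'] at this
        linarith
      calc |p x - p y| * (1 - Real.log l) ≤ |p x - p y| * (1 + Real.log (4 * n)) := by gcongr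
        _ ≤ _ := by gcongr
  · linarith [hinf' x]

/-- The logarithm of a quantity equivalent to the norm of the indicator of `cube a l`. -/
noncomputable def cubeExp {n : ℕ} (p : EuclideanSpace ℝ (Fin n) → ℝ) (pinf : ℝ)
    (a : EuclideanSpace ℝ (Fin n)) (l : ℝ) : ℝ :=
  if 1 ≤ l then n * Real.log l / pinf else n * Real.log l / p a

/-- The deviation of the normalized density `exp (-p cubeExp)` from `1 / |Q|`, on a log scale. -/
noncomputable def cubeDev {n : ℕ} (p : EuclideanSpace ℝ (Fin n) → ℝ) (pinf : ℝ)
    (a : EuclideanSpace ℝ (Fin n)) (l : ℝ) (x : EuclideanSpace ℝ (Fin n)) : ℝ :=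
  |p x * cubeExp p pinf a l - n * Real.log l|

/-- The modular of `exp (r (b - m))` on a cube with exponent `p` and normalized density. -/
noncomputable def cubeModular {n : ℕ} (p : EuclideanSpace ℝ (Fin n) → ℝ) (pinf : ℝ)
    (b : EuclideanSpace ℝ (Fin n) → ℝ) (r m : ℝ) (a : EuclideanSpace ℝ (Fin n)) (l : ℝ) : ℝ≥0∞ :=
  ∫⁻ x in cube a l, ENNReal.ofReal (Real.exp (r * p x * (b x - m) - p x * cubeExp p pinf a l))

namespace RegularExponent

variable {n : ℕ} {p b : EuclideanSpace ℝ (Fin n) → ℝ} {c P pinf K : ℝ}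
  {a x : EuclideanSpace ℝ (Fin n)} {l : ℝ}

lemma P_pos (hp : RegularExponent p c P pinf K) : 0 < P :=
  hp.c_pos.trans_le ((hp.ge 0).trans (hp.le 0))

lemma pos (hp : RegularExponent p c P pinf K) (x : EuclideanSpace ℝ (Fin n)) : 0 < p x :=
  hp.c_pos.trans_le (hp.ge x)

lemma measurable (hp : RegularExponent p c P pinf K) : Measurable p := hp.continuous.measurable

lemma measurable_cubeDev (hp : RegularExponent p c P pinf K) :
    Measurable (cubeDev p pinf a l) := by
  have := hp.measurable
  unfold cubeDev
  fun_prop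

/-- The deviation is `n |log l|` times a relative error of the exponent. For `l < 1` the local
oscillation of `p` on the cube absorbs `log l`; for `l ≥ 1` the decay of `p - pinf` does, provided
that `log l` is controlled by `log (e + |x|)`. -/
lemma cubeDev_le (hp : RegularExponent p c P pinf K) (hl : 0 < l) (hx : x ∈ cube a l) {C : ℝ}
    (hC : 0 ≤ C) (h : Real.log l ≤ C * Real.log (Real.exp 1 + ‖x‖)) :
    cubeDev p pinf a l x ≤ (n * K / c + n * K / pinf) * (1 + C) := by
  have hc := hp.c_pos
  have hpi := hp.pinf_pos
  have hK := hp.K_nonneg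
  have hA : 0 ≤ n * K / c := by positivity
  have hB : 0 ≤ n * K / pinf := by positivity
  unfold cubeDev cubeExp
  split_ifs with h1
  · have h2 : 0 ≤ Real.log l := Real.log_nonneg h1
    have e : p x * (n * Real.log l / pinf) - n * Real.log l =
        n / pinf * (Real.log l * (p x - pinf)) := by field_simp
    rw [e, abs_mul, abs_mul, abs_of_nonneg h2, abs_of_nonneg (by positivity)]
    have h3 : Real.log l * |p x - pinf| ≤ C * K := by
      calc Real.log l * |p x - pinf| ≤ C * Real.log (Real.exp 1 + ‖x‖) * |p x - pinf| := by gcongr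
        _ = C * (|p x - pinf| * Real.log (Real.exp 1 + ‖x‖)) := by ring
        _ ≤ C * K := by gcongr; exact hp.inf x
    calc n / pinf * (Real.log l * |p x - pinf|) ≤ n / pinf * (C * K) := by gcongr
      _ = n * K / pinf * C := by ring
      _ ≤ _ := by nlinarith
  · have h2 : Real.log l ≤ 0 := Real.log_nonpos hl.le (not_le.1 h1).le
    have hpa := hp.pos a
    have e : p x * (n * Real.log l / p a) - n * Real.log l =
        n / p a * (Real.log l * (p x - p a)) := by field_simp
    rw [e, abs_mul, abs_mul, abs_of_nonpos h2, abs_of_nonneg (by positivity)]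
    have h3 := hp.osc x a l hl (norm_sub_le_of_mem_cube hx (self_mem_cube hl))
    have h4 : -Real.log l * |p x - p a| ≤ K := by
      nlinarith [abs_nonneg (p x - p a)]
    calc n / p a * (-Real.log l * |p x - p a|) ≤ n / c * K := by
          gcongr
          · exact mul_nonneg (by linarith) (abs_nonneg _)
          · exact hp.ge a
      _ = n * K / c := by ring
      _ ≤ _ := by nlinarith

/-- For `l ≥ 1` the deviation is uncontrolled only near the origin. The exceptional set is a box of
half-side `η l ^ δ`: outside it `log l` is bounded by a multiple of `log (e + |x|)`, while the box
carries little volume and little of the mass `exp (-p τ)`. For `l < 1` it is empty. -/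
lemma exists_exceptional (hn : 1 ≤ n) (hp : RegularExponent p c P pinf K) {η : ℝ} (hη : 0 < η)
    (hη1 : η ≤ 1 / 2) : ∃ K' : ℝ, 0 ≤ K' ∧ ∀ (a : EuclideanSpace ℝ (Fin n)) (l : ℝ), 0 < l →
      ∃ B : Set (EuclideanSpace ℝ (Fin n)), MeasurableSet B ∧
        volume B ≤ ENNReal.ofReal (2 * η) * volume (cube a l) ∧
        ∫⁻ x in B, ENNReal.ofReal (Real.exp (-(p x * cubeExp p pinf a l))) ≤
          ENNReal.ofReal (2 * η) ∧
        (∀ x ∈ cube a l, x ∉ B → cubeDev p pinf a l x ≤ K') ∧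
        ∫⁻ x in B, ENNReal.ofReal (cubeDev p pinf a l x) ≤
          ENNReal.ofReal K' * volume (cube a l) := by
  have hc := hp.c_pos
  have hpi := hp.pinf_pos
  have hK := hp.K_nonneg
  have hP := hp.P_pos
  -- `δ ≤ c / pinf` gives `exp (-p τ) ≤ l ^ (-δ n)`, cancelling the volume of the box; `δ ≤ 1/2`
  -- leaves room for the factor `log l ≤ 2 l ^ (1/2)` in the last estimate, as `δ n + 1/2 ≤ n`.
  set δ : ℝ := min (1 / 2) (c / pinf) with hδ
  have hδ0 : 0 < δ := by positivity
  have hδ1 : δ ≤ 1 / 2 := min_le_left _ _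
  have hδ2 : δ ≤ c / pinf := min_le_right _ _
  have hη0 : 0 ≤ Real.log (1 / η) := Real.log_nonneg (by
    rw [le_div_iff₀ hη]; linarith)
  set C := (1 + Real.log (1 / η)) / δ with hC
  have hC0 : 0 ≤ C := by positivity
  have hn' : (1 : ℝ) ≤ n := by exact_mod_cast hn
  set K1 := (n * K / c + n * K / pinf) * (1 + C) with hK1
  set K2 := 2 * ((P / pinf + 1) * n) with hK2
  have hK10 : 0 ≤ K1 := by positivity
  have hK20 : 0 ≤ K2 := by positivity
  refine ⟨K1 + K2, by positivity, fun a l hl => ?_⟩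
  rcases lt_or_ge l 1 with hl1 | hl1
  · refine ⟨∅, MeasurableSet.empty, by simp, by simp, fun x hx _ => ?_, by simp⟩
    refine (hp.cubeDev_le hl hx hC0 ?_).trans (by linarith)
    have := Real.log_nonpos hl.le hl1.le
    have := one_le_log_exp_add (norm_nonneg x)
    nlinarith
  have hll : 0 ≤ Real.log l := Real.log_nonneg hl1
  set t := η * l ^ δ with ht
  have ht0 : 0 < t := by positivity
  set B : Set (EuclideanSpace ℝ (Fin n)) := {x | ∀ i, x i ∈ Ioo (-t) t} with hB
  have hBm : MeasurableSet B := by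
    rw [hB, ofPred_forall]
    exact MeasurableSet.iInter fun i => (by fun_prop : Measurable
      fun x : EuclideanSpace ℝ (Fin n) => x i) measurableSet_Ioo
  have hBv : volume B ≤ ENNReal.ofReal (2 * η) * ENNReal.ofReal (l ^ (δ * n)) := by
    have h1 : volume B = ENNReal.ofReal ((2 * t) ^ n) := by
      rw [hB, volume_setOf_forall_mem (fun _ => Ioo (-t) t)]
      simp only [Real.volume_Ioo, Finset.prod_const, Finset.card_univ, Fintype.card_fin]
      rw [← ENNReal.ofReal_pow (by linarith)]
      ring_nf
    rw [h1, ← ENNReal.ofReal_mul (by positivity)]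
    refine ENNReal.ofReal_le_ofReal ?_
    rw [ht, ← mul_assoc, mul_pow, ← Real.rpow_natCast (l ^ δ), ← Real.rpow_mul hl.le]
    gcongr
    exact pow_le_of_le_one (by positivity) (by linarith) (by omega)
  have hτ : cubeExp p pinf a l = n * Real.log l / pinf := by simp [cubeExp, hl1]
  have hτ0 : 0 ≤ cubeExp p pinf a l := by rw [hτ]; positivity
  refine ⟨B, hBm, ?_, ?_, ?_, ?_⟩
  · refine hBv.trans ?_
    rw [volume_cube hl]
    gcongr
    rw [← Real.rpow_natCast]
    exact Real.rpow_le_rpow_of_exponent_le hl1 (by nlinarith)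
  · calc ∫⁻ x in B, ENNReal.ofReal (Real.exp (-(p x * cubeExp p pinf a l)))
        ≤ ∫⁻ _ in B, ENNReal.ofReal (l ^ (-(δ * n))) := by
          refine lintegral_mono fun x => ENNReal.ofReal_le_ofReal ?_
          rw [Real.rpow_def_of_pos hl]
          refine Real.exp_le_exp.2 ?_
          have h1 : c * cubeExp p pinf a l ≤ p x * cubeExp p pinf a l :=
            mul_le_mul_of_nonneg_right (hp.ge x) hτ0
          have h2 : δ * (n * Real.log l) ≤ c / pinf * (n * Real.log l) := by gcongr
          have h3 : c * cubeExp p pinf a l = c / pinf * (n * Real.log l) := by rw [hτ]; ring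
          nlinarith
      _ = ENNReal.ofReal (l ^ (-(δ * n))) * volume B := by simp
      _ ≤ ENNReal.ofReal (l ^ (-(δ * n))) * (ENNReal.ofReal (2 * η) *
            ENNReal.ofReal (l ^ (δ * n))) := by gcongr
      _ = ENNReal.ofReal (2 * η) := by
          rw [← ENNReal.ofReal_mul (by positivity), ← ENNReal.ofReal_mul (by positivity)]
          congr 1
          rw [mul_comm, mul_assoc, ← Real.rpow_add hl]
          simp
  · intro x hx hxB
    refine (hp.cubeDev_le hl hx hC0 ?_).trans (by linarith)
    have h1 : t ≤ ‖x‖ := by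
      simp only [hB, mem_ofPred_eq, not_forall] at hxB
      obtain ⟨i, hi⟩ := hxB
      have h2 : t ≤ |x i| := by
        by_contra hc
        exact hi (abs_lt.1 (not_le.1 hc))
      exact h2.trans (by simpa using PiLp.norm_apply_le x i)
    have h2 : Real.log t ≤ Real.log (Real.exp 1 + ‖x‖) :=
      Real.log_le_log ht0 (h1.trans (by linarith [Real.exp_pos 1]))
    rw [ht, Real.log_mul hη.ne' (by positivity), Real.log_rpow hl] at h2
    have h3 : Real.log (1 / η) = -Real.log η := by rw [one_div, Real.log_inv]
    have h4 := one_le_log_exp_add (norm_nonneg x)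
    rw [hC, div_mul_eq_mul_div, le_div_iff₀ hδ0]
    nlinarith
  · have h1 : ∀ x, cubeDev p pinf a l x ≤ (P / pinf + 1) * n * Real.log l := by
      intro x
      rw [cubeDev, hτ]
      have hpx := hp.pos x
      refine (abs_sub _ _).trans ?_
      rw [abs_of_nonneg (by positivity), abs_of_nonneg (by positivity)]
      have : p x * (n * Real.log l / pinf) ≤ P * (n * Real.log l / pinf) := by
        gcongr; exact hp.le x
      calc _ ≤ P * (n * Real.log l / pinf) + n * Real.log l := by linarith
        _ = _ := by ring
    calc ∫⁻ x in B, ENNReal.ofReal (cubeDev p pinf a l x)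
        ≤ ∫⁻ _ in B, ENNReal.ofReal ((P / pinf + 1) * n * Real.log l) :=
          lintegral_mono fun x => ENNReal.ofReal_le_ofReal (h1 x)
      _ = ENNReal.ofReal ((P / pinf + 1) * n * Real.log l) * volume B := by simp
      _ ≤ ENNReal.ofReal ((P / pinf + 1) * n * Real.log l) * (1 * ENNReal.ofReal (l ^ (δ * n))) := by
          gcongr
          refine hBv.trans ?_
          gcongr
          rw [← ENNReal.ofReal_one]
          exact ENNReal.ofReal_le_ofReal (by linarith)
      _ ≤ ENNReal.ofReal (K1 + K2) * ENNReal.ofReal (l ^ n) := by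
          rw [one_mul, ← ENNReal.ofReal_mul (by positivity), ← ENNReal.ofReal_mul (by positivity)]
          refine ENNReal.ofReal_le_ofReal ?_
          have h2 : Real.log l ≤ 2 * l ^ (1 / 2 : ℝ) := by
            have := Real.log_le_rpow_div hl.le (ε := 1 / 2) (by norm_num)
            linarith
          have h3 : l ^ (1 / 2 : ℝ) * l ^ (δ * n) ≤ l ^ n := by
            rw [← Real.rpow_add hl, ← Real.rpow_natCast l n]
            exact Real.rpow_le_rpow_of_exponent_le hl1 (by nlinarith)
          calc (P / pinf + 1) * n * Real.log l * l ^ (δ * n)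
              ≤ (P / pinf + 1) * n * (2 * l ^ (1 / 2 : ℝ)) * l ^ (δ * n) := by gcongr
            _ = K2 * (l ^ (1 / 2 : ℝ) * l ^ (δ * n)) := by rw [hK2]; ring
            _ ≤ K2 * l ^ n := by gcongr
            _ ≤ (K1 + K2) * l ^ n := by gcongr; linarith
      _ = _ := by rw [volume_cube hl]

lemma exists_lintegral_cubeDev_le (hn : 1 ≤ n) (hp : RegularExponent p c P pinf K) :
    ∃ S : ℝ, 0 ≤ S ∧ ∀ (a : EuclideanSpace ℝ (Fin n)) (l : ℝ), 0 < l →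
      ∫⁻ x in cube a l, ENNReal.ofReal (cubeDev p pinf a l x) ≤
        ENNReal.ofReal S * volume (cube a l) := by
  obtain ⟨K', hK', h⟩ := exists_exceptional hn hp (η := 1 / 2) (by norm_num) le_rfl
  refine ⟨K' + K', by positivity, fun a l hl => ?_⟩
  obtain ⟨B, hB, -, -, h1, h2⟩ := h a l hl
  rw [← lintegral_inter_add_sdiff _ (cube a l) hB, ENNReal.ofReal_add hK' hK', add_mul]
  refine add_le_add ((lintegral_mono_set inter_subset_right).trans h2) ?_
  calc _ ≤ ∫⁻ _ in cube a l \ B, ENNReal.ofReal K' :=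
        setLIntegral_mono' (measurableSet_cube.diff hB) fun x hx =>
          ENNReal.ofReal_le_ofReal (h1 x hx.1 hx.2)
    _ = ENNReal.ofReal K' * volume (cube a l \ B) := by simp
    _ ≤ _ := by gcongr; exact sdiff_subset

/-- Two-sided bounds for the modular of the normalized indicator of a cube. -/
lemma exists_cubeModular_zero_bounds (hn : 1 ≤ n) (hp : RegularExponent p c P pinf K) :
    ∃ k S : ℝ, 0 < k ∧ 0 < S ∧ ∀ (a : EuclideanSpace ℝ (Fin n)) (l : ℝ), 0 < l →
      ENNReal.ofReal k ≤ ∫⁻ x in cube a l, ENNReal.ofReal (Real.exp (-(p x * cubeExp p pinf a l))) ∧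
      ∫⁻ x in cube a l, ENNReal.ofReal (Real.exp (-(p x * cubeExp p pinf a l))) ≤
        ENNReal.ofReal S := by
  obtain ⟨K', hK', h⟩ := exists_exceptional hn hp (η := 1 / 4) (by norm_num) (by norm_num)
  refine ⟨Real.exp (-K') * (1 / 2), 1 + Real.exp K', by positivity, by positivity,
    fun a l hl => ?_⟩
  obtain ⟨B, hB, hBv, hBi, h1, -⟩ := h a l hl
  have hln : 0 < l ^ n := by positivity
  have hdev : ∀ x ∈ cube a l \ B, -K' - n * Real.log l ≤ -(p x * cubeExp p pinf a l) ∧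
      -(p x * cubeExp p pinf a l) ≤ K' - n * Real.log l := fun x hx => by
    have := abs_le.1 (h1 x hx.1 hx.2)
    constructor <;> linarith
  have hexp : ∀ t, Real.exp (t - n * Real.log l) = Real.exp t * (l ^ n)⁻¹ := fun t => by
    rw [Real.exp_sub, Real.exp_nat_mul, Real.exp_log hl, div_eq_mul_inv]
  have hinv : ENNReal.ofReal ((l ^ n)⁻¹) * volume (cube a l) = 1 := by
    rw [volume_cube hl, ← ENNReal.ofReal_mul (by positivity), inv_mul_cancel₀ hln.ne',
      ENNReal.ofReal_one]
  constructor
  · have h2 := exp_mul_measure_le_setLIntegral (f := fun x => -(p x * cubeExp p pinf a l))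
      (-K' - n * Real.log l) (S := cube a l) (T := cube a l \ B) (measurableSet_cube.diff hB)
      sdiff_subset (fun x hx => (hdev x hx).1)
    refine le_trans ?_ h2
    have h3 := measure_diff_ge (S := cube a l) (V := B) (W := ∅) (v := 1 / 2) (w := 0)
      (by norm_num) le_rfl (volume_cube_ne_top hl)
      ((measure_mono inter_subset_right).trans (hBv.trans (by norm_num))) (by simp)
    rw [union_empty] at h3
    calc ENNReal.ofReal (Real.exp (-K') * (1 / 2))
        = ENNReal.ofReal (Real.exp (-K' - n * Real.log l)) *
          (ENNReal.ofReal (1 - 1 / 2 - 0) * volume (cube a l)) := by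
          rw [hexp, ENNReal.ofReal_mul (Real.exp_pos _).le, ENNReal.ofReal_mul (Real.exp_pos _).le,
            mul_comm (ENNReal.ofReal (1 - 1 / 2 - 0)), mul_assoc,
            ← mul_assoc (ENNReal.ofReal ((l ^ n)⁻¹)), hinv, one_mul]
          norm_num
      _ ≤ _ := by gcongr
  · rw [← lintegral_inter_add_sdiff _ (cube a l) hB, ENNReal.ofReal_add zero_le_one
      (Real.exp_pos _).le]
    refine add_le_add ((lintegral_mono_set inter_subset_right).trans (hBi.trans
      (ENNReal.ofReal_le_ofReal (by norm_num)))) ?_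
    calc _ ≤ ∫⁻ _ in cube a l \ B, ENNReal.ofReal (Real.exp (K' - n * Real.log l)) :=
          setLIntegral_mono' (measurableSet_cube.diff hB) fun x hx =>
            ENNReal.ofReal_le_ofReal (Real.exp_le_exp.2 (hdev x hx).2)
      _ = ENNReal.ofReal (Real.exp (K' - n * Real.log l)) * volume (cube a l \ B) := by simp
      _ ≤ ENNReal.ofReal (Real.exp (K' - n * Real.log l)) * volume (cube a l) := by
          gcongr; exact sdiff_subset
      _ = _ := by
          rw [hexp, ENNReal.ofReal_mul (Real.exp_pos _).le, mul_assoc, hinv, mul_one]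

/-- A Jensen type bound for the positive part of `b - m`. -/
lemma exists_lintegral_sub_le (hn : 1 ≤ n) (hp : RegularExponent p c P pinf K) :
    ∃ S : ℝ, 0 ≤ S ∧ ∀ (b : EuclideanSpace ℝ (Fin n) → ℝ), Measurable b →
      ∀ (a : EuclideanSpace ℝ (Fin n)) (l m : ℝ), 0 < l →
      ENNReal.ofReal c * ∫⁻ x in cube a l, ENNReal.ofReal (b x - m) ≤
        (ENNReal.ofReal S + cubeModular p pinf b 1 m a l) * volume (cube a l) := by
  obtain ⟨S, hS, h⟩ := exists_lintegral_cubeDev_le hn hp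
  refine ⟨S, hS, fun b hb a l m hl => ?_⟩
  have hpm := hp.measurable
  have hln : 0 < l ^ n := by positivity
  have hpt : ∀ x, ENNReal.ofReal c * ENNReal.ofReal (b x - m) ≤
      ENNReal.ofReal (cubeDev p pinf a l x) + ENNReal.ofReal (Real.exp (1 * p x * (b x - m) -
        p x * cubeExp p pinf a l)) * ENNReal.ofReal (l ^ n) := by
    intro x
    rw [← ENNReal.ofReal_mul hp.c_pos.le, ← ENNReal.ofReal_mul (Real.exp_pos _).le,
      ← ENNReal.ofReal_add (show 0 ≤ cubeDev p pinf a l x from abs_nonneg _) (by positivity)]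
    refine ENNReal.ofReal_le_ofReal ?_
    have e : Real.exp (1 * p x * (b x - m) - p x * cubeExp p pinf a l) * l ^ n =
        Real.exp (p x * (b x - m) - (p x * cubeExp p pinf a l - n * Real.log l)) := by
      rw [← Real.exp_log hln, ← Real.exp_add, Real.log_pow, one_mul]
      ring_nf
    rw [e]
    -- For `b > m` this is `t ≤ exp t` with `t = p (b - m) - (p τ - n log l)`, the bracket being at
    -- most the deviation.
    rcases le_or_gt (b x) m with hbm | hbm
    · have h1 : c * (b x - m) ≤ 0 := mul_nonpos_of_nonneg_of_nonpos hp.c_pos.le (by linarith)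
      have h2 : 0 ≤ cubeDev p pinf a l x := abs_nonneg _
      linarith [Real.exp_pos (p x * (b x - m) - (p x * cubeExp p pinf a l - n * Real.log l))]
    · have h1 : c * (b x - m) ≤ p x * (b x - m) :=
        mul_le_mul_of_nonneg_right (hp.ge x) (by linarith)
      have h2 := Real.add_one_le_exp
        (p x * (b x - m) - (p x * cubeExp p pinf a l - n * Real.log l))
      have h3 : p x * cubeExp p pinf a l - n * Real.log l ≤ cubeDev p pinf a l x := le_abs_self _
      linarith
  rw [← lintegral_const_mul _ (by fun_prop)]
  refine (lintegral_mono hpt).trans ?_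
  rw [lintegral_add_left hp.measurable_cubeDev.ennreal_ofReal, lintegral_mul_const _ (by fun_prop),
    add_mul, ← volume_cube (a := a) hl]
  exact add_le_add (h a l hl) le_rfl

end RegularExponent

end VariableWeights

/-! ### Distribution of `b` on a cube from bounds on its modular -/

namespace VariableWeights

lemma cube_inter_measure {n : ℕ} {a : EuclideanSpace ℝ (Fin n)} {l : ℝ} (hl : 0 < l)
    (S : Set (EuclideanSpace ℝ (Fin n))) : ∃ g : ℝ, 0 ≤ g ∧ g ≤ 1 ∧
      volume (cube a l ∩ S) = ENNReal.ofReal g * volume (cube a l) := by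
  have hln : 0 < l ^ n := by positivity
  have hfin : volume (cube a l ∩ S) ≠ ∞ :=
    measure_ne_top_of_subset inter_subset_left (volume_cube_ne_top hl)
  refine ⟨volume.real (cube a l ∩ S) / l ^ n, by positivity, ?_, ?_⟩
  · rw [div_le_one hln, ← volume_real_cube (a := a) hl]
    exact measureReal_mono inter_subset_left (volume_cube_ne_top hl)
  · rw [volume_cube hl, ← ENNReal.ofReal_mul (by positivity), div_mul_cancel₀ _ hln.ne',
      Measure.real, ENNReal.ofReal_toReal hfin]

lemma ofReal_mul_volume_cube_le_iff {n : ℕ} {a : EuclideanSpace ℝ (Fin n)} {l : ℝ} (hl : 0 < l)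
    {x y : ℝ} (hy : 0 ≤ y) : ENNReal.ofReal x * volume (cube a l) ≤
      ENNReal.ofReal y * volume (cube a l) ↔ x ≤ y := by
  rw [ENNReal.mul_le_mul_iff_left (volume_cube_ne_zero hl) (volume_cube_ne_top hl),
    ENNReal.ofReal_le_ofReal_iff hy]

namespace RegularExponent

variable {n : ℕ} {p : EuclideanSpace ℝ (Fin n) → ℝ} {c P pinf K : ℝ}

lemma exists_lintegral_sub_le_of_cubeModular (hn : 1 ≤ n) (hp : RegularExponent p c P pinf K)
    (T : ℝ) : ∃ S : ℝ, 0 < S ∧ ∀ (b : EuclideanSpace ℝ (Fin n) → ℝ), Measurable b →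
      ∀ (a : EuclideanSpace ℝ (Fin n)) (l m : ℝ), 0 < l →
      cubeModular p pinf b 1 m a l ≤ ENNReal.ofReal T →
      ∫⁻ x in cube a l, ENNReal.ofReal (b x - m) ≤ ENNReal.ofReal S * volume (cube a l) := by
  obtain ⟨S, hS, h⟩ := exists_lintegral_sub_le hn hp
  have hc := hp.c_pos
  refine ⟨(S + |T| + 1) / c, by positivity, fun b hb a l m hl hm => ?_⟩
  have h1 := h b hb a l m hl
  have h2 : (ENNReal.ofReal S + cubeModular p pinf b 1 m a l) * volume (cube a l) ≤
      ENNReal.ofReal c * (ENNReal.ofReal ((S + |T| + 1) / c) * volume (cube a l)) := by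
    rw [← mul_assoc, ← ENNReal.ofReal_mul hc.le, mul_div_cancel₀ _ hc.ne']
    gcongr
    calc _ ≤ ENNReal.ofReal S + ENNReal.ofReal |T| := by
          gcongr; exact hm.trans (ENNReal.ofReal_le_ofReal (le_abs_self T))
      _ = ENNReal.ofReal (S + |T|) := (ENNReal.ofReal_add hS (abs_nonneg T)).symm
      _ ≤ _ := ENNReal.ofReal_le_ofReal (by linarith)
  have h3 := h1.trans h2
  rwa [ENNReal.mul_le_mul_iff_right (by simpa using hc) ENNReal.ofReal_ne_top] at h3

lemma exists_upper_tail (hn : 1 ≤ n) (hp : RegularExponent p c P pinf K)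
    (T : ℝ) {ε : ℝ} (hε : 0 < ε) :
    ∃ H : ℝ, 0 ≤ H ∧ ∀ (b : EuclideanSpace ℝ (Fin n) → ℝ), Measurable b →
      ∀ (a : EuclideanSpace ℝ (Fin n)) (l m : ℝ), 0 < l →
      cubeModular p pinf b 1 m a l ≤ ENNReal.ofReal T →
      volume (cube a l ∩ {x | m + H < b x}) ≤ ENNReal.ofReal ε * volume (cube a l) := by
  obtain ⟨S, hS, h⟩ := exists_lintegral_sub_le_of_cubeModular hn hp T
  have hH : 0 < S / ε := by positivity
  refine ⟨S / ε, hH.le, fun b hb a l m hl hm => ?_⟩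
  have h1 := h b hb a l m hl hm
  have hms : MeasurableSet {x | m + S / ε < b x} := measurableSet_lt measurable_const hb
  have h2 : ENNReal.ofReal (S / ε) * volume (cube a l ∩ {x | m + S / ε < b x}) ≤
      ENNReal.ofReal (S / ε) * (ENNReal.ofReal ε * volume (cube a l)) := by
    rw [← mul_assoc, ← ENNReal.ofReal_mul hH.le, div_mul_cancel₀ _ hε.ne']
    refine le_trans ?_ h1
    calc _ = ∫⁻ _ in cube a l ∩ {x | m + S / ε < b x}, ENNReal.ofReal (S / ε) := by simp
      _ ≤ ∫⁻ x in cube a l ∩ {x | m + S / ε < b x}, ENNReal.ofReal (b x - m) :=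
          setLIntegral_mono' (measurableSet_cube.inter hms) fun x hx =>
            ENNReal.ofReal_le_ofReal (by
              have := hx.2
              simp only [mem_ofPred_eq] at this
              linarith)
      _ ≤ _ := lintegral_mono_set inter_subset_left
  rwa [ENNReal.mul_le_mul_iff_right (by simpa using hH) ENNReal.ofReal_ne_top] at h2

/-- A Paley–Zygmund argument. The modular with exponent 1 is at least `k`; the part where `b < m -
H` is at most `exp (-c H) S`, and the part where `p (b - m) > t` is at most `exp (-(r - 1) t) C` by
higher integrability. What remains lives on `b ≥ m - H` with an integrand of at most `exp t` times
the normalized density, so that set cannot be small. -/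
lemma exists_lower_fraction (hn : 1 ≤ n) (hp : RegularExponent p c P pinf K)
    {r C k : ℝ} (hr : 1 < r) (hC : 0 < C) (hk : 0 < k) :
    ∃ γ H : ℝ, 0 < γ ∧ γ < 1 ∧ 0 ≤ H ∧ ∀ (b : EuclideanSpace ℝ (Fin n) → ℝ), Measurable b →
      ∀ (a : EuclideanSpace ℝ (Fin n)) (l m : ℝ), 0 < l →
      cubeModular p pinf b r m a l ≤ ENNReal.ofReal C →
      ENNReal.ofReal k ≤ cubeModular p pinf b 1 m a l →
      ENNReal.ofReal γ * volume (cube a l) ≤ volume (cube a l ∩ {x | m - H ≤ b x}) := by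
  obtain ⟨k₀, S, -, hS, hmass⟩ := exists_cubeModular_zero_bounds hn hp
  have hc := hp.c_pos
  -- `t`, `H` and `η` are chosen so that the high part, the low part and the exceptional set each
  -- cost at most `k / 4`, leaving `k / 4` for the set sought.
  set t : ℝ := Real.log (4 * C / k) / (r - 1) with ht
  have hr1 : 0 < r - 1 := by linarith
  have ht1 : Real.exp (-((r - 1) * t)) * C = k / 4 := by
    rw [ht, mul_div_cancel₀ _ hr1.ne', Real.exp_neg, Real.exp_log (by positivity)]
    field_simp
  set H : ℝ := |Real.log (4 * S / k)| / c with hH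
  have hH0 : 0 ≤ H := by positivity
  have hH1 : Real.exp (-(c * H)) * S ≤ k / 4 := by
    rw [hH, mul_div_cancel₀ _ hc.ne']
    have : Real.exp (-|Real.log (4 * S / k)|) ≤ Real.exp (-Real.log (4 * S / k)) :=
      Real.exp_le_exp.2 (neg_le_neg (le_abs_self _))
    rw [Real.exp_neg (Real.log _), Real.exp_log (by positivity)] at this
    calc _ ≤ (4 * S / k)⁻¹ * S := by gcongr
      _ = k / 4 := by field_simp
  set η : ℝ := min (1 / 2) (k / 8 * Real.exp (-t)) with hη
  have hη0 : 0 < η := by positivity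
  obtain ⟨K', hK', hexc⟩ := exists_exceptional hn hp hη0 (min_le_left _ _)
  have hη1 : Real.exp t * (2 * η) ≤ k / 4 := by
    have : η ≤ k / 8 * Real.exp (-t) := min_le_right _ _
    calc _ ≤ Real.exp t * (2 * (k / 8 * Real.exp (-t))) := by gcongr
      _ = k / 4 * (Real.exp t * Real.exp (-t)) := by ring
      _ = k / 4 := by rw [← Real.exp_add]; simp
  refine ⟨min (1 / 2) (k / 4 * Real.exp (-(t + K'))), H, by positivity,
    (min_le_left _ _).trans_lt (by norm_num), hH0, fun b hb a l m hl hCm hkm => ?_⟩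
  obtain ⟨B, hB, -, hBi, hBd, -⟩ := hexc a l hl
  obtain ⟨g, hg0, -, hg⟩ := cube_inter_measure (a := a) hl {x | m - H ≤ b x}
  rw [hg, ofReal_mul_volume_cube_le_iff hl hg0]
  refine (min_le_right _ _).trans ?_
  have hpm := hp.measurable
  set G : Set (EuclideanSpace ℝ (Fin n)) := {x | m - H ≤ b x} with hG
  have hGm : MeasurableSet G := measurableSet_le measurable_const hb
  set τ := cubeExp p pinf a l
  set v : EuclideanSpace ℝ (Fin n) → ℝ≥0∞ := fun x => ENNReal.ofReal (Real.exp (-(p x * τ))) with hv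
  have hvm : Measurable v := by fun_prop
  have hpt : ∀ x, ENNReal.ofReal (Real.exp (1 * p x * (b x - m) - p x * τ)) ≤
      ENNReal.ofReal (Real.exp (-(c * H))) * v x +
      (ENNReal.ofReal (Real.exp t) * G.indicator v x +
      ENNReal.ofReal (Real.exp (-((r - 1) * t))) *
        ENNReal.ofReal (Real.exp (r * p x * (b x - m) - p x * τ))) := by
    intro x
    by_cases hx : x ∈ G
    · refine le_add_left ?_
      rw [indicator_of_mem hx, hv, ← ENNReal.ofReal_mul (Real.exp_pos _).le,
        ← ENNReal.ofReal_mul (Real.exp_pos _).le, ← ENNReal.ofReal_add (by positivity)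
        (by positivity), ← Real.exp_add, ← Real.exp_add]
      refine ENNReal.ofReal_le_ofReal ?_
      rcases le_total (p x * (b x - m)) t with h | h
      · refine le_add_of_le_of_nonneg (Real.exp_le_exp.2 (by linarith)) (Real.exp_pos _).le
      · refine le_add_of_nonneg_of_le (Real.exp_pos _).le (Real.exp_le_exp.2 ?_)
        nlinarith
    · refine le_add_right ?_
      rw [hv, ← ENNReal.ofReal_mul (Real.exp_pos _).le, ← Real.exp_add]
      refine ENNReal.ofReal_le_ofReal (Real.exp_le_exp.2 ?_)
      have hx' : b x < m - H := not_le.1 hx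
      have := hp.ge x
      nlinarith
  have hint : cubeModular p pinf b 1 m a l ≤ ENNReal.ofReal (Real.exp (-(c * H))) *
      (∫⁻ x in cube a l, v x) + (ENNReal.ofReal (Real.exp t) * (∫⁻ x in cube a l ∩ G, v x) +
      ENNReal.ofReal (Real.exp (-((r - 1) * t))) * cubeModular p pinf b r m a l) := by
    refine (lintegral_mono hpt).trans (le_of_eq ?_)
    rw [lintegral_add_left (by fun_prop), lintegral_add_left
      ((hvm.indicator hGm).const_mul _), lintegral_const_mul _ hvm,
      lintegral_const_mul _ (hvm.indicator hGm), lintegral_const_mul _ (by fun_prop),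
      setLIntegral_indicator hGm, inter_comm, cubeModular]
  have hGint : ∫⁻ x in cube a l ∩ G, v x ≤ ENNReal.ofReal (2 * η + Real.exp K' * g) := by
    rw [← lintegral_inter_add_sdiff _ (cube a l ∩ G) hB, ENNReal.ofReal_add (by positivity)
      (by positivity)]
    refine add_le_add ((lintegral_mono_set inter_subset_right).trans hBi) ?_
    calc _ ≤ ∫⁻ _ in (cube a l ∩ G) \ B, ENNReal.ofReal (Real.exp (K' - n * Real.log l)) :=
          setLIntegral_mono' ((measurableSet_cube.inter hGm).diff hB) fun x hx =>
            ENNReal.ofReal_le_ofReal (Real.exp_le_exp.2 (by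
              have := (abs_le.1 (hBd x hx.1.1 hx.2)).1
              linarith))
      _ = ENNReal.ofReal (Real.exp (K' - n * Real.log l)) * volume ((cube a l ∩ G) \ B) := by simp
      _ ≤ ENNReal.ofReal (Real.exp (K' - n * Real.log l)) * (ENNReal.ofReal g *
            volume (cube a l)) := by rw [← hg]; gcongr; exact sdiff_subset
      _ = _ := by
          rw [volume_cube hl, ← ENNReal.ofReal_mul hg0, ← ENNReal.ofReal_mul (Real.exp_pos _).le,
            Real.exp_sub, Real.exp_nat_mul, Real.exp_log hl]
          congr 1
          have : l ^ n ≠ 0 := by positivity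
          field_simp
  have hfin : ENNReal.ofReal k ≤ ENNReal.ofReal (Real.exp (-(c * H)) * S +
      (Real.exp t * (2 * η + Real.exp K' * g) + Real.exp (-((r - 1) * t)) * C)) := by
    refine hkm.trans (hint.trans ?_)
    rw [ENNReal.ofReal_add (by positivity) (by positivity), ENNReal.ofReal_add (by positivity)
      (by positivity), ENNReal.ofReal_mul (Real.exp_pos _).le,
      ENNReal.ofReal_mul (p := Real.exp t) (Real.exp_pos _).le,
      ENNReal.ofReal_mul (p := Real.exp (-((r - 1) * t))) (Real.exp_pos _).le]
    gcongr
    exact (hmass a l hl).2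
  rw [ENNReal.ofReal_le_ofReal_iff (by positivity), ht1] at hfin
  have h4 : k / 4 ≤ Real.exp (t + K') * g := by
    rw [Real.exp_add]
    nlinarith
  rw [Real.exp_neg, ← div_eq_mul_inv, div_le_iff₀ (Real.exp_pos _)]
  linarith

end RegularExponent

end VariableWeights

/-! ### From the reverse Hölder condition to averages of `b` -/

namespace VariableWeights

/-- The `A_∞` type condition for `b = log w`, in terms of averages of `b`. -/
def LogCondition {n : ℕ} (p : EuclideanSpace ℝ (Fin n) → ℝ) (pinf : ℝ)
    (b : EuclideanSpace ℝ (Fin n) → ℝ) : Prop :=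
  (∀ (a : EuclideanSpace ℝ (Fin n)) (l : ℝ), 0 < l → IntegrableOn b (cube a l)) ∧
  ∃ C : ℝ, 0 < C ∧ ∀ (a : EuclideanSpace ℝ (Fin n)) (l : ℝ), 0 < l →
    cubeModular p pinf b 1 (⨍ y in cube a l, b y) a l ≤ ENNReal.ofReal C

/-- The reverse Hölder condition for `w = exp b`. -/
def ReverseHolderCondition {n : ℕ} (p : EuclideanSpace ℝ (Fin n) → ℝ) (pinf : ℝ)
    (b : EuclideanSpace ℝ (Fin n) → ℝ) : Prop :=
  ∃ r C k : ℝ, 1 < r ∧ 0 < C ∧ 0 < k ∧ ∀ (a : EuclideanSpace ℝ (Fin n)) (l : ℝ), 0 < l →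
    ∃ m : ℝ, cubeModular p pinf b r m a l ≤ ENNReal.ofReal C ∧
      ENNReal.ofReal k ≤ cubeModular p pinf b 1 m a l

lemma integral_le_of_lintegral_ofReal_le {α : Type*} [MeasurableSpace α] {μ : Measure α}
    {f : α → ℝ} (hf : Integrable f μ) {C : ℝ} (hC : 0 ≤ C)
    (h : ∫⁻ x, ENNReal.ofReal (f x) ∂μ ≤ ENNReal.ofReal C) : ∫ x, f x ∂μ ≤ C := by
  rw [integral_eq_lintegral_pos_part_sub_lintegral_neg_part hf]
  have h1 := ENNReal.toReal_mono ENNReal.ofReal_ne_top h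
  rw [ENNReal.toReal_ofReal hC] at h1
  have h2 : 0 ≤ (∫⁻ x, ENNReal.ofReal (-f x) ∂μ).toReal := ENNReal.toReal_nonneg
  linarith

variable {n : ℕ} {p b : EuclideanSpace ℝ (Fin n) → ℝ} {c P pinf K : ℝ}

/-- If `m'` were larger, the points of the big cube with `b ≥ m' - H`, of density at least `γ`,
would lie in the difference of the cubes or in the upper tail on the small one. These have density
at most `γ / 4` each. -/
lemma le_of_fractions {a a' : EuclideanSpace ℝ (Fin n)} {l l' m m' γ H H' : ℝ} (hl : 0 < l)
    (hl' : 0 < l') (hγ : 0 < γ) (hsub : cube a l ⊆ cube a' l') (hvol : (1 - γ / 4) * l' ^ n ≤ l ^ n)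
    (h1 : ENNReal.ofReal γ * volume (cube a' l') ≤ volume (cube a' l' ∩ {x | m' - H ≤ b x}))
    (h2 : volume (cube a l ∩ {x | m + H' < b x}) ≤ ENNReal.ofReal (γ / 4) * volume (cube a l)) :
    m' ≤ m + (H + H') := by
  by_contra hcon
  have h3 : cube a' l' ∩ {x | m' - H ≤ b x} ⊆
      (cube a' l' \ cube a l) ∪ (cube a l ∩ {x | m + H' < b x}) := by
    intro x hx
    by_cases hxa : x ∈ cube a l
    · refine Or.inr ⟨hxa, ?_⟩
      have := hx.2
      simp only [mem_ofPred_eq] at this ⊢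
      linarith
    · exact Or.inl ⟨hx.1, hxa⟩
  have hpos : 0 < l' ^ n := by positivity
  have h4 : volume (cube a' l' \ cube a l) ≤ ENNReal.ofReal (γ / 4) * volume (cube a' l') := by
    rw [measure_sdiff hsub measurableSet_cube.nullMeasurableSet (volume_cube_ne_top hl),
      volume_cube hl, volume_cube hl', ← ENNReal.ofReal_mul (by positivity),
      ← ENNReal.ofReal_sub _ (by positivity)]
    exact ENNReal.ofReal_le_ofReal (by linarith)
  have h5 : ENNReal.ofReal γ * volume (cube a' l') ≤
      ENNReal.ofReal (γ / 4 + γ / 4) * volume (cube a' l') := by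
    rw [ENNReal.ofReal_add (by positivity) (by positivity), add_mul]
    refine h1.trans ((measure_mono h3).trans ((measure_union_le _ _).trans
      (add_le_add h4 (h2.trans ?_))))
    gcongr
  rw [ofReal_mul_volume_cube_le_iff hl' (by positivity)] at h5
  linarith

/-- A functional that is almost monotone along slightly larger cubes is almost monotone from
a cube to one of twice the side length. -/
lemma exists_doubling (n : ℕ) {ε H : ℝ} (hε : 0 < ε) (hε1 : ε < 1) (hH : 0 ≤ H) :
    ∃ D : ℝ, 0 ≤ D ∧ ∀ M : EuclideanSpace ℝ (Fin n) → ℝ → ℝ,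
      (∀ a l a' l', 0 < l → 0 < l' → cube a l ⊆ cube a' l' → (1 - ε) * l' ^ n ≤ l ^ n →
        M a' l' ≤ M a l + H) →
      ∀ a l a', 0 < l → (∀ i, a' i ≤ a i ∧ a i ≤ a' i + l) → M a' (2 * l) ≤ M a l + D := by
  -- The cubes are interpolated linearly in `N` steps. Consecutive sides have ratio at least `1 -
  -- 1/N`, and Bernoulli gives `(1 - 1/N) ^ n ≥ 1 - n/N ≥ 1 - ε` for the volumes.
  obtain ⟨N, hN⟩ := exists_nat_gt (n / ε)
  have hN0 : (0 : ℝ) < N := lt_of_le_of_lt (by positivity) hN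
  refine ⟨N * H, by positivity, fun M hM a l a' hl ha => ?_⟩
  have key : ∀ j : ℕ, M (a + ((j : ℝ) / N) • (a' - a)) ((1 + (j : ℝ) / N) * l) ≤ M a l + j * H := by
    intro j
    induction j with
    | zero => simp
    | succ j ih =>
      have hj : (0 : ℝ) ≤ j / N := by positivity
      have hstep : (((j + 1 : ℕ) : ℝ)) / N = j / N + 1 / N := by push_cast; ring
      have hN1 : (0 : ℝ) < 1 / N := by positivity
      set s : ℝ := j / N
      rw [hstep]
      refine (hM (a + s • (a' - a)) ((1 + s) * l) _ _ (by positivity) (by positivity) ?_ ?_).trans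
        (by push_cast; linarith)
      · intro x hx i
        have h1 := hx i
        have h2 := ha i
        simp only [mem_Ico, PiLp.add_apply, PiLp.smul_apply, PiLp.sub_apply, smul_eq_mul] at h1 ⊢
        have h3 : (1 / (N : ℝ)) * (a' i - a i) ≤ 0 :=
          mul_nonpos_of_nonneg_of_nonpos hN1.le (by linarith)
        have h4 : 0 ≤ (1 / (N : ℝ)) * (a' i + l - a i) := mul_nonneg hN1.le (by linarith)
        constructor <;> nlinarith
      · have hb : (1 - ε) * (1 + (s + 1 / N)) ^ n ≤ (1 + s) ^ n := by
          have h1 : 1 - ε ≤ (1 + -(1 / (N : ℝ))) ^ n := by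
            have h2 := one_add_mul_le_pow (a := -(1 / (N : ℝ))) (by
              have : 1 / (N : ℝ) ≤ 1 := by
                rw [div_le_one hN0]
                have : 0 < N := by exact_mod_cast hN0
                exact_mod_cast this
              linarith) n
            have h3 : n * (1 / (N : ℝ)) ≤ ε := by
              rw [div_lt_iff₀ hε] at hN
              rw [mul_one_div, div_le_iff₀ hN0]
              linarith
            linarith
          have h2 : (1 + -(1 / (N : ℝ))) * (1 + (s + 1 / N)) ≤ 1 + s := by
            nlinarith
          have h4 : 0 ≤ 1 + -(1 / (N : ℝ)) := by
            have : 1 / (N : ℝ) ≤ 1 := by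
              rw [div_le_one hN0]
              have : 0 < N := by exact_mod_cast hN0
              exact_mod_cast this
            linarith
          calc (1 - ε) * (1 + (s + 1 / N)) ^ n
              ≤ (1 + -(1 / (N : ℝ))) ^ n * (1 + (s + 1 / N)) ^ n := by gcongr
            _ = ((1 + -(1 / (N : ℝ))) * (1 + (s + 1 / N))) ^ n := (mul_pow _ _ _).symm
            _ ≤ (1 + s) ^ n := pow_le_pow_left₀ (mul_nonneg h4 (by positivity)) h2 n
        rw [mul_pow, mul_pow, ← mul_assoc]
        gcongr
  have := key N
  rw [div_self hN0.ne', one_smul, add_sub_cancel] at this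
  convert this using 2
  ring

lemma gridCorner_succ_mem {a x : EuclideanSpace ℝ (Fin n)} {l : ℝ} (hl : 0 < l) (k : ℕ)
    (i : Fin n) : gridCorner a l k x i ≤ gridCorner a l (k + 1) x i ∧
      gridCorner a l (k + 1) x i ≤ gridCorner a l k x i + l / 2 ^ (k + 1) := by
  have h1 := gridIndex_eq_div (a := a) (x := x) hl k i
  have h2 : 2 * gridIndex a l k x i ≤ gridIndex a l (k + 1) x i ∧
    gridIndex a l (k + 1) x i ≤ 2 * gridIndex a l k x i + 1 := by omega
  obtain ⟨h3, h4⟩ := h2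
  have h3' : (2 : ℝ) * gridIndex a l k x i ≤ gridIndex a l (k + 1) x i := by exact_mod_cast h3
  have h4' : (gridIndex a l (k + 1) x i : ℝ) ≤ 2 * gridIndex a l k x i + 1 := by exact_mod_cast h4
  have hpos : 0 < l / 2 ^ (k + 1) := by positivity
  have e : l / 2 ^ k = 2 * (l / 2 ^ (k + 1)) := by rw [pow_succ]; field_simp
  simp only [gridCorner]
  rw [e]
  constructor <;> nlinarith

/-- The stopping argument is applied to `f = -b` and `φ = -m`: doubling of `m` bounds the jumps, the
lower fraction bounds densities, and the upper tail transfers them to the stopped set. Exponential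
integrability of `m - b` makes `b` integrable and gives `m ≤ avg b + C' / s`. Replacing `m` by the
average then costs the modular a factor of at most `exp (P C' / s)`. -/
theorem ReverseHolderCondition.logCondition (hn : 1 ≤ n) (hp : RegularExponent p c P pinf K)
    (hb : Measurable b) (h : ReverseHolderCondition p pinf b) : LogCondition p pinf b := by
  obtain ⟨r, C, k, hr, hC, hk, h⟩ := h
  choose! m hm1 hm2 using h
  obtain ⟨k₀, S, -, hS, hmass⟩ := hp.exists_cubeModular_zero_bounds hn
  have hpm := hp.measurable
  -- Pointwise, the exponent 1 integrand is below that of exponent 0 where `b ≤ m` and below that of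
  -- exponent `r` elsewhere.
  have hT : ∀ a l, 0 < l → cubeModular p pinf b 1 (m a l) a l ≤ ENNReal.ofReal (S + C) := by
    intro a l hl
    rw [ENNReal.ofReal_add hS.le hC.le]
    refine le_trans ?_ (add_le_add (hmass a l hl).2 (hm1 a l hl))
    rw [cubeModular, cubeModular, ← lintegral_add_left (by fun_prop)]
    refine lintegral_mono fun x => ?_
    rw [← ENNReal.ofReal_add (Real.exp_pos _).le (Real.exp_pos _).le]
    refine ENNReal.ofReal_le_ofReal ?_
    rcases le_total (p x * (b x - m a l)) 0 with h0 | h0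
    · exact le_add_of_le_of_nonneg (Real.exp_le_exp.2 (by linarith)) (Real.exp_pos _).le
    · exact le_add_of_nonneg_of_le (Real.exp_pos _).le (Real.exp_le_exp.2 (by nlinarith))
  obtain ⟨γ, H, hγ, hγ1, hH, hlow⟩ := hp.exists_lower_fraction hn hr hC hk
  obtain ⟨H1, hH1, hup1⟩ := hp.exists_upper_tail hn (S + C) (ε := γ / 4) (by positivity)
  obtain ⟨H2, hH2, hup2⟩ := hp.exists_upper_tail hn (S + C) (ε := γ / 2) (by positivity)
  obtain ⟨S2, hS2, hsub⟩ := hp.exists_lintegral_sub_le_of_cubeModular hn (S + C)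
  obtain ⟨D, hD, hdbl⟩ := exists_doubling n (ε := γ / 4) (H := H + H1) (by positivity)
    (by linarith) (by positivity)
  have hmdbl := hdbl m fun a l a' l' hl hl' hss hv => le_of_fractions hl hl' hγ hss hv
    (hlow b hb a' l' _ hl' (hm1 a' l' hl') (hm2 a' l' hl')) (hup1 b hb a l _ hl (hT a l hl))
  have hθ0 : 0 ≤ (1 - γ) / (1 - γ / 2) := div_nonneg (by linarith) (by linarith)
  have hθ1 : (1 - γ) / (1 - γ / 2) < 1 := by rw [div_lt_one] <;> linarith
  -- The stopped set, times `1 - γ / 2`, is bounded by the set where `-b ≥ -m + H + 1`, of density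
  -- at most `1 - γ`; the quotient is below 1. The summand 1 makes this inequality strict against `m
  -- - H`.
  obtain ⟨s, C', hs, hC', hStopping⟩ := exists_lintegral_exp_le n (D := D) (L := H2 + H + 1) (H := H)
    hD (by positivity) hθ0 hθ1 (γ := 1 - γ) (by linarith)
  have hcompl : ∀ a l, 0 < l → volume (cube a l ∩ {x | b x < m a l - H}) ≤
      ENNReal.ofReal (1 - γ) * volume (cube a l) := by
    intro a l hl
    have h1 := hlow b hb a l _ hl (hm1 a l hl) (hm2 a l hl)
    have hms : MeasurableSet {x | m a l - H ≤ b x} := measurableSet_le measurable_const hb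
    have h2 := measure_inter_add_sdiff (μ := volume) (cube a l) hms
    rw [ENNReal.ofReal_sub _ hγ.le, ENNReal.ofReal_one,
      ENNReal.sub_mul fun _ _ => volume_cube_ne_top hl, one_mul]
    refine ENNReal.le_sub_of_add_le_right (ENNReal.mul_ne_top ENNReal.ofReal_ne_top
      (volume_cube_ne_top hl)) ?_
    rw [← h2, add_comm]
    refine add_le_add (by rw [h2]; exact h1) (measure_mono ?_)
    rintro x ⟨hx, hxb⟩
    refine ⟨hx, ?_⟩
    simp only [mem_ofPred_eq, not_le] at hxb ⊢
    exact hxb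
  have hexp : ∀ a l, 0 < l → ∫⁻ x in cube a l, ENNReal.ofReal (Real.exp (s * (m a l - b x))) ≤
      ENNReal.ofReal C' * volume (cube a l) := by
    intro a l hl
    have hφ : ∀ k x, ∀ y ∈ gridCube a l k x, -m (gridCorner a l k y) (l / 2 ^ k) =
        -m (gridCorner a l k x) (l / 2 ^ k) := fun k x y hy => by rw [gridCorner_congr hl hy]
    have hlarge : ∀ x ∈ cube a l, ∀ k, volume (gridCube a l k x ∩
        {y | -b y < -m (gridCorner a l k x) (l / 2 ^ k) - H2}) ≤
        ENNReal.ofReal (γ / 2) * volume (gridCube a l k x) := fun x _ k => by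
      refine le_trans (measure_mono ?_) (hup2 b hb (gridCorner a l k x) (l / 2 ^ k) _
        (gridSide_pos hl k) (hT _ _ (gridSide_pos hl k)))
      rintro y ⟨hy, hyb⟩
      refine ⟨hy, ?_⟩
      simp only [mem_ofPred_eq] at hyb ⊢
      linarith
    have := hStopping a l hl volume (Measure.AbsolutelyContinuous.refl _) (fun x => -b x)
      (fun k x => -m (gridCorner a l k x) (l / 2 ^ k)) hb.neg hφ ?_ ?_ ?_
    · refine le_trans (le_of_eq ?_) this
      have hc0 : gridCorner a l 0 a = a := by ext i; simp [gridCorner, gridIndex]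
      simp only [hc0, pow_zero, div_one]
      refine lintegral_congr fun x => ?_
      ring_nf
    · intro x hx k
      have h1 := hmdbl (gridCorner a l (k + 1) x) (l / 2 ^ (k + 1)) (gridCorner a l k x)
        (gridSide_pos hl _) (gridCorner_succ_mem hl k)
      rw [show 2 * (l / 2 ^ (k + 1)) = l / 2 ^ k by rw [pow_succ]; field_simp] at h1
      linarith
    · intro x hx k
      have h1 := measure_exists_lt_le hl hφ hb.neg (H := H2) (L := H2 + H + 1) (ε := γ / 2)
        (by positivity) hlarge hx k
      have h2 : volume (gridCube a l k x ∩ {y | -m (gridCorner a l k x) (l / 2 ^ k) +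
          (H2 + H + 1) - H2 ≤ -b y}) ≤ ENNReal.ofReal (1 - γ) * volume (gridCube a l k x) := by
        refine le_trans (measure_mono ?_) (hcompl (gridCorner a l k x) (l / 2 ^ k)
          (gridSide_pos hl k))
        rintro y ⟨hy, hyb⟩
        refine ⟨hy, ?_⟩
        simp only [mem_ofPred_eq] at hyb ⊢
        linarith
      have h3 := h1.trans h2
      have h4 : 0 < 1 - γ / 2 := by linarith
      rw [show 1 - γ = (1 - γ / 2) * ((1 - γ) / (1 - γ / 2)) from (mul_div_cancel₀ _ h4.ne').symm,
        ENNReal.ofReal_mul h4.le, mul_assoc] at h3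
      rwa [ENNReal.mul_le_mul_iff_right (by simpa using h4) ENNReal.ofReal_ne_top] at h3
    · intro x hx k
      refine le_trans (measure_mono ?_) (hcompl (gridCorner a l k x) (l / 2 ^ k)
        (gridSide_pos hl k))
      rintro y ⟨hy, hyb⟩
      refine ⟨hy, ?_⟩
      simp only [mem_ofPred_eq] at hyb ⊢
      linarith
  have hneg : ∀ a l, 0 < l → ∫⁻ x in cube a l, ENNReal.ofReal (m a l - b x) ≤
      ENNReal.ofReal (C' / s) * volume (cube a l) := by
    intro a l hl
    calc _ ≤ ∫⁻ x in cube a l, ENNReal.ofReal (1 / s) *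
          ENNReal.ofReal (Real.exp (s * (m a l - b x))) := by
          refine lintegral_mono fun x => ?_
          rw [← ENNReal.ofReal_mul (by positivity)]
          refine ENNReal.ofReal_le_ofReal ?_
          rw [one_div, ← div_eq_inv_mul, le_div_iff₀ hs]
          linarith [Real.add_one_le_exp (s * (m a l - b x))]
      _ = ENNReal.ofReal (1 / s) * ∫⁻ x in cube a l,
          ENNReal.ofReal (Real.exp (s * (m a l - b x))) := lintegral_const_mul _ (by fun_prop)
      _ ≤ ENNReal.ofReal (1 / s) * (ENNReal.ofReal C' * volume (cube a l)) := by
          gcongr; exact hexp a l hl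
      _ = _ := by rw [← mul_assoc, ← ENNReal.ofReal_mul (by positivity)]; ring_nf
  have hpos : ∀ a l, 0 < l → ∫⁻ x in cube a l, ENNReal.ofReal (b x - m a l) ≤
      ENNReal.ofReal S2 * volume (cube a l) := fun a l hl => hsub b hb a l _ hl (hT a l hl)
  have hint : ∀ a l, 0 < l → IntegrableOn b (cube a l) := by
    intro a l hl
    have h1 : IntegrableOn (fun x => b x - m a l) (cube a l) := by
      refine ⟨by fun_prop, ?_⟩
      rw [hasFiniteIntegral_iff_norm]
      have h2 : ∀ x, ENNReal.ofReal ‖b x - m a l‖ ≤ ENNReal.ofReal (b x - m a l) +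
          ENNReal.ofReal (m a l - b x) := fun x => by
        rw [Real.norm_eq_abs]
        rcases le_total (m a l) (b x) with h | h
        · rw [abs_of_nonneg (by linarith)]; exact le_self_add
        · rw [abs_of_nonpos (by linarith), neg_sub]; exact le_add_self
      refine (lintegral_mono h2).trans_lt ?_
      rw [lintegral_add_left (by fun_prop)]
      have hv := (volume_cube_ne_top (a := a) hl).lt_top
      exact ENNReal.add_lt_top.2 ⟨(hpos a l hl).trans_lt (ENNReal.mul_lt_top ENNReal.ofReal_lt_top hv),
        (hneg a l hl).trans_lt (ENNReal.mul_lt_top ENNReal.ofReal_lt_top hv)⟩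
    have h3 : IntegrableOn (fun _ => m a l) (cube a l) :=
      integrableOn_const (volume_cube_ne_top hl)
    exact (h1.add h3).congr_fun (fun x _ => by simp) measurableSet_cube
  refine ⟨hint, Real.exp (P * (C' / s)) * (S + C), by positivity, fun a l hl => ?_⟩
  have havg : m a l - (⨍ y in cube a l, b y) ≤ C' / s := by
    have hln : 0 < l ^ n := by positivity
    have h3 : IntegrableOn (fun _ => m a l) (cube a l) :=
      integrableOn_const (volume_cube_ne_top hl)
    have h4 : ∫ x in cube a l, (m a l - b x) = l ^ n * (m a l - ⨍ y in cube a l, b y) := by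
      rw [integral_sub h3 (hint a l hl), setAverage_eq, setIntegral_const, volume_real_cube hl,
        smul_eq_mul, smul_eq_mul]
      field_simp
    have h5 : ∫ x in cube a l, (m a l - b x) ≤ C' / s * l ^ n := by
      refine integral_le_of_lintegral_ofReal_le (h3.sub (hint a l hl)) (by positivity) ?_
      refine (hneg a l hl).trans (le_of_eq ?_)
      rw [volume_cube hl, ENNReal.ofReal_mul (by positivity)]
    rw [h4, mul_comm, mul_le_mul_iff_left₀ hln] at h5
    exact h5
  calc cubeModular p pinf b 1 (⨍ y in cube a l, b y) a l
      ≤ ∫⁻ x in cube a l, ENNReal.ofReal (Real.exp (P * (C' / s))) * ENNReal.ofReal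
        (Real.exp (1 * p x * (b x - m a l) - p x * cubeExp p pinf a l)) := by
        refine lintegral_mono fun x => ?_
        rw [← ENNReal.ofReal_mul (Real.exp_pos _).le, ← Real.exp_add]
        refine ENNReal.ofReal_le_ofReal (Real.exp_le_exp.2 ?_)
        have h6 : p x * (m a l - ⨍ y in cube a l, b y) ≤ P * (C' / s) :=
          (mul_le_mul_of_nonneg_left havg (hp.pos x).le).trans
            (mul_le_mul_of_nonneg_right (hp.le x) (by positivity))
        linarith
    _ = ENNReal.ofReal (Real.exp (P * (C' / s))) * cubeModular p pinf b 1 (m a l) a l :=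
        lintegral_const_mul _ (by fun_prop)
    _ ≤ _ := by
        rw [ENNReal.ofReal_mul (Real.exp_pos _).le]
        gcongr
        exact hT a l hl

end VariableWeights

/-! ### Bounded mean oscillation and cubes controlled by the distance to the origin -/

namespace VariableWeights

/-- The average of `b` over `cube a l`. -/
noncomputable def cubeAvg {n : ℕ} (b : EuclideanSpace ℝ (Fin n) → ℝ)
    (a : EuclideanSpace ℝ (Fin n)) (l : ℝ) : ℝ := ⨍ y in cube a l, b y

/-- The average of `b` over the cube of the `k`-th grid that contains `x`. -/
noncomputable def gridAvg {n : ℕ} (b : EuclideanSpace ℝ (Fin n) → ℝ)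
    (a : EuclideanSpace ℝ (Fin n)) (l : ℝ) (k : ℕ) (x : EuclideanSpace ℝ (Fin n)) : ℝ :=
  cubeAvg b (gridCorner a l k x) (l / 2 ^ k)

/-- Bounded mean oscillation on cubes. -/
def HasOscBound {n : ℕ} (b : EuclideanSpace ℝ (Fin n) → ℝ) (B : ℝ) : Prop :=
  ∀ (a : EuclideanSpace ℝ (Fin n)) (l : ℝ), 0 < l →
    ∫⁻ x in cube a l, ENNReal.ofReal |b x - cubeAvg b a l| ≤ ENNReal.ofReal B * volume (cube a l)

variable {n : ℕ} {p b : EuclideanSpace ℝ (Fin n) → ℝ} {c P pinf K B C : ℝ}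
  {a x y : EuclideanSpace ℝ (Fin n)} {l : ℝ}

lemma gridCorner_zero : gridCorner a l 0 a = a := by ext i; simp [gridCorner, gridIndex]

lemma gridAvg_congr (hl : 0 < l) {k : ℕ} (h : y ∈ gridCube a l k x) :
    gridAvg b a l k y = gridAvg b a l k x := by
  simp [gridAvg, gridCorner_congr hl h]

lemma gridAvg_zero (hl : 0 < l) (hx : x ∈ cube a l) : gridAvg b a l 0 x = cubeAvg b a l := by
  rw [gridAvg_congr hl (x := a) (by rwa [gridCube_zero hl (self_mem_cube hl)])]
  simp [gridAvg, gridCorner_zero]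

/-- The modular bound controls only the positive part of `b - avg b`, but its integral vanishes, so
the negative part has the same size. -/
lemma exists_hasOscBound (hn : 1 ≤ n) (hp : RegularExponent p c P pinf K)
    (hb : Measurable b) (h : LogCondition p pinf b) : ∃ B : ℝ, 0 < B ∧ HasOscBound b B := by
  obtain ⟨hint, C, hC, h⟩ := h
  obtain ⟨S, hS, hsub⟩ := hp.exists_lintegral_sub_le_of_cubeModular hn C
  refine ⟨2 * S, by positivity, fun a l hl => ?_⟩
  have h1 := hsub b hb a l _ hl (h a l hl)
  set m := cubeAvg b a l with hm
  have hconst : IntegrableOn (fun _ => m) (cube a l) := integrableOn_const (volume_cube_ne_top hl)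
  have hdi : IntegrableOn (fun x => b x - m) (cube a l) := (hint a l hl).sub hconst
  have hln : 0 < l ^ n := by positivity
  have hzero : ∫ x in cube a l, (b x - m) = 0 := by
    rw [integral_sub (hint a l hl) hconst, setIntegral_const, hm, cubeAvg, setAverage_eq,
      volume_real_cube hl]
    simp only [smul_eq_mul]
    field_simp
    simp
  rw [integral_eq_lintegral_pos_part_sub_lintegral_neg_part hdi] at hzero
  have hfin1 : ∫⁻ x in cube a l, ENNReal.ofReal (b x - m) ≠ ∞ :=
    (h1.trans_lt (ENNReal.mul_lt_top ENNReal.ofReal_lt_top (volume_cube_ne_top hl).lt_top)).ne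
  have hfin2 : ∫⁻ x in cube a l, ENNReal.ofReal (-(b x - m)) ≠ ∞ := by
    have := hdi.neg.lintegral_lt_top
    exact this.ne
  have heq : ∫⁻ x in cube a l, ENNReal.ofReal (-(b x - m)) =
      ∫⁻ x in cube a l, ENNReal.ofReal (b x - m) := by
    rw [← ENNReal.toReal_eq_toReal_iff' hfin2 hfin1]
    linarith
  calc _ = ∫⁻ x in cube a l, (ENNReal.ofReal (b x - m) + ENNReal.ofReal (-(b x - m))) := by
        refine lintegral_congr fun x => ?_
        rcases le_total m (b x) with h | h
        · rw [abs_of_nonneg (by linarith), ENNReal.ofReal_of_nonpos (p := -(b x - m)) (by linarith),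
            add_zero]
        · rw [abs_of_nonpos (by linarith), ENNReal.ofReal_of_nonpos (p := b x - m) (by linarith),
            zero_add]
    _ = 2 * ∫⁻ x in cube a l, ENNReal.ofReal (b x - m) := by
        rw [lintegral_add_left (by fun_prop), heq, two_mul]
    _ ≤ 2 * (ENNReal.ofReal S * volume (cube a l)) := by gcongr; exact h1
    _ = _ := by
        rw [ENNReal.ofReal_mul (by norm_num), mul_assoc]
        simp

namespace HasOscBound

lemma measure_le (h : HasOscBound b B) (hb : Measurable b) (hl : 0 < l) {t e : ℝ} (ht : 0 < t)
    (he : B ≤ t * e) : volume (cube a l ∩ {x | t ≤ |b x - cubeAvg b a l|}) ≤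
      ENNReal.ofReal e * volume (cube a l) := by
  have h1 := h a l hl
  have hms : MeasurableSet {x | t ≤ |b x - cubeAvg b a l|} :=
    measurableSet_le measurable_const (by fun_prop)
  have h2 : ENNReal.ofReal t * volume (cube a l ∩ {x | t ≤ |b x - cubeAvg b a l|}) ≤
      ENNReal.ofReal t * (ENNReal.ofReal e * volume (cube a l)) := by
    rw [← mul_assoc, ← ENNReal.ofReal_mul ht.le]
    calc _ = ∫⁻ _ in cube a l ∩ {x | t ≤ |b x - cubeAvg b a l|}, ENNReal.ofReal t := by simp
      _ ≤ ∫⁻ x in cube a l ∩ {x | t ≤ |b x - cubeAvg b a l|},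
            ENNReal.ofReal |b x - cubeAvg b a l| :=
          setLIntegral_mono' (measurableSet_cube.inter hms) fun x hx =>
            ENNReal.ofReal_le_ofReal hx.2
      _ ≤ _ := lintegral_mono_set inter_subset_left
      _ ≤ _ := h1
      _ ≤ _ := by gcongr
  rwa [ENNReal.mul_le_mul_iff_right (by simpa using ht) ENNReal.ofReal_ne_top] at h2

lemma abs_gridAvg_succ_sub_le (h : HasOscBound b B) (hb : Measurable b) (hB : 0 ≤ B) (hl : 0 < l)
    (k : ℕ) : |gridAvg b a l (k + 1) x - gridAvg b a l k x| ≤ B * (1 + 2 ^ n) := by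
  set m := gridAvg b a l (k + 1) x
  set m' := gridAvg b a l k x
  have hl1 := gridSide_pos hl (k + 1)
  have h1 := h (gridCorner a l (k + 1) x) _ hl1
  have h2 := (lintegral_mono_set (gridCube_succ_subset (x := x) hl k)).trans
    (h (gridCorner a l k x) _ (gridSide_pos hl k))
  have hvol : volume (gridCube a l k x) = ENNReal.ofReal (2 ^ n) * volume (gridCube a l (k + 1) x) := by
    rw [volume_gridCube hl, volume_gridCube hl, ← ENNReal.ofReal_mul (by positivity), ← mul_pow]
    congr 2
    rw [pow_succ]; field_simp
  have h3 : ENNReal.ofReal |m - m'| * volume (gridCube a l (k + 1) x) ≤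
      ENNReal.ofReal (B * (1 + 2 ^ n)) * volume (gridCube a l (k + 1) x) := by
    calc _ = ∫⁻ _ in gridCube a l (k + 1) x, ENNReal.ofReal |m - m'| := by simp
      _ ≤ ∫⁻ y in gridCube a l (k + 1) x, (ENNReal.ofReal |b y - m| + ENNReal.ofReal |b y - m'|) := by
          refine lintegral_mono fun y => ?_
          rw [← ENNReal.ofReal_add (abs_nonneg _) (abs_nonneg _)]
          refine ENNReal.ofReal_le_ofReal ?_
          rw [abs_sub_comm (b y) m]
          exact abs_sub_le _ _ _
      _ ≤ ENNReal.ofReal B * volume (gridCube a l (k + 1) x) +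
            ENNReal.ofReal B * volume (gridCube a l k x) := by
          rw [lintegral_add_left (by fun_prop)]
          exact add_le_add h1 h2
      _ = _ := by
          rw [hvol, mul_add, mul_one, ENNReal.ofReal_add hB (by positivity), ENNReal.ofReal_mul hB]
          ring
  exact (ofReal_mul_volume_cube_le_iff hl1 (by positivity)).1 h3

lemma abs_gridAvg_sub_le (h : HasOscBound b B) (hb : Measurable b) (hB : 0 ≤ B) (hl : 0 < l)
    {j k : ℕ} (hjk : j ≤ k) :
    |gridAvg b a l k x - gridAvg b a l j x| ≤ B * (1 + 2 ^ n) * (k - j) := by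
  induction k, hjk using Nat.le_induction with
  | base => simp
  | succ k hk ih =>
    have h1 := h.abs_gridAvg_succ_sub_le (a := a) (x := x) hb hB hl k
    calc _ ≤ |gridAvg b a l (k + 1) x - gridAvg b a l k x| +
          |gridAvg b a l k x - gridAvg b a l j x| := abs_sub_le _ _ _
      _ ≤ B * (1 + 2 ^ n) + B * (1 + 2 ^ n) * (k - j) := add_le_add h1 ih
      _ = _ := by push_cast; ring

end HasOscBound

/-- Half of the cube is lost to the exceptional set and a quarter to large oscillation. On the
remaining quarter `|b - avg b| < 4 B`, and the density is comparable to `1 / |Q|`. -/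
lemma exists_le_cubeModular_avg (hn : 1 ≤ n) (hp : RegularExponent p c P pinf K)
    (hb : Measurable b) (hB : 0 < B) (h : HasOscBound b B) :
    ∃ k : ℝ, 0 < k ∧ ∀ (a : EuclideanSpace ℝ (Fin n)) (l : ℝ), 0 < l →
      ENNReal.ofReal k ≤ cubeModular p pinf b 1 (cubeAvg b a l) a l := by
  obtain ⟨K', hK', hexc⟩ := hp.exists_exceptional hn (η := 1 / 4) (by norm_num) (by norm_num)
  have hP := hp.P_pos
  refine ⟨Real.exp (-(P * (4 * B)) - K') / 4, by positivity, fun a l hl => ?_⟩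
  obtain ⟨U, hU, hUv, -, hUd, -⟩ := hexc a l hl
  have hms : MeasurableSet {x | 4 * B ≤ |b x - cubeAvg b a l|} :=
    measurableSet_le measurable_const (by fun_prop)
  have h1 := measure_diff_ge (S := cube a l) (V := U) (W := {x | 4 * B ≤ |b x - cubeAvg b a l|})
    (v := 1 / 2) (w := 1 / 4) (by norm_num) (by norm_num) (volume_cube_ne_top hl)
    ((measure_mono inter_subset_right).trans (hUv.trans (by norm_num)))
    (h.measure_le hb hl (by positivity) (by linarith))
  have h2 := exp_mul_measure_le_setLIntegral
    (f := fun x => 1 * p x * (b x - cubeAvg b a l) - p x * cubeExp p pinf a l)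
    (-(P * (4 * B)) - K' - n * Real.log l) (S := cube a l)
    (T := cube a l \ (U ∪ {x | 4 * B ≤ |b x - cubeAvg b a l|}))
    (measurableSet_cube.diff (hU.union hms)) sdiff_subset (fun x hx => by
      simp only [mem_sdiff, mem_union, mem_ofPred_eq, not_or, not_le] at hx
      obtain ⟨hx, hxU, hxb⟩ := hx
      have h3 := (abs_le.1 (hUd x hx hxU)).2
      have h4 : |p x * (b x - cubeAvg b a l)| ≤ P * (4 * B) := by
        rw [abs_mul, abs_of_pos (hp.pos x)]
        exact mul_le_mul (hp.le x) hxb.le (abs_nonneg _) hP.le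
      have h5 := (abs_le.1 h4).1
      linarith)
  refine le_trans ?_ h2
  refine le_trans ?_ (mul_le_mul_right h1 _)
  rw [volume_cube hl, ← ENNReal.ofReal_mul (by norm_num), ← ENNReal.ofReal_mul (Real.exp_pos _).le]
  refine ENNReal.ofReal_le_ofReal (le_of_eq ?_)
  have hln : 0 < l ^ n := by positivity
  rw [Real.exp_sub _ (n * Real.log l), Real.exp_nat_mul, Real.exp_log hl]
  field_simp
  norm_num

lemma cubeModular_ge_of_cubeDev (hl : 0 < l) {m r K' : ℝ} {S : Set (EuclideanSpace ℝ (Fin n))}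
    (hp : RegularExponent p c P pinf K) (hb : Measurable b)
    (hSm : MeasurableSet S) (hS : S ⊆ cube a l) (hd : ∀ x ∈ S, cubeDev p pinf a l x ≤ K') :
    ∫⁻ x in S, ENNReal.ofReal (Real.exp (r * p x * (b x - m))) ≤
      ENNReal.ofReal (Real.exp K') * volume (cube a l) * cubeModular p pinf b r m a l := by
  have hpm := hp.measurable
  rw [volume_cube hl, ← ENNReal.ofReal_mul (Real.exp_pos _).le, cubeModular,
    ← lintegral_const_mul _ (by fun_prop)]
  refine le_trans ?_ (lintegral_mono_set hS)
  refine setLIntegral_mono' hSm fun x hx => ?_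
  rw [← ENNReal.ofReal_mul (by positivity)]
  refine ENNReal.ofReal_le_ofReal ?_
  have h1 : l ^ n = Real.exp (n * Real.log l) := by rw [Real.exp_nat_mul, Real.exp_log hl]
  rw [h1, ← Real.exp_add, ← Real.exp_add]
  refine Real.exp_le_exp.2 ?_
  have := (abs_le.1 (hd x hx)).2
  linarith

lemma lintegral_exp_mono_exponent {α : Type*} [MeasurableSpace α] {μ : Measure α} {f : α → ℝ}
    {r s : ℝ} (hr : 0 ≤ r) (hrs : r ≤ s) :
    ∫⁻ x, ENNReal.ofReal (Real.exp (r * f x)) ∂μ ≤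
      μ univ + ∫⁻ x, ENNReal.ofReal (Real.exp (s * f x)) ∂μ := by
  rw [← one_mul (μ univ), ← lintegral_const, ← lintegral_add_left measurable_const]
  refine lintegral_mono fun x => ?_
  rcases le_total (f x) 0 with h | h
  · refine le_add_right (ENNReal.ofReal_le_one.2 (Real.exp_le_one_iff.2 ?_))
    exact mul_nonpos_of_nonneg_of_nonpos hr h
  · exact le_add_left (ENNReal.ofReal_le_ofReal (Real.exp_le_exp.2 (by gcongr)))

/-- Reverse Hölder inequality on cubes whose side length is controlled by the distance to the
origin. -/
lemma exists_reverse_holder_good (hp : RegularExponent p c P pinf K)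
    (hb : Measurable b) (hB : 0 < B) (h : HasOscBound b B) (hC : 0 < C)
    (hmod : ∀ (a : EuclideanSpace ℝ (Fin n)) (l : ℝ), 0 < l →
      cubeModular p pinf b 1 (cubeAvg b a l) a l ≤ ENNReal.ofReal C) {C₁ : ℝ} (hC₁ : 0 ≤ C₁) :
    ∃ s C' : ℝ, 0 < s ∧ 0 < C' ∧ ∀ (a : EuclideanSpace ℝ (Fin n)) (l : ℝ), 0 < l →
      (∀ x ∈ cube a l, Real.log l ≤ C₁ * Real.log (Real.exp 1 + ‖x‖)) →
      ∀ r, 0 ≤ r → r ≤ 1 + s →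
      ∫⁻ x in cube a l, ENNReal.ofReal (Real.exp (r * (p x * (b x - cubeAvg b a l)))) ≤
        ENNReal.ofReal C' * volume (cube a l) := by
  have hP := hp.P_pos
  have hK := hp.K_nonneg
  have hc := hp.c_pos
  have hpi := hp.pinf_pos
  set D := B * (1 + 2 ^ n) with hD
  have hD0 : 0 ≤ D := by positivity
  have hlog2 : 0 < Real.log 2 := Real.log_pos (by norm_num)
  set E := D * ((K + 2 * C₁ * K) / Real.log 2) with hE
  have hE0 : 0 ≤ E := by positivity
  set K' := (n * K / c + n * K / pinf) * (1 + C₁) with hK'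
  set A := 1 + C * Real.exp (E + K') with hA
  obtain ⟨s, C', hs, hC', hrh⟩ := exists_reverse_holder n (A := A) (H := E + P * (4 * B))
    (by rw [hA]; have : 0 < C * Real.exp (E + K') := by positivity
        linarith) (by positivity)
  refine ⟨s, 1 + C', hs, by positivity, fun a l hl hgood r hr0 hr1 => ?_⟩
  set m := cubeAvg b a l with hm
  have hpm := hp.measurable
  -- The error of freezing the exponent at generation `k`. The average has drifted by at most `D k`,
  -- and on a cube of side `l / 2 ^ k` the oscillation of `p` times `1 - log l + k log 2` is at most
  -- `K`. The remaining `log l` is absorbed by the decay of `p - pinf`, so the product is bounded in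
  -- `k`.
  have hosc : ∀ x ∈ cube a l, ∀ k, ∀ y ∈ gridCube a l k x,
      |p y - p (gridCorner a l k x)| * |gridAvg b a l k x - m| ≤ E := by
    intro x hx k y hy
    set a' := gridCorner a l k x with ha'
    have hl' := gridSide_pos hl k
    have ha'm : a' ∈ cube a l := gridCube_subset_cube hl hx k (self_mem_cube hl')
    have hym : y ∈ cube a l := gridCube_subset_cube hl hx k hy
    have h1 := hp.osc y a' _ hl' (norm_sub_le_of_mem_cube hy (self_mem_cube hl'))
    have h2 : |gridAvg b a l k x - m| ≤ D * k := by
      have := h.abs_gridAvg_sub_le (a := a) (x := x) hb hB.le hl (Nat.zero_le k)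
      rw [gridAvg_zero hl hx] at this
      simpa using this
    have h3 : Real.log (l / 2 ^ k) = Real.log l - k * Real.log 2 := by
      rw [Real.log_div hl.ne' (by positivity), Real.log_pow]
    have h4 : |p y - p a'| * Real.log l ≤ 2 * C₁ * K := by
      rcases le_total (Real.log l) 0 with h0 | h0
      · exact (mul_nonpos_of_nonneg_of_nonpos (abs_nonneg _) h0).trans (by positivity)
      · have h5 : ∀ z ∈ cube a l, |p z - pinf| * Real.log l ≤ C₁ * K := fun z hz => by
          calc _ ≤ |p z - pinf| * (C₁ * Real.log (Real.exp 1 + ‖z‖)) := by gcongr; exact hgood z hz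
            _ = C₁ * (|p z - pinf| * Real.log (Real.exp 1 + ‖z‖)) := by ring
            _ ≤ _ := by gcongr; exact hp.inf z
        have h6 : |p y - p a'| ≤ |p y - pinf| + |p a' - pinf| := by
          rw [abs_sub_comm (p a')]; exact abs_sub_le _ _ _
        have h7 := h5 y hym
        have h8 := h5 a' ha'm
        nlinarith
    have h9 : |p y - p a'| * k ≤ (K + 2 * C₁ * K) / Real.log 2 := by
      rw [le_div_iff₀ hlog2]
      rw [h3] at h1
      nlinarith [abs_nonneg (p y - p a')]
    calc _ ≤ |p y - p a'| * (D * k) := by gcongr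
      _ = D * (|p y - p a'| * k) := by ring
      _ ≤ E := by rw [hE]; gcongr
  have hshift : ∀ x ∈ cube a l, ∀ k, ∀ y ∈ gridCube a l k x,
      |p y * (b y - m) - p y * (b y - gridAvg b a l k x) -
        p (gridCorner a l k x) * (gridAvg b a l k x - m)| ≤ E := by
    intro x hx k y hy
    have := hosc x hx k y hy
    rw [← abs_mul] at this
    rwa [show p y * (b y - m) - p y * (b y - gridAvg b a l k x) -
      p (gridCorner a l k x) * (gridAvg b a l k x - m) =
      (p y - p (gridCorner a l k x)) * (gridAvg b a l k x - m) by ring]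
  -- The proxy `φ` is the drift of the average times the exponent frozen at the corner; the modular
  -- bound on each subcube gives the upper hypothesis, bounded oscillation the lower one.
  have key := hrh a l hl (fun x => p x * (b x - m))
    (fun k x => p (gridCorner a l k x) * (gridAvg b a l k x - m)) (by fun_prop)
    (fun k x y hy => by simp only [gridCorner_congr hl hy, gridAvg_congr hl hy]) ?_ ?_
  · have e0 : p (gridCorner a l 0 a) * (gridAvg b a l 0 a - m) = 0 := by
      rw [gridAvg_zero hl (self_mem_cube hl)]; simp [hm]
    rw [e0] at key
    simp only [sub_zero] at key
    refine (lintegral_exp_mono_exponent hr0 hr1).trans ?_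
    rw [Measure.restrict_apply_univ, ENNReal.ofReal_add zero_le_one hC'.le, add_mul,
      ENNReal.ofReal_one, one_mul]
    exact add_le_add le_rfl key
  · intro x hx k
    have hl' := gridSide_pos hl k
    have h1 := cubeModular_ge_of_cubeDev (m := gridAvg b a l k x) (r := 1) (K' := K') hl' hp hb
      (measurableSet_gridCube (a := a) (x := x) (l := l) k) Subset.rfl (fun y hy =>
        hp.cubeDev_le hl' hy hC₁ ((Real.log_le_log hl' (div_le_self hl.le
          (one_le_pow₀ (by norm_num)))).trans (hgood y (gridCube_subset_cube hl hx k hy))))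
    have h2 := h1.trans (mul_le_mul_right (hmod _ _ hl') _)
    calc _ ≤ ∫⁻ y in gridCube a l k x, ENNReal.ofReal (Real.exp (E + p (gridCorner a l k x) *
            (gridAvg b a l k x - m))) *
            ENNReal.ofReal (Real.exp (1 * p y * (b y - gridAvg b a l k x))) := by
          refine setLIntegral_mono' (measurableSet_gridCube k) fun y hy => ?_
          rw [← ENNReal.ofReal_mul (Real.exp_pos _).le, ← Real.exp_add]
          refine ENNReal.ofReal_le_ofReal (Real.exp_le_exp.2 ?_)
          have := (abs_le.1 (hshift x hx k y hy)).2
          linarith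
      _ = ENNReal.ofReal (Real.exp (E + p (gridCorner a l k x) * (gridAvg b a l k x - m))) *
            ∫⁻ y in gridCube a l k x,
              ENNReal.ofReal (Real.exp (1 * p y * (b y - gridAvg b a l k x))) :=
          lintegral_const_mul _ (by fun_prop)
      _ ≤ ENNReal.ofReal (Real.exp (E + p (gridCorner a l k x) * (gridAvg b a l k x - m))) *
            (ENNReal.ofReal (Real.exp K') * volume (gridCube a l k x) * ENNReal.ofReal C) := by
          gcongr; exact h2
      _ = ENNReal.ofReal (C * Real.exp (E + K') * Real.exp (p (gridCorner a l k x) *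
            (gridAvg b a l k x - m))) * volume (gridCube a l k x) := by
          rw [mul_right_comm (ENNReal.ofReal (Real.exp K')), ← mul_assoc,
            ← ENNReal.ofReal_mul (Real.exp_pos _).le, ← ENNReal.ofReal_mul (Real.exp_pos _).le]
          congr 2
          rw [Real.exp_add, Real.exp_add]
          ring
      _ ≤ _ := by
          gcongr
          rw [hA]; linarith
  · intro x hx k
    have hl' := gridSide_pos hl k
    refine le_trans (measure_mono ?_) (h.measure_le (a := gridCorner a l k x) hb hl' (t := 4 * B)
      (by positivity) (by linarith))
    rintro y ⟨hy, hyf⟩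
    refine ⟨hy, ?_⟩
    simp only [mem_ofPred_eq] at hyf ⊢
    have h1 := (abs_le.1 (hshift x hx k y hy)).1
    have h2 : p y * (b y - gridAvg b a l k x) < -(P * (4 * B)) := by linarith
    by_contra hcon
    have h3 : |b y - gridAvg b a l k x| < 4 * B := not_le.1 hcon
    have h4 : |p y * (b y - gridAvg b a l k x)| ≤ P * (4 * B) := by
      rw [abs_mul, abs_of_pos (hp.pos y)]
      exact mul_le_mul (hp.le y) h3.le (abs_nonneg _) hP.le
    linarith [(abs_le.1 h4).1]

end VariableWeights

/-! ### Coarse averages on large cubes -/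

namespace VariableWeights

variable {n : ℕ} {p b : EuclideanSpace ℝ (Fin n) → ℝ} {c P pinf K B C : ℝ}
  {a x y : EuclideanSpace ℝ (Fin n)} {l : ℝ}

lemma volume_setOf_Ioo {t : ℝ} (ht : 0 < t) :
    volume {z : EuclideanSpace ℝ (Fin n) | ∀ i, z i ∈ Ioo (-t) t} = ENNReal.ofReal ((2 * t) ^ n) := by
  rw [volume_setOf_forall_mem (fun _ => Ioo (-t) t)]
  simp only [Real.volume_Ioo, Finset.prod_const, Finset.card_univ, Fintype.card_fin]
  rw [← ENNReal.ofReal_pow (by linarith)]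
  ring_nf

lemma measurableSet_setOf_Ioo {t : ℝ} :
    MeasurableSet {z : EuclideanSpace ℝ (Fin n) | ∀ i, z i ∈ Ioo (-t) t} := by
  rw [ofPred_forall]
  exact MeasurableSet.iInter fun i => (by fun_prop : Measurable
    fun x : EuclideanSpace ℝ (Fin n) => x i) measurableSet_Ioo

lemma le_norm_of_notMem_setOf_Ioo {t : ℝ}
    (hx : x ∉ {z : EuclideanSpace ℝ (Fin n) | ∀ i, z i ∈ Ioo (-t) t}) : t ≤ ‖x‖ := by
  simp only [mem_ofPred_eq, not_forall] at hx
  obtain ⟨i, hi⟩ := hx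
  have h2 : t ≤ |x i| := by
    by_contra hc
    exact hi (abs_lt.1 (not_le.1 hc))
  exact h2.trans (by simpa using PiLp.norm_apply_le x i)

lemma log_le_of_le_four_mul_norm {ρ : ℝ} (hρ : 0 < ρ) (h : ρ / 4 ≤ ‖x‖) :
    Real.log ρ ≤ (1 + Real.log 4) * Real.log (Real.exp 1 + ‖x‖) := by
  have h1 := one_le_log_exp_add (norm_nonneg x)
  have h2 : Real.log (ρ / 4) ≤ Real.log (Real.exp 1 + ‖x‖) :=
    Real.log_le_log (by positivity) (h.trans (by linarith [Real.exp_pos 1]))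
  rw [Real.log_div hρ.ne' (by norm_num)] at h2
  have h3 : 0 < Real.log 4 := Real.log_pos (by norm_num)
  nlinarith

/-- The bounds on the scale `l / 2 ^ k` when it is at least the square root of `l ≥ 1`. -/
lemma scale_bounds {k : ℕ} (hl : 1 ≤ l) (hk : l ≤ (l / 2 ^ k) ^ 2) :
    1 ≤ l / 2 ^ k ∧ Real.log l ≤ 2 * Real.log (l / 2 ^ k) ∧
      Real.log (l / 2 ^ k) = Real.log l - k * Real.log 2 ∧ k * Real.log 2 ≤ Real.log (l / 2 ^ k) := by
  have hl0 : 0 < l := by linarith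
  have h0 : 0 < l / 2 ^ k := gridSide_pos hl0 k
  have h1 : 1 ≤ l / 2 ^ k := by nlinarith
  have h2 : Real.log l ≤ 2 * Real.log (l / 2 ^ k) := by
    have := Real.log_le_log hl0 hk
    rwa [Real.log_pow] at this
  have h3 : Real.log (l / 2 ^ k) = Real.log l - k * Real.log 2 := by
    rw [Real.log_div hl0.ne' (by positivity), Real.log_pow]
  exact ⟨h1, h2, h3, by linarith⟩

/-- At least a quarter of the small cube satisfies both `|z| ≥ ρ / 4` and `|b - m'| < 4 B`. There
`log l ≤ 2 log ρ` is controlled by `log (e + |z|)`, so the normalization is comparable to the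
reciprocal volume, and replacing `p` by `pinf` is harmless because the drift `m' - m` is at most of
order `k`, hence of order `log ρ`. -/
lemma exists_exp_gridAvg_le (hn : 1 ≤ n) (hp : RegularExponent p c P pinf K)
    (hb : Measurable b) (hB : 0 < B) (h : HasOscBound b B) :
    ∃ A : ℝ, 0 < A ∧ ∀ (a : EuclideanSpace ℝ (Fin n)) (l : ℝ) (k : ℕ), 1 ≤ l →
      l ≤ (l / 2 ^ k) ^ 2 → ∀ x j, j ≤ k →
      ENNReal.ofReal (Real.exp (pinf * (gridAvg b a l k x - gridAvg b a l j x))) *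
        volume (gridCube a l k x) ≤ ENNReal.ofReal A * volume (gridCube a l j x) *
        ∫⁻ y in gridCube a l k x, ENNReal.ofReal (Real.exp (1 * p y * (b y - gridAvg b a l j x) -
          p y * cubeExp p pinf (gridCorner a l j x) (l / 2 ^ j))) := by
  have hP := hp.P_pos
  have hK := hp.K_nonneg
  have hc := hp.c_pos
  have hpi := hp.pinf_pos
  set D := B * (1 + 2 ^ n) with hD
  have hD0 : 0 ≤ D := by positivity
  have hlog2 : 0 < Real.log 2 := Real.log_pos (by norm_num)
  have hlog4 : 0 < Real.log 4 := Real.log_pos (by norm_num)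
  set C₁ := 2 * (1 + Real.log 4) with hC₁
  set K' := (n * K / c + n * K / pinf) * (1 + C₁) with hK'
  set E := D * (C₁ * K) / Real.log 2 with hE
  refine ⟨4 * Real.exp (P * (4 * B) + E + K'), by positivity, fun a l k hl hk x j hjk => ?_⟩
  have hl0 : 0 < l := by linarith
  obtain ⟨hρ1, hρ2, hρ3, hρ4⟩ := scale_bounds hl hk
  set ρ := l / 2 ^ k with hρ
  have hρ0 : 0 < ρ := by linarith
  set m := gridAvg b a l j x with hm
  set m' := gridAvg b a l k x with hm'
  have hj0 := gridSide_pos hl0 j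
  have hsubj : gridCube a l k x ⊆ gridCube a l j x := gridCube_antitone hl0 hjk
  set V : Set (EuclideanSpace ℝ (Fin n)) := {z | ∀ i, z i ∈ Ioo (-(ρ / 4)) (ρ / 4)} with hV
  set W : Set (EuclideanSpace ℝ (Fin n)) := {z | 4 * B ≤ |b z - m'|} with hW
  have hVm : MeasurableSet V := measurableSet_setOf_Ioo
  have hWm : MeasurableSet W := measurableSet_le measurable_const (by fun_prop)
  have hVv : volume (gridCube a l k x ∩ V) ≤ ENNReal.ofReal (1 / 2) * volume (gridCube a l k x) := by
    refine (measure_mono inter_subset_right).trans ?_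
    rw [hV, volume_setOf_Ioo (by positivity), volume_gridCube hl0,
      ← ENNReal.ofReal_mul (by norm_num)]
    refine ENNReal.ofReal_le_ofReal ?_
    rw [show 2 * (ρ / 4) = 1 / 2 * ρ by ring, mul_pow]
    gcongr
    exact pow_le_of_le_one (by norm_num) (by norm_num) (by omega)
  have h1 := measure_diff_ge (by norm_num) (by norm_num) (volume_gridCube_ne_top hl0 k) hVv
    (h.measure_le (a := gridCorner a l k x) hb hρ0 (t := 4 * B) (e := 1 / 4) (by positivity)
      (by linarith))
  have hlow : ∀ z ∈ gridCube a l k x \ (V ∪ W),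
      pinf * (m' - m) - (P * (4 * B) + E + K') - n * Real.log (l / 2 ^ j) ≤
      1 * p z * (b z - m) - p z * cubeExp p pinf (gridCorner a l j x) (l / 2 ^ j) := by
    rintro z ⟨hz, hzVW⟩
    simp only [mem_union, not_or] at hzVW
    have hzn := log_le_of_le_four_mul_norm hρ0 (le_norm_of_notMem_setOf_Ioo hzVW.1)
    have hzb : |b z - m'| < 4 * B := by
      have := hzVW.2
      simp only [hW, mem_ofPred_eq, not_le] at this
      exact this
    have h2 : |p z * (b z - m')| ≤ P * (4 * B) := by
      rw [abs_mul, abs_of_pos (hp.pos z)]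
      exact mul_le_mul (hp.le z) hzb.le (abs_nonneg _) hP.le
    have hlz := one_le_log_exp_add (norm_nonneg z)
    have h3 : cubeDev p pinf (gridCorner a l j x) (l / 2 ^ j) z ≤ K' := by
      refine hp.cubeDev_le hj0 (hsubj hz) (by positivity) ?_
      have : Real.log (l / 2 ^ j) ≤ Real.log l :=
        Real.log_le_log hj0 (div_le_self hl0.le (one_le_pow₀ (by norm_num)))
      rw [hC₁]
      linarith
    have h4 : |(p z - pinf) * (m' - m)| ≤ E := by
      have h5 := h.abs_gridAvg_sub_le (a := a) (x := x) hb hB.le hl0 hjk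
      have h6 : D * ((k : ℝ) - j) ≤ D * k := by
        gcongr
        linarith [(Nat.cast_nonneg j : (0 : ℝ) ≤ j)]
      have hkC : k * Real.log 2 ≤ C₁ * Real.log (Real.exp 1 + ‖z‖) := by
        have : 0 ≤ (1 + Real.log 4) * Real.log (Real.exp 1 + ‖z‖) := by positivity
        rw [hC₁]
        linarith
      rw [abs_mul, hE, le_div_iff₀ hlog2]
      calc |p z - pinf| * |m' - m| * Real.log 2
          ≤ |p z - pinf| * (D * k) * Real.log 2 := by gcongr; exact h5.trans h6
        _ = D * (|p z - pinf| * (k * Real.log 2)) := by ring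
        _ ≤ D * (|p z - pinf| * (C₁ * Real.log (Real.exp 1 + ‖z‖))) :=
            mul_le_mul_of_nonneg_left (mul_le_mul_of_nonneg_left hkC (abs_nonneg _)) hD0
        _ = D * (C₁ * (|p z - pinf| * Real.log (Real.exp 1 + ‖z‖))) := by ring
        _ ≤ D * (C₁ * K) := by gcongr; exact hp.inf z
    have e1 := (abs_le.1 h2).1
    have e2 := (abs_le.1 h3).2
    have e3 := (abs_le.1 h4).1
    have : 1 * p z * (b z - m) = p z * (b z - m') + pinf * (m' - m) + (p z - pinf) * (m' - m) := by
      ring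
    linarith
  have h2 := exp_mul_measure_le_setLIntegral _ (S := gridCube a l k x)
    ((measurableSet_gridCube k).diff (hVm.union hWm)) sdiff_subset hlow
  have h3 := (mul_le_mul_right h1 _).trans h2
  refine le_trans (le_of_eq ?_) (mul_le_mul_right h3 _)
  rw [volume_gridCube hl0 (k := j), ← mul_assoc, ← mul_assoc, ← ENNReal.ofReal_mul (by positivity),
    ← ENNReal.ofReal_mul (by positivity), ← ENNReal.ofReal_mul (by positivity)]
  congr 2
  rw [Real.exp_sub _ (n * _), Real.exp_sub (pinf * _), Real.exp_nat_mul, Real.exp_log hj0]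
  have : (l / 2 ^ j) ^ n ≠ 0 := by positivity
  field_simp
  norm_num

/-- Reverse Hölder inequality for the averages of `b` at the scale `l / 2 ^ k ≥ √l`. -/
lemma exists_reverse_holder_gridAvg (hn : 1 ≤ n) (hp : RegularExponent p c P pinf K)
    (hb : Measurable b) (hB : 0 < B) (h : HasOscBound b B) (hC : 0 < C)
    (hmod : ∀ (a : EuclideanSpace ℝ (Fin n)) (l : ℝ), 0 < l →
      cubeModular p pinf b 1 (cubeAvg b a l) a l ≤ ENNReal.ofReal C) :
    ∃ s C' : ℝ, 0 < s ∧ 0 < C' ∧ ∀ (a : EuclideanSpace ℝ (Fin n)) (l : ℝ) (k : ℕ), 1 ≤ l →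
      l ≤ (l / 2 ^ k) ^ 2 →
      ∫⁻ x in cube a l, ENNReal.ofReal (Real.exp ((1 + s) *
        (pinf * (gridAvg b a l k x - cubeAvg b a l)))) ≤ ENNReal.ofReal C' * volume (cube a l) := by
  have hpi := hp.pinf_pos
  obtain ⟨A₀, hA₀, hcmp⟩ := exists_exp_gridAvg_le hn hp hb hB h
  obtain ⟨s, C', hs, hC', hrh⟩ := exists_reverse_holder n (A := 1 + A₀ * C) (H := pinf * (10 * B))
    (by have : 0 < A₀ * C := by positivity
        linarith) (by positivity)
  refine ⟨s, C', hs, hC', fun a l k hl hk => ?_⟩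
  have hl0 : 0 < l := by linarith
  have hpm := hp.measurable
  set M := cubeAvg b a l with hM
  have hgm : ∀ j, Measurable fun y => gridAvg b a l j y := fun j =>
    measurable_of_gridCube hl0 j fun x y hy => gridAvg_congr hl0 hy
  have hmono : ∀ (j : ℕ) (x y : EuclideanSpace ℝ (Fin n)), y ∈ gridCube a l j x →
      gridAvg b a l (min j k) y = gridAvg b a l (min j k) x := fun j x y hy =>
    gridAvg_congr hl0 (gridCube_antitone hl0 (min_le_left j k) hy)
  have hconst : ∀ (j : ℕ) (x y : EuclideanSpace ℝ (Fin n)), k ≤ j → y ∈ gridCube a l j x →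
      gridAvg b a l k y = gridAvg b a l (min j k) x := fun j x y hj hy => by
    rw [← hmono j x y hy, min_eq_right hj]
  -- The function is already constant on cubes of generation `k`, so the proxy is frozen there: `min
  -- j k`.
  have key := hrh a l hl0 (fun x => pinf * (gridAvg b a l k x - M))
    (fun j x => pinf * (gridAvg b a l (min j k) x - M)) (by have := hgm k; fun_prop)
    (fun j x y hy => by simp only [hmono j x y hy]) ?_ ?_
  · have e0 : pinf * (gridAvg b a l (min 0 k) a - M) = 0 := by
      rw [Nat.zero_min, gridAvg_zero hl0 (self_mem_cube hl0)]; simp [hM]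
    rw [e0] at key
    simpa only [sub_zero] using key
  · intro x hx j
    set φ := pinf * (gridAvg b a l (min j k) x - M) with hφ
    have hA1 : ENNReal.ofReal (Real.exp φ) ≤ ENNReal.ofReal ((1 + A₀ * C) * Real.exp φ) := by
      refine ENNReal.ofReal_le_ofReal ?_
      have : 0 < A₀ * C * Real.exp φ := by positivity
      linarith
    rcases le_total k j with hj | hj
    · calc _ = ∫⁻ _ in gridCube a l j x, ENNReal.ofReal (Real.exp φ) :=
            setLIntegral_congr_fun (measurableSet_gridCube j) fun y hy => by
              simp only [hφ, hconst j x y hj hy]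
        _ = ENNReal.ofReal (Real.exp φ) * volume (gridCube a l j x) := by simp
        _ ≤ _ := by gcongr
    · have hj0 := gridSide_pos hl0 j
      rw [min_eq_left hj] at hφ
      set m := gridAvg b a l j x with hm
      set g : EuclideanSpace ℝ (Fin n) → ℝ≥0∞ := fun y => ENNReal.ofReal (Real.exp (1 * p y *
        (b y - m) - p y * cubeExp p pinf (gridCorner a l j x) (l / 2 ^ j))) with hg
      have hQm := measurableSet_gridCube (a := a) (x := x) (l := l) j
      have hμν := measure_le_of_gridCube (a := a) hl0
        (μ := volume.withDensity fun y => ENNReal.ofReal (Real.exp (pinf * (gridAvg b a l k y - m))))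
        (ν := (ENNReal.ofReal A₀ * volume (gridCube a l j x)) • volume.withDensity g)
        (U := gridCube a l j x) (fun _ => k)
        (fun y hy z hz => ⟨by rw [← gridCube_congr hl0 hy]; exact gridCube_antitone hl0 hj hz, rfl⟩)
        (fun y hy => by
          rw [Measure.smul_apply, withDensity_apply _ (measurableSet_gridCube k),
            withDensity_apply _ (measurableSet_gridCube k), smul_eq_mul,
            setLIntegral_congr_fun (g := fun _ => ENNReal.ofReal (Real.exp
              (pinf * (gridAvg b a l k y - m)))) (measurableSet_gridCube k)
              (fun z hz => by simp only [gridAvg_congr hl0 hz])]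
          have := hcmp a l k hl hk y j hj
          rw [gridAvg_congr hl0 hy, gridCorner_congr hl0 hy, gridCube_congr hl0 hy] at this
          rw [lintegral_const, Measure.restrict_apply_univ]
          exact this)
      rw [Measure.smul_apply, withDensity_apply _ hQm, withDensity_apply _ hQm, smul_eq_mul] at hμν
      have hmodj : ∫⁻ y in gridCube a l j x, g y ≤ ENNReal.ofReal C := hmod _ _ hj0
      calc _ = ∫⁻ y in gridCube a l j x, ENNReal.ofReal (Real.exp φ) *
              ENNReal.ofReal (Real.exp (pinf * (gridAvg b a l k y - m))) := by
            refine lintegral_congr fun y => ?_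
            rw [← ENNReal.ofReal_mul (Real.exp_pos _).le, ← Real.exp_add, hφ]
            ring_nf
        _ = ENNReal.ofReal (Real.exp φ) * ∫⁻ y in gridCube a l j x,
              ENNReal.ofReal (Real.exp (pinf * (gridAvg b a l k y - m))) :=
            lintegral_const_mul _ (by have := hgm k; fun_prop)
        _ ≤ ENNReal.ofReal (Real.exp φ) * (ENNReal.ofReal A₀ * volume (gridCube a l j x) *
              ENNReal.ofReal C) := by
            gcongr
            exact hμν.trans (by gcongr)
        _ = ENNReal.ofReal (A₀ * C * Real.exp φ) * volume (gridCube a l j x) := by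
            rw [mul_right_comm (ENNReal.ofReal A₀), ← mul_assoc, ← ENNReal.ofReal_mul hA₀.le,
              ← ENNReal.ofReal_mul (Real.exp_pos _).le, mul_comm (Real.exp φ)]
        _ ≤ _ := by
            gcongr
            linarith
  · intro x hx j
    rcases le_total k j with hj | hj
    · have : gridCube a l j x ∩ {y | pinf * (gridAvg b a l k y - M) <
          pinf * (gridAvg b a l (min j k) x - M) - pinf * (10 * B)} = ∅ := by
        refine eq_empty_of_forall_notMem fun y hy => ?_
        have h1 := hy.2
        simp only [mem_ofPred_eq, hconst j x y hj hy.1] at h1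
        have : 0 < pinf * (10 * B) := by positivity
        linarith
      rw [this]
      simp
    · have hj0 := gridSide_pos hl0 j
      rw [min_eq_left hj]
      set m := gridAvg b a l j x with hm
      set W : Set (EuclideanSpace ℝ (Fin n)) := gridCube a l j x ∩ {z | 6 * B ≤ |b z - m|} with hW
      have hWm : MeasurableSet W := (measurableSet_gridCube j).inter
        (measurableSet_le measurable_const (by fun_prop))
      have hWv : volume W ≤ ENNReal.ofReal (1 / 6) * volume (gridCube a l j x) :=
        h.measure_le (a := gridCorner a l j x) hb hj0 (by positivity) (by linarith)
      set U : Set (EuclideanSpace ℝ (Fin n)) := gridCube a l j x ∩ {y |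
        pinf * (gridAvg b a l k y - M) < pinf * (m - M) - pinf * (10 * B)} with hU
      -- On a generation `k` cube whose average is below `m - 10 B`, three quarters of the points
      -- have `b < m - 6 B`. That set has density at most one sixth, so these cubes fill at most a
      -- quarter.
      have hμν := measure_le_of_gridCube (a := a) hl0 (μ := ENNReal.ofReal (1 - 1 / 4) • volume)
        (ν := volume.restrict W) (U := U) (fun _ => k)
        (fun y hy z hz => by
          refine ⟨⟨?_, ?_⟩, rfl⟩
          · rw [← gridCube_congr hl0 hy.1]; exact gridCube_antitone hl0 hj hz
          · have := hy.2
            simp only [mem_ofPred_eq, gridAvg_congr hl0 hz] at this ⊢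
            exact this)
        (fun y hy => by
          have hk0 := gridSide_pos hl0 k
          have h1 := measure_diff_ge (V := ∅) (v := 0) le_rfl (by norm_num)
            (volume_gridCube_ne_top (x := y) hl0 k) (by simp)
            (h.measure_le (a := gridCorner a l k y) hb hk0 (t := 4 * B) (e := 1 / 4)
              (by positivity) (by linarith))
          rw [Measure.smul_apply, smul_eq_mul, Measure.restrict_apply (measurableSet_gridCube k)]
          rw [sub_zero] at h1
          refine h1.trans (measure_mono ?_)
          rintro z ⟨hz, hzb⟩
          refine ⟨hz, ?_, ?_⟩
          · rw [← gridCube_congr hl0 hy.1]; exact gridCube_antitone hl0 hj hz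
          · simp only [mem_union, mem_empty_iff_false, false_or, mem_ofPred_eq, not_le] at hzb ⊢
            have h2 := hy.2
            simp only [mem_ofPred_eq] at h2
            have h3 : gridAvg b a l k y - M < m - M - 10 * B := by
              rw [← mul_sub] at h2
              exact lt_of_mul_lt_mul_left h2 hpi.le
            have h4 : b z - gridAvg b a l k y < 4 * B := (le_abs_self _).trans_lt hzb
            rw [abs_sub_comm]
            exact le_trans (by linarith) (le_abs_self _))
      rw [Measure.smul_apply, smul_eq_mul] at hμν
      have h5 : ENNReal.ofReal (1 - 1 / 4) * volume U ≤
          ENNReal.ofReal (1 - 1 / 4) * (ENNReal.ofReal (1 / 4) * volume (gridCube a l j x)) := by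
        refine hμν.trans (((measure_mono (subset_univ U)).trans
          (Measure.restrict_apply_univ W).le).trans (hWv.trans ?_))
        rw [← mul_assoc, ← ENNReal.ofReal_mul (by norm_num)]
        gcongr
        norm_num
      rwa [ENNReal.mul_le_mul_iff_right (by simp; norm_num) ENNReal.ofReal_ne_top] at h5

end VariableWeights

/-! ### Induction on scales for cubes near the origin -/

namespace VariableWeights

variable {n : ℕ} {p b : EuclideanSpace ℝ (Fin n) → ℝ} {c P pinf K B C : ℝ}
  {a x y : EuclideanSpace ℝ (Fin n)} {l : ℝ}

/-- The modular at scale `l` is controlled by the modular at scale `l / 2 ^ k ≥ √l`, with a gain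
that improves with `k`. -/
lemma exists_scale_step (hn : 1 ≤ n) (hp : RegularExponent p c P pinf K)
    (hb : Measurable b) (hB : 0 < B) (h : HasOscBound b B) (hC : 0 < C)
    (hmod : ∀ (a : EuclideanSpace ℝ (Fin n)) (l : ℝ), 0 < l →
      cubeModular p pinf b 1 (cubeAvg b a l) a l ≤ ENNReal.ofReal C) :
    ∃ r₁ K₂ A η : ℝ, 1 < r₁ ∧ 0 < K₂ ∧ 0 < A ∧ 0 < η ∧ ∀ r, 1 ≤ r → r ≤ r₁ →
      ∀ (a : EuclideanSpace ℝ (Fin n)) (l : ℝ) (k : ℕ), 1 ≤ l → l ≤ (l / 2 ^ k) ^ 2 →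
      ∀ T, 0 ≤ T → (∀ a' : EuclideanSpace ℝ (Fin n),
        cubeModular p pinf b r (cubeAvg b a' (l / 2 ^ k)) a' (l / 2 ^ k) ≤ ENNReal.ofReal T) →
      cubeModular p pinf b r (cubeAvg b a l) a l ≤
        ENNReal.ofReal (K₂ + A * Real.exp (-(η * k)) * T) := by
  have hP := hp.P_pos
  have hK := hp.K_nonneg
  have hc := hp.c_pos
  have hpi := hp.pinf_pos
  have hpm := hp.measurable
  have hlog2 : 0 < Real.log 2 := Real.log_pos (by norm_num)
  have hn0 : (0 : ℝ) < n := by exact_mod_cast hn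
  obtain ⟨s, C₀, hs, hC₀, hgrid⟩ := exists_reverse_holder_gridAvg hn hp hb hB h hC hmod
  obtain ⟨s', C₁, hs', hC₁, hgood⟩ := exists_reverse_holder_good hp hb hB h hC hmod zero_le_one
  -- Using only exponents `r ≤ 1 + s / 2` leaves a gap `1 - κ > 0` below the integrability exponent
  -- `1 + s`; the decay rate `η` comes from this gap.
  set κ := (1 + s / 2) / (1 + s) with hκ
  have hκ0 : 0 < κ := by positivity
  have hκ1 : κ < 1 := by rw [hκ, div_lt_one] <;> linarith
  set D := B * (1 + 2 ^ n) with hD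
  have hD0 : 0 ≤ D := by positivity
  set E₁ := D * K / Real.log 2 with hE₁
  have hE₁0 : 0 ≤ E₁ := by positivity
  set K₁ := (n * K / c + n * K / pinf) * (1 + 2) with hK₁
  set r₁ := min (1 + s / 2) (1 + s') with hr₁
  have hr₁1 : 1 < r₁ := lt_min (by linarith) (by linarith)
  set L₀ := Real.log (1 + C₀) with hL₀
  have hL₀0 : 0 ≤ L₀ := Real.log_nonneg (by linarith)
  set E₂ := P * (κ * L₀ / pinf) with hE₂
  set η := c * ((1 - κ) * n * Real.log 2 / pinf) with hη
  have hη0 : 0 < η := by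
    have : 0 < 1 - κ := by linarith
    positivity
  set A₁ := Real.exp (r₁ * E₁ + K₁) * C₁ with hA₁
  refine ⟨r₁, A₁ * (1 + C₀), Real.exp E₂ * (2 * (n + 2)) ^ n, η, hr₁1, by positivity,
    by positivity, hη0, fun r hr1 hrr a l k hl hk T hT hTm => ?_⟩
  have hl0 : 0 < l := by linarith
  have hr0 : 0 < r := by linarith
  obtain ⟨hρ1, hρ2, hρ3, hρ4⟩ := scale_bounds hl hk
  set ρ := l / 2 ^ k with hρ
  have hρ0 : 0 < ρ := by linarith
  set M := cubeAvg b a l with hM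
  have hgm : Measurable fun y => gridAvg b a l k y :=
    measurable_of_gridCube hl0 k fun x y hy => gridAvg_congr hl0 hy
  have hosc : ∀ x ∈ cube a l, |gridAvg b a l k x - M| ≤ D * k := fun x hx => by
    have := h.abs_gridAvg_sub_le (a := a) (x := x) hb hB.le hl0 (Nat.zero_le k)
    rw [gridAvg_zero hl0 hx] at this
    simpa using this
  -- Keeping a single subcube in the reverse Hölder integral: its volume is `2 ^ (-k n)` of the
  -- whole.
  have hgain : ∀ x ∈ cube a l, (1 + s) * (pinf * (gridAvg b a l k x - M)) ≤
      L₀ + n * (k * Real.log 2) := by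
    intro x hx
    have h1 := (lintegral_mono_set (gridCube_subset_cube hl0 hx k)).trans (hgrid a l k hl hk)
    rw [setLIntegral_congr_fun (g := fun _ => ENNReal.ofReal (Real.exp ((1 + s) * (pinf *
      (gridAvg b a l k x - M))))) (measurableSet_gridCube k)
      (fun z hz => by simp only [gridAvg_congr hl0 hz, hM]), lintegral_const,
      Measure.restrict_apply_univ, volume_gridCube hl0, volume_cube hl0,
      ← ENNReal.ofReal_mul (by positivity), ← ENNReal.ofReal_mul (by positivity),
      ENNReal.ofReal_le_ofReal_iff (by positivity), div_pow, ← mul_div_assoc,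
      div_le_iff₀ (by positivity)] at h1
    have hln : 0 < l ^ n := by positivity
    have h2 : Real.exp ((1 + s) * (pinf * (gridAvg b a l k x - M))) ≤ C₀ * (2 ^ k) ^ n := by
      rw [mul_right_comm, mul_le_mul_iff_left₀ hln] at h1
      exact h1
    have h3 := Real.log_le_log (Real.exp_pos _) h2
    rw [Real.log_exp, Real.log_mul hC₀.ne' (by positivity), Real.log_pow, Real.log_pow] at h3
    have h4 : Real.log C₀ ≤ L₀ := Real.log_le_log hC₀ (by linarith)
    linarith
  set t := (n + 2) * ρ with ht
  have ht0 : 0 < t := by positivity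
  set V : Set (EuclideanSpace ℝ (Fin n)) := {z | ∀ i, z i ∈ Ioo (-t) t} with hV
  set F : EuclideanSpace ℝ (Fin n) → ℝ≥0∞ := fun x =>
    ENNReal.ofReal (Real.exp (r * p x * (b x - M) - p x * cubeExp p pinf a l)) with hF
  set G : EuclideanSpace ℝ (Fin n) → ℝ≥0∞ := fun x =>
    ENNReal.ofReal (Real.exp (r * (pinf * (gridAvg b a l k x - M)))) with hG
  set ν₁ : Measure (EuclideanSpace ℝ (Fin n)) :=
    ENNReal.ofReal (A₁ / l ^ n) • volume.withDensity G with hν₁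
  set ν₂ : Measure (EuclideanSpace ℝ (Fin n)) :=
    ENNReal.ofReal (Real.exp (E₂ - η * k) * T / ρ ^ n) • volume.restrict V with hν₂
  -- Each subcube of side `ρ` is charged to one of two measures: `ν₁`, with the coarse averages as
  -- density, if it stays at distance `ρ` from the origin, and otherwise `ν₂`, which spreads the
  -- bound `T` uniformly over the box `V`.
  have key := measure_le_of_gridCube (a := a) hl0 (μ := volume.withDensity F) (ν := ν₁ + ν₂)
    (U := cube a l) (fun _ => k) (fun y hy z hz => ⟨gridCube_subset_cube hl0 hy k hz, rfl⟩) ?_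
  · rw [withDensity_apply _ measurableSet_cube] at key
    refine (show cubeModular p pinf b r M a l = ∫⁻ x in cube a l, F x from rfl).le.trans
      (key.trans ?_)
    rw [Measure.add_apply, ENNReal.ofReal_add (by positivity) (by positivity)]
    refine add_le_add ?_ ?_
    · rw [hν₁, Measure.smul_apply, withDensity_apply _ measurableSet_cube, smul_eq_mul]
      have h1 : ∫⁻ x in cube a l, G x ≤ ENNReal.ofReal (1 + C₀) * volume (cube a l) := by
        refine (lintegral_exp_mono_exponent hr0.le (s := 1 + s) ?_).trans ?_
        · exact hrr.trans ((min_le_left _ _).trans (by linarith))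
        · rw [Measure.restrict_apply_univ, ENNReal.ofReal_add zero_le_one hC₀.le, add_mul,
            ENNReal.ofReal_one, one_mul]
          exact add_le_add le_rfl (hgrid a l k hl hk)
      refine (mul_le_mul_right h1 _).trans (le_of_eq ?_)
      rw [volume_cube hl0, ← ENNReal.ofReal_mul (by positivity), ← ENNReal.ofReal_mul (by positivity)]
      congr 1
      have : l ^ n ≠ 0 := by positivity
      field_simp
    · rw [hν₂, Measure.smul_apply, smul_eq_mul]
      refine (mul_le_mul_right ((measure_mono (subset_univ _)).trans
        (Measure.restrict_apply_univ V).le) _).trans (le_of_eq ?_)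
      rw [hV, volume_setOf_Ioo ht0, ← ENNReal.ofReal_mul (by positivity)]
      congr 1
      rw [ht, ← mul_assoc, mul_pow, sub_eq_add_neg, Real.exp_add]
      have : ρ ^ n ≠ 0 := by positivity
      field_simp
  · intro x hx
    set m' := gridAvg b a l k x with hm'
    have hsub := gridCube_subset_cube hl0 hx k
    have hPv : volume (gridCube a l k x) = ENNReal.ofReal (ρ ^ n) := volume_gridCube hl0 k
    rw [withDensity_apply _ (measurableSet_gridCube k), Measure.add_apply]
    by_cases hnice : ∀ z ∈ gridCube a l k x, ρ ≤ ‖z‖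
    · refine le_add_right ?_
      have hlogz : ∀ z ∈ gridCube a l k x, Real.log ρ ≤ Real.log (Real.exp 1 + ‖z‖) := fun z hz =>
        Real.log_le_log hρ0 ((hnice z hz).trans (by linarith [Real.exp_pos 1]))
      have h1 := hgood (gridCorner a l k x) ρ hρ0 (fun z hz => by rw [one_mul]; exact hlogz z hz)
        r hr0.le (hrr.trans (min_le_right _ _))
      have h2 : ∫⁻ z in gridCube a l k x, F z ≤ ∫⁻ z in gridCube a l k x,
          ENNReal.ofReal (Real.exp (r * (pinf * (m' - M)) + (r₁ * E₁ + K₁) - n * Real.log l)) *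
          ENNReal.ofReal (Real.exp (r * (p z * (b z - m')))) := by
        refine setLIntegral_mono' (measurableSet_gridCube k) fun z hz => ?_
        rw [hF, ← ENNReal.ofReal_mul (Real.exp_pos _).le, ← Real.exp_add]
        refine ENNReal.ofReal_le_ofReal (Real.exp_le_exp.2 ?_)
        have h3 := hp.cubeDev_le hl0 (hsub hz) (C := 2) (by norm_num)
          (by linarith [hlogz z hz])
        have h4 := (abs_le.1 h3).1
        have h5 : |(p z - pinf) * (m' - M)| ≤ E₁ := by
          rw [abs_mul, hE₁, le_div_iff₀ hlog2]
          calc |p z - pinf| * |m' - M| * Real.log 2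
              ≤ |p z - pinf| * (D * k) * Real.log 2 := by gcongr; exact hosc x hx
            _ = D * (|p z - pinf| * (k * Real.log 2)) := by ring
            _ ≤ D * (|p z - pinf| * Real.log (Real.exp 1 + ‖z‖)) := by
                have : k * Real.log 2 ≤ Real.log (Real.exp 1 + ‖z‖) := hρ4.trans (hlogz z hz)
                gcongr
            _ ≤ D * K := by gcongr; exact hp.inf z
        have h6 : r * ((p z - pinf) * (m' - M)) ≤ r₁ * E₁ :=
          (mul_le_mul_of_nonneg_left ((le_abs_self _).trans h5) hr0.le).trans
            (mul_le_mul_of_nonneg_right hrr hE₁0)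
        have e : r * p z * (b z - M) = r * (p z * (b z - m')) + r * (pinf * (m' - M)) +
          r * ((p z - pinf) * (m' - M)) := by ring
        linarith
      refine h2.trans ?_
      have hGi : ∫⁻ z in gridCube a l k x, G z =
          ENNReal.ofReal (Real.exp (r * (pinf * (m' - M)))) * volume (gridCube a l k x) := by
        rw [setLIntegral_congr_fun (g := fun _ => ENNReal.ofReal (Real.exp (r * (pinf * (m' - M)))))
          (measurableSet_gridCube k) (fun z hz => by simp only [hG, gridAvg_congr hl0 hz, hm']),
          lintegral_const, Measure.restrict_apply_univ]
      rw [lintegral_const_mul _ (by fun_prop), hν₁, Measure.smul_apply, smul_eq_mul,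
        withDensity_apply _ (measurableSet_gridCube k), hGi]
      refine (mul_le_mul_right h1 _).trans (le_of_eq ?_)
      rw [show volume (cube (gridCorner a l k x) ρ) = volume (gridCube a l k x) from rfl,
        ← mul_assoc (ENNReal.ofReal (Real.exp _)), ← mul_assoc (ENNReal.ofReal (A₁ / l ^ n)),
        ← ENNReal.ofReal_mul (by positivity), ← ENNReal.ofReal_mul (by positivity)]
      congr 2
      rw [Real.exp_sub, Real.exp_add, Real.exp_nat_mul, Real.exp_log hl0, hA₁]
      have : l ^ n ≠ 0 := by positivity
      field_simp
    · refine le_add_left ?_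
      simp only [not_forall, not_le] at hnice
      obtain ⟨z₀, hz₀, hz₀n⟩ := hnice
      -- The diameter is at most `n ρ` and some point has norm below `ρ`, hence the half-side `(n +
      -- 2) ρ`.
      have hPV : gridCube a l k x ⊆ V := by
        intro z hz i
        have h1 := norm_sub_le_of_mem_cube hz hz₀
        have h2 : ‖z‖ ≤ ‖z - z₀‖ + ‖z₀‖ := by simpa using norm_add_le (z - z₀) z₀
        have h3 : |z i| ≤ ‖z‖ := by simpa using PiLp.norm_apply_le z i
        exact abs_lt.1 (by rw [ht]; nlinarith)
      -- Passing from scale `ρ` to `l` multiplies the integrand by `exp (p (r (m' - M) - n k log 2 /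
      -- pinf))`. By `hgain` the first term recovers at most a fraction `κ` of the second, up to a
      -- constant.
      have hτ : cubeExp p pinf a l - cubeExp p pinf (gridCorner a l k x) ρ =
          n * (k * Real.log 2) / pinf := by
        simp only [cubeExp, if_pos hl, if_pos hρ1, hρ3]
        ring
      have h1 : r * (m' - M) ≤ κ / pinf * (L₀ + n * (k * Real.log 2)) := by
        have h2 := hgain x hx
        have h3 : m' - M ≤ (L₀ + n * (k * Real.log 2)) / ((1 + s) * pinf) := by
          rw [le_div_iff₀ (by positivity)]
          linarith
        have h4 : r ≤ 1 + s / 2 := hrr.trans (min_le_left _ _)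
        calc r * (m' - M) ≤ r * ((L₀ + n * (k * Real.log 2)) / ((1 + s) * pinf)) := by gcongr
          _ ≤ (1 + s / 2) * ((L₀ + n * (k * Real.log 2)) / ((1 + s) * pinf)) := by gcongr
          _ = _ := by rw [hκ]; field_simp
      have h2 : ∫⁻ z in gridCube a l k x, F z ≤ ∫⁻ z in gridCube a l k x,
          ENNReal.ofReal (Real.exp (E₂ - η * k)) * ENNReal.ofReal (Real.exp (r * p z * (b z - m') -
            p z * cubeExp p pinf (gridCorner a l k x) ρ)) := by
        refine setLIntegral_mono' (measurableSet_gridCube k) fun z hz => ?_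
        rw [hF, ← ENNReal.ofReal_mul (Real.exp_pos _).le, ← Real.exp_add]
        refine ENNReal.ofReal_le_ofReal (Real.exp_le_exp.2 ?_)
        have h3 : r * (m' - M) - n * (k * Real.log 2) / pinf ≤
            κ * L₀ / pinf - (1 - κ) * n * Real.log 2 / pinf * k := by
          refine (sub_le_sub_right h1 _).trans (le_of_eq ?_)
          field_simp
          ring
        have h4 : p z * (κ * L₀ / pinf) ≤ E₂ := by
          rw [hE₂]; gcongr; exact hp.le z
        have h5 : η * k ≤ p z * ((1 - κ) * n * Real.log 2 / pinf * k) := by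
          rw [hη, mul_assoc]
          have : 0 ≤ 1 - κ := by linarith
          gcongr
          exact hp.ge z
        have h6 := mul_le_mul_of_nonneg_left h3 (hp.pos z).le
        have e : r * p z * (b z - M) - p z * cubeExp p pinf a l = r * p z * (b z - m') -
            p z * cubeExp p pinf (gridCorner a l k x) ρ + p z * (r * (m' - M) -
            (cubeExp p pinf a l - cubeExp p pinf (gridCorner a l k x) ρ)) := by ring
        rw [e, hτ]
        linarith
      refine h2.trans ?_
      rw [lintegral_const_mul _ (by fun_prop)]
      have h3 : ∫⁻ z in gridCube a l k x, ENNReal.ofReal (Real.exp (r * p z * (b z - m') -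
            p z * cubeExp p pinf (gridCorner a l k x) ρ)) ≤ ENNReal.ofReal T :=
        hTm (gridCorner a l k x)
      refine (mul_le_mul_right h3 _).trans (le_of_eq ?_)
      rw [hν₂, Measure.smul_apply, smul_eq_mul, Measure.restrict_apply (measurableSet_gridCube k),
        inter_eq_left.2 hPV, hPv, ← ENNReal.ofReal_mul (by positivity),
        ← ENNReal.ofReal_mul (by positivity), div_mul_cancel₀ _ (by positivity)]

/-- Cubes of bounded side are covered by `exists_reverse_holder_good`, larger ones by iterating
`exists_scale_step` with enough generations that `T` is replaced by at most `K₂ + T / 2 ≤ T`. The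
centring constant is the average of `b`. -/
theorem LogCondition.reverseHolderCondition (hn : 1 ≤ n) (hp : RegularExponent p c P pinf K)
    (hb : Measurable b) (h : LogCondition p pinf b) : ReverseHolderCondition p pinf b := by
  obtain ⟨B, hB, hosc⟩ := exists_hasOscBound hn hp hb h
  obtain ⟨-, C, hC, hmod⟩ := h
  have hK := hp.K_nonneg
  have hc := hp.c_pos
  have hpi := hp.pinf_pos
  have hpm := hp.measurable
  obtain ⟨r₁, K₂, A, η, hr₁, hK₂, hA, hη, hstep⟩ := exists_scale_step hn hp hb hB hosc hC hmod
  obtain ⟨k₀, hk₀⟩ : ∃ k₀ : ℕ, A * Real.exp (-(η * k₀)) ≤ 1 / 2 := by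
    obtain ⟨k₀, hk₀⟩ := exists_nat_ge (Real.log (2 * A) / η)
    refine ⟨k₀, ?_⟩
    rw [div_le_iff₀ hη] at hk₀
    have h1 : Real.exp (-(η * k₀)) ≤ Real.exp (-Real.log (2 * A)) := Real.exp_le_exp.2 (by linarith)
    rw [Real.exp_neg (Real.log _), Real.exp_log (by positivity)] at h1
    calc _ ≤ A * (2 * A)⁻¹ := by gcongr
      _ = 1 / 2 := by field_simp
  -- Above this side, the `j` with `4 ^ j ≤ l < 4 ^ (j + 1)` is at least `k₀ + 1`; the inequality `4
  -- ^ j ≤ l` says that `l / 2 ^ j ≥ √l`.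
  set R₀ : ℝ := 4 ^ (k₀ + 1) with hR₀
  have hR₀1 : 1 ≤ R₀ := one_le_pow₀ (by norm_num)
  have hC₁ : 0 ≤ Real.log R₀ := Real.log_nonneg hR₀1
  obtain ⟨s, C', hs, hC', hgood⟩ := exists_reverse_holder_good hp hb hB hosc hC hmod hC₁
  obtain ⟨k, hk, hlow⟩ := exists_le_cubeModular_avg hn hp hb hB hosc
  set r := min r₁ (1 + s) with hr
  have hr1 : 1 < r := lt_min hr₁ (by linarith)
  set K₁ := (n * K / c + n * K / pinf) * (1 + Real.log R₀) with hK₁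
  set T := max (Real.exp K₁ * C') (2 * K₂) with hT
  have hT0 : 0 < T := lt_max_of_lt_right (by positivity)
  have hsmall : ∀ (a : EuclideanSpace ℝ (Fin n)) (l : ℝ), 0 < l → l ≤ R₀ →
      cubeModular p pinf b r (cubeAvg b a l) a l ≤ ENNReal.ofReal T := by
    intro a l hl hlR
    have hlog : ∀ x ∈ cube a l, Real.log l ≤ Real.log R₀ * Real.log (Real.exp 1 + ‖x‖) :=
      fun x _ => by
        have h1 := one_le_log_exp_add (norm_nonneg x)
        have h2 := Real.log_le_log hl hlR
        nlinarith
    have h1 := hgood a l hl hlog r (by linarith) (min_le_right _ _)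
    calc cubeModular p pinf b r (cubeAvg b a l) a l
        ≤ ∫⁻ x in cube a l, ENNReal.ofReal (Real.exp (K₁ - n * Real.log l)) *
          ENNReal.ofReal (Real.exp (r * (p x * (b x - cubeAvg b a l)))) := by
          refine setLIntegral_mono' measurableSet_cube fun x hx => ?_
          rw [← ENNReal.ofReal_mul (Real.exp_pos _).le, ← Real.exp_add]
          refine ENNReal.ofReal_le_ofReal (Real.exp_le_exp.2 ?_)
          have := (abs_le.1 (hp.cubeDev_le hl hx hC₁ (hlog x hx))).1
          linarith
      _ = ENNReal.ofReal (Real.exp (K₁ - n * Real.log l)) * ∫⁻ x in cube a l,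
          ENNReal.ofReal (Real.exp (r * (p x * (b x - cubeAvg b a l)))) :=
          lintegral_const_mul _ (by fun_prop)
      _ ≤ ENNReal.ofReal (Real.exp (K₁ - n * Real.log l)) *
          (ENNReal.ofReal C' * volume (cube a l)) := by gcongr
      _ = ENNReal.ofReal (Real.exp K₁ * C') := by
          rw [volume_cube hl, ← ENNReal.ofReal_mul hC'.le, ← ENNReal.ofReal_mul (Real.exp_pos _).le,
            Real.exp_sub, Real.exp_nat_mul, Real.exp_log hl]
          congr 1
          have : l ^ n ≠ 0 := by positivity
          field_simp
      _ ≤ ENNReal.ofReal T := ENNReal.ofReal_le_ofReal (le_max_left _ _)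
  have hall : ∀ (N : ℕ) (a : EuclideanSpace ℝ (Fin n)) (l : ℝ), 0 < l → l ≤ R₀ * 2 ^ N →
      cubeModular p pinf b r (cubeAvg b a l) a l ≤ ENNReal.ofReal T := by
    intro N
    induction N with
    | zero => intro a l hl hlR; exact hsmall a l hl (by simpa using hlR)
    | succ N ih =>
      intro a l hl hlR
      rcases le_or_gt l R₀ with hle | hgt
      · exact hsmall a l hl hle
      have hl1 : 1 ≤ l := hR₀1.trans hgt.le
      obtain ⟨j, hj1, hj2⟩ := exists_nat_pow_near hl1 (by norm_num : (1 : ℝ) < 4)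
      have hj : k₀ + 1 ≤ j := by
        have h1 : (4 : ℝ) ^ (k₀ + 1) < 4 ^ (j + 1) := hgt.trans hj2
        have := (pow_lt_pow_iff_right₀ (by norm_num : (1 : ℝ) < 4)).1 h1
        omega
      have hjl : l ≤ (l / 2 ^ j) ^ 2 := by
        rw [div_pow, ← pow_mul, mul_comm j 2, pow_mul, le_div_iff₀ (by positivity), sq l,
          show (2 : ℝ) ^ 2 = 4 by norm_num]
        exact mul_le_mul_of_nonneg_left hj1 (by linarith)
      have hj2' : (2 : ℝ) ≤ 2 ^ j := by
        calc (2 : ℝ) = 2 ^ 1 := by norm_num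
          _ ≤ 2 ^ j := pow_le_pow_right₀ (by norm_num) (by omega)
      have hhalf : l / 2 ^ j ≤ R₀ * 2 ^ N := by
        rw [div_le_iff₀ (by positivity)]
        calc l ≤ R₀ * 2 ^ (N + 1) := hlR
          _ = R₀ * 2 ^ N * 2 := by rw [pow_succ]; ring
          _ ≤ R₀ * 2 ^ N * 2 ^ j := by gcongr
      have h1 := hstep r hr1.le (min_le_left _ _) a l j hl1 hjl T hT0.le
        fun a' => ih a' _ (gridSide_pos hl j) hhalf
      refine h1.trans (ENNReal.ofReal_le_ofReal ?_)
      have h2 : A * Real.exp (-(η * j)) ≤ 1 / 2 := by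
        refine le_trans ?_ hk₀
        have : (k₀ : ℝ) ≤ j := by exact_mod_cast (by omega : k₀ ≤ j)
        gcongr
      have h3 : 2 * K₂ ≤ T := le_max_right _ _
      nlinarith
  refine ⟨r, T, k, hr1, hT0, hk, fun a l hl => ⟨cubeAvg b a l, ?_, hlow a l hl⟩⟩
  obtain ⟨N, hN⟩ := pow_unbounded_of_one_lt l (by norm_num : (1 : ℝ) < 2)
  refine hall N a l hl (hN.le.trans ?_)
  have : (0 : ℝ) < 2 ^ N := by positivity
  nlinarith

end VariableWeights

/-! ### Luxemburg norms in terms of modulars -/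

namespace VariableWeights

section LuxemburgNorm

variable {n : ℕ} {q f : EuclideanSpace ℝ (Fin n) → ℝ} {c P : ℝ}

lemma modular_div_le {s t A : ℝ} (hs : 0 < s) (ht : 0 < t) (hA : ∀ x, (s / t) ^ q x ≤ A) :
    modular q (fun x => f x / t) ≤ ENNReal.ofReal A * modular q (fun x => f x / s) := by
  rw [modular, modular, ← lintegral_const_mul' _ _ ENNReal.ofReal_ne_top]
  refine lintegral_mono fun x => ?_
  have hst : 0 ≤ (s / t) ^ q x := by positivity
  rw [← ENNReal.ofReal_mul (hst.trans (hA x))]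
  refine ENNReal.ofReal_le_ofReal ?_
  have e : |f x / t| = (s / t) * |f x / s| := by
    rw [abs_div, abs_div, abs_of_pos hs, abs_of_pos ht]; field_simp
  rw [e, Real.mul_rpow (by positivity) (abs_nonneg _)]
  exact mul_le_mul_of_nonneg_right (hA x) (by positivity)

lemma lpNorm_le_of_modular_le_one {t : ℝ} (ht : 0 < t) (h : modular q (fun x => f x / t) ≤ 1) :
    lpNorm q f ≤ ENNReal.ofReal t :=
  iInf_le_of_le t (iInf_le_of_le ht (iInf_le_of_le h le_rfl))

lemma exists_modular_le_one {y : ℝ≥0∞} (h : lpNorm q f < y) :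
    ∃ t : ℝ, 0 < t ∧ ENNReal.ofReal t < y ∧ modular q (fun x => f x / t) ≤ 1 := by
  simp only [lpNorm, iInf_lt_iff] at h
  obtain ⟨t, ht, hm, hlt⟩ := h
  exact ⟨t, ht, hlt, hm⟩

lemma lpNorm_le_of_modular_le {t A : ℝ} (hc : 0 < c) (hq : ∀ x, c ≤ q x) (hA : 1 ≤ A) (ht : 0 < t)
    (h : modular q (fun x => f x / t) ≤ ENNReal.ofReal A) :
    lpNorm q f ≤ ENNReal.ofReal (A ^ (1 / c) * t) := by
  have hA0 : 0 < A := by linarith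
  have hu : 0 < A ^ (1 / c) := by positivity
  refine lpNorm_le_of_modular_le_one (by positivity) ?_
  refine (modular_div_le (A := A⁻¹) ht (by positivity) fun x => ?_).trans ?_
  · have e : t / (A ^ (1 / c) * t) = A ^ (-(1 / c)) := by
      rw [Real.rpow_neg hA0.le]; field_simp
    rw [e, ← Real.rpow_mul hA0.le, ← Real.rpow_neg_one]
    refine Real.rpow_le_rpow_of_exponent_le hA ?_
    rw [neg_mul, neg_le_neg_iff, one_div, ← div_eq_inv_mul, le_div_iff₀ hc, one_mul]
    exact hq x
  · calc ENNReal.ofReal A⁻¹ * modular q (fun x => f x / t)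
        ≤ ENNReal.ofReal A⁻¹ * ENNReal.ofReal A := by gcongr
      _ = 1 := by
        rw [← ENNReal.ofReal_mul (by positivity), inv_mul_cancel₀ hA0.ne', ENNReal.ofReal_one]

lemma lpNorm_le_of_modular_le_of_le_one {t A : ℝ} (hP : 0 < P)
    (hq : ∀ x, q x ≤ P) (hA0 : 0 < A) (hA : A ≤ 1) (ht : 0 < t)
    (h : modular q (fun x => f x / t) ≤ ENNReal.ofReal A) :
    lpNorm q f ≤ ENNReal.ofReal (A ^ (1 / P) * t) := by
  have hu : 0 < A ^ (1 / P) := by positivity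
  refine lpNorm_le_of_modular_le_one (by positivity) ?_
  refine (modular_div_le (A := A⁻¹) ht (by positivity) fun x => ?_).trans ?_
  · have e : t / (A ^ (1 / P) * t) = A ^ (-(1 / P)) := by
      rw [Real.rpow_neg hA0.le]; field_simp
    rw [e, ← Real.rpow_mul hA0.le, ← Real.rpow_neg_one]
    refine Real.rpow_le_rpow_of_exponent_ge hA0 hA ?_
    rw [neg_mul, neg_le_neg_iff, one_div, ← div_eq_inv_mul, div_le_one hP]
    exact hq x
  · calc ENNReal.ofReal A⁻¹ * modular q (fun x => f x / t)
        ≤ ENNReal.ofReal A⁻¹ * ENNReal.ofReal A := by gcongr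
      _ = 1 := by
        rw [← ENNReal.ofReal_mul (by positivity), inv_mul_cancel₀ hA0.ne', ENNReal.ofReal_one]

/-- The factor 2 makes the norm bound strict, so that an admissible `s` exists without knowing that
the infimum is attained. -/
lemma modular_le_of_lpNorm_le {t T : ℝ} (hq0 : ∀ x, 0 < q x) (hq : ∀ x, q x ≤ P) (hT : 1 ≤ T)
    (ht : 0 < t) (h : lpNorm q f ≤ ENNReal.ofReal (T * t)) :
    modular q (fun x => f x / t) ≤ ENNReal.ofReal ((2 * T) ^ P) := by
  have h2 : ENNReal.ofReal (T * t) < ENNReal.ofReal (2 * T * t) := by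
    rw [ENNReal.ofReal_lt_ofReal_iff (by positivity)]
    nlinarith [mul_pos (zero_lt_one.trans_le hT) ht]
  obtain ⟨s, hs, hst, hm⟩ := exists_modular_le_one (h.trans_lt h2)
  rw [ENNReal.ofReal_lt_ofReal_iff (by positivity)] at hst
  refine (modular_div_le (A := (2 * T) ^ P) hs ht fun x => ?_).trans ?_
  · calc (s / t) ^ q x ≤ (2 * T) ^ q x := by
          refine Real.rpow_le_rpow (by positivity) ?_ (hq0 x).le
          rw [div_le_iff₀ ht]; exact hst.le
      _ ≤ (2 * T) ^ P := Real.rpow_le_rpow_of_exponent_le (by linarith) (hq x)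
  · calc _ ≤ ENNReal.ofReal ((2 * T) ^ P) * 1 := by gcongr
      _ = _ := mul_one _

lemma le_lpNorm_of_le_modular {t k : ℝ} (hc : 0 < c) (hq : ∀ x, c ≤ q x) (hk0 : 0 < k)
    (hk : k ≤ 1) (ht : 0 < t) (h : ENNReal.ofReal k ≤ modular q (fun x => f x / t)) :
    ENNReal.ofReal (k ^ (1 / c) * t) ≤ lpNorm q f := by
  by_contra! hcon
  obtain ⟨s, hs, hst, hm⟩ := exists_modular_le_one hcon
  rw [ENNReal.ofReal_lt_ofReal_iff (by positivity), ← div_lt_iff₀ ht] at hst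
  have hk1 : k ^ (1 / c) ≤ 1 := Real.rpow_le_one hk0.le hk (by positivity)
  have h1 : (s / t) ^ c < k := by
    calc (s / t) ^ c < (k ^ (1 / c)) ^ c := Real.rpow_lt_rpow (by positivity) hst hc
      _ = k := by rw [← Real.rpow_mul hk0.le, one_div_mul_cancel hc.ne', Real.rpow_one]
  have h2 : modular q (fun x => f x / t) ≤ ENNReal.ofReal ((s / t) ^ c) * 1 :=
    (modular_div_le (A := (s / t) ^ c) hs ht fun x =>
      Real.rpow_le_rpow_of_exponent_ge (by positivity) (hst.le.trans hk1) (hq x)).trans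
      (by gcongr)
  rw [mul_one] at h2
  have h3 := h.trans h2
  rw [ENNReal.ofReal_le_ofReal_iff (by positivity)] at h3
  linarith

end LuxemburgNorm

/-! ### Translation between normalized norms and `cubeModular` -/

section Mean

variable {n : ℕ} {p b w : EuclideanSpace ℝ (Fin n) → ℝ} {c P pinf K : ℝ}
  {Q : Set (EuclideanSpace ℝ (Fin n))} {a : EuclideanSpace ℝ (Fin n)} {l r m : ℝ}

/-- Raising `exp (b - m - τ / r)` to the power `r p` gives `exp (r p (b - m) - p τ)`: the same `τ`
normalizes the indicator for every multiple `r p`. -/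
lemma modular_indicator_eq_cubeModular (hp : ∀ x, 0 < p x) (hr : 0 < r)
    (hwb : w =ᵐ[volume] fun x => Real.exp (b x)) (hQ : Q =ᵐ[volume] cube a l) :
    modular (fun x => r * p x)
      (fun x => Q.indicator w x / Real.exp (m + cubeExp p pinf a l / r)) =
      cubeModular p pinf b r m a l := by
  rw [modular, cubeModular, ← lintegral_indicator measurableSet_cube]
  refine lintegral_congr_ae ?_
  filter_upwards [hwb, hQ.mem_iff] with x hx hxQ
  by_cases hxc : x ∈ cube a l
  · rw [indicator_of_mem hxc, indicator_of_mem (hxQ.2 hxc), hx, ← Real.exp_sub, Real.abs_exp,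
      ← Real.exp_mul]
    congr 2
    field_simp
    ring
  · rw [indicator_of_notMem hxc, indicator_of_notMem fun h => hxc (hxQ.1 h), zero_div, abs_zero,
      Real.zero_rpow (mul_pos hr (hp x)).ne', ENNReal.ofReal_zero]

namespace RegularExponent

lemma exists_lpNorm_indicator_one_bounds (hn : 1 ≤ n) (hp : RegularExponent p c P pinf K)
    (hr : 0 < r) : ∃ d D : ℝ, 0 < d ∧ 0 < D ∧ ∀ (a : EuclideanSpace ℝ (Fin n)) (l : ℝ)
      (Q : Set (EuclideanSpace ℝ (Fin n))), 0 < l → Q =ᵐ[volume] cube a l →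
      ENNReal.ofReal (d * Real.exp (cubeExp p pinf a l / r)) ≤
        lpNorm (fun x => r * p x) (Q.indicator fun _ => 1) ∧
      lpNorm (fun x => r * p x) (Q.indicator fun _ => 1) ≤
        ENNReal.ofReal (D * Real.exp (cubeExp p pinf a l / r)) := by
  obtain ⟨k, S, hk, hS, h⟩ := hp.exists_cubeModular_zero_bounds hn
  have hrc : 0 < r * c := mul_pos hr hp.c_pos
  have hge : ∀ x, r * c ≤ r * p x := fun x => mul_le_mul_of_nonneg_left (hp.ge x) hr.le
  refine ⟨min k 1 ^ (1 / (r * c)), max S 1 ^ (1 / (r * c)), by positivity, by positivity,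
    fun a l Q hl hQ => ?_⟩
  have e : modular (fun x => r * p x) (fun x => Q.indicator (fun _ => 1) x /
      Real.exp (cubeExp p pinf a l / r)) =
      ∫⁻ x in cube a l, ENNReal.ofReal (Real.exp (-(p x * cubeExp p pinf a l))) := by
    have := modular_indicator_eq_cubeModular (w := fun _ => 1) (b := fun _ => 0) (m := 0)
      (pinf := pinf) hp.pos hr (by simp) hQ
    simpa [cubeModular] using this
  obtain ⟨h1, h2⟩ := h a l hl
  rw [← e] at h1 h2
  exact ⟨le_lpNorm_of_le_modular hrc hge (by positivity) (min_le_right _ _) (by positivity)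
      ((ENNReal.ofReal_le_ofReal (min_le_left _ _)).trans h1),
    lpNorm_le_of_modular_le hrc hge (le_max_right _ _) (by positivity)
      (h2.trans (ENNReal.ofReal_le_ofReal (le_max_left _ _)))⟩

lemma lpNorm_indicator_one_ne (hn : 1 ≤ n) (hp : RegularExponent p c P pinf K) (hr : 0 < r)
    (hl : 0 < l) (hQ : Q =ᵐ[volume] cube a l) :
    lpNorm (fun x => r * p x) (Q.indicator fun _ => 1) ≠ 0 ∧
      lpNorm (fun x => r * p x) (Q.indicator fun _ => 1) ≠ ∞ := by
  obtain ⟨d, D, hd, hD, h⟩ := hp.exists_lpNorm_indicator_one_bounds hn hr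
  obtain ⟨h1, h2⟩ := h a l Q hl hQ
  refine ⟨fun h0 => ?_, ne_top_of_le_ne_top ENNReal.ofReal_ne_top h2⟩
  rw [h0, nonpos_iff_eq_zero, ENNReal.ofReal_eq_zero] at h1
  exact absurd h1 (not_le.2 (by positivity))

lemma exists_lpMean_le (hn : 1 ≤ n) (hp : RegularExponent p c P pinf K) (hr : 0 < r)
    (hwb : w =ᵐ[volume] fun x => Real.exp (b x)) (C : ℝ) :
    ∃ C' : ℝ, 0 < C' ∧ ∀ (a : EuclideanSpace ℝ (Fin n)) (l m : ℝ)
      (Q : Set (EuclideanSpace ℝ (Fin n))), 0 < l → Q =ᵐ[volume] cube a l →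
      cubeModular p pinf b r m a l ≤ ENNReal.ofReal C →
      lpMean (fun x => r * p x) w Q ≤ ENNReal.ofReal (C' * Real.exp m) := by
  obtain ⟨d, D, hd, hD, h⟩ := hp.exists_lpNorm_indicator_one_bounds hn hr
  refine ⟨max C 1 ^ (1 / (r * c)) / d, by positivity, fun a l m Q hl hQ hC => ?_⟩
  rw [← modular_indicator_eq_cubeModular hp.pos hr hwb hQ] at hC
  have h1 := lpNorm_le_of_modular_le (mul_pos hr hp.c_pos)
    (fun x => mul_le_mul_of_nonneg_left (hp.ge x) hr.le) (le_max_right C 1) (by positivity)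
    (hC.trans (ENNReal.ofReal_le_ofReal (le_max_left C 1)))
  refine (ENNReal.div_le_div h1 (h a l Q hl hQ).1).trans (le_of_eq ?_)
  rw [← ENNReal.ofReal_div_of_pos (by positivity), Real.exp_add]
  congr 1
  field_simp

lemma exists_lpMean_le_small (hn : 1 ≤ n) (hp : RegularExponent p c P pinf K) (hr : 0 < r)
    (hwb : w =ᵐ[volume] fun x => Real.exp (b x)) :
    ∃ k : ℝ, 0 < k ∧ ∀ (a : EuclideanSpace ℝ (Fin n)) (l m : ℝ)
      (Q : Set (EuclideanSpace ℝ (Fin n))), 0 < l → Q =ᵐ[volume] cube a l →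
      ENNReal.ofReal (Real.exp m) ≤ lpMean (fun x => r * p x) w Q →
      ENNReal.ofReal k ≤ cubeModular p pinf b r m a l := by
  obtain ⟨d, D, hd, hD, h⟩ := hp.exists_lpNorm_indicator_one_bounds hn hr
  have hP : 0 < r * P := mul_pos hr hp.P_pos
  -- A modular below `k` would make the normalized norm at most `exp m / 2`.
  set k := min ((d / 2) ^ (r * P)) 1 with hk
  have hk0 : 0 < k := by positivity
  have hkd : k ^ (1 / (r * P)) ≤ d / 2 := by
    calc k ^ (1 / (r * P)) ≤ ((d / 2) ^ (r * P)) ^ (1 / (r * P)) :=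
          Real.rpow_le_rpow hk0.le (min_le_left _ _) (by positivity)
      _ = d / 2 := by
        rw [← Real.rpow_mul (by positivity), mul_one_div_cancel hP.ne', Real.rpow_one]
  refine ⟨k, hk0, fun a l m Q hl hQ hm => ?_⟩
  by_contra! hcon
  rw [← modular_indicator_eq_cubeModular hp.pos hr hwb hQ] at hcon
  have h1 := lpNorm_le_of_modular_le_of_le_one hP
    (fun x => mul_le_mul_of_nonneg_left (hp.le x) hr.le) hk0 (min_le_right _ _) (by positivity)
    hcon.le
  have h2 := hm.trans (ENNReal.div_le_div h1 (h a l Q hl hQ).1)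
  rw [← ENNReal.ofReal_div_of_pos (by positivity), ENNReal.ofReal_le_ofReal_iff (by positivity),
    Real.exp_add, le_div_iff₀ (by positivity)] at h2
  have h3 : 0 < Real.exp m * Real.exp (cubeExp p pinf a l / r) := by positivity
  nlinarith

lemma exists_le_lpMean (hn : 1 ≤ n) (hp : RegularExponent p c P pinf K) (hr : 0 < r)
    (hwb : w =ᵐ[volume] fun x => Real.exp (b x)) {k : ℝ} (hk : 0 < k) :
    ∃ k' : ℝ, 0 < k' ∧ ∀ (a : EuclideanSpace ℝ (Fin n)) (l m : ℝ)
      (Q : Set (EuclideanSpace ℝ (Fin n))), 0 < l → Q =ᵐ[volume] cube a l →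
      ENNReal.ofReal k ≤ cubeModular p pinf b r m a l →
      ENNReal.ofReal (k' * Real.exp m) ≤ lpMean (fun x => r * p x) w Q := by
  obtain ⟨d, D, hd, hD, h⟩ := hp.exists_lpNorm_indicator_one_bounds hn hr
  refine ⟨min k 1 ^ (1 / (r * c)) / D, by positivity, fun a l m Q hl hQ hC => ?_⟩
  rw [← modular_indicator_eq_cubeModular hp.pos hr hwb hQ] at hC
  have h1 := le_lpNorm_of_le_modular (mul_pos hr hp.c_pos)
    (fun x => mul_le_mul_of_nonneg_left (hp.ge x) hr.le) (by positivity) (min_le_right k 1)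
    (by positivity) ((ENNReal.ofReal_le_ofReal (min_le_left k 1)).trans hC)
  refine (le_of_eq ?_).trans (ENNReal.div_le_div h1 (h a l Q hl hQ).2)
  rw [← ENNReal.ofReal_div_of_pos (by positivity), Real.exp_add]
  congr 1
  field_simp

lemma exists_cubeModular_le (hn : 1 ≤ n) (hp : RegularExponent p c P pinf K) (hr : 0 < r)
    (hwb : w =ᵐ[volume] fun x => Real.exp (b x)) (T : ℝ) :
    ∃ C : ℝ, 0 < C ∧ ∀ (a : EuclideanSpace ℝ (Fin n)) (l m : ℝ)
      (Q : Set (EuclideanSpace ℝ (Fin n))), 0 < l → Q =ᵐ[volume] cube a l →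
      lpMean (fun x => r * p x) w Q ≤ ENNReal.ofReal (T * Real.exp m) →
      cubeModular p pinf b r m a l ≤ ENNReal.ofReal C := by
  obtain ⟨d, D, hd, hD, h⟩ := hp.exists_lpNorm_indicator_one_bounds hn hr
  refine ⟨(2 * max (T * D) 1) ^ (r * P), by positivity, fun a l m Q hl hQ hT => ?_⟩
  rw [← modular_indicator_eq_cubeModular hp.pos hr hwb hQ]
  refine modular_le_of_lpNorm_le (fun x => mul_pos hr (hp.pos x))
    (fun x => mul_le_mul_of_nonneg_left (hp.le x) hr.le) (le_max_right _ _) (by positivity) ?_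
  obtain ⟨h0, htop⟩ := hp.lpNorm_indicator_one_ne hn hr hl hQ
  rw [lpMean, ENNReal.div_le_iff h0 htop] at hT
  refine hT.trans ((mul_le_mul_right (h a l Q hl hQ).2 _).trans ?_)
  rw [← ENNReal.ofReal_mul' (by positivity)]
  refine ENNReal.ofReal_le_ofReal ?_
  rw [Real.exp_add]
  calc T * Real.exp m * (D * Real.exp (cubeExp p pinf a l / r))
      = T * D * (Real.exp m * Real.exp (cubeExp p pinf a l / r)) := by ring
    _ ≤ _ := by gcongr; exact le_max_left _ _

lemma lpMean_ne_zero (hn : 1 ≤ n) (hp : RegularExponent p c P pinf K) (hr : 0 < r)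
    (hb : Measurable b) (hwb : w =ᵐ[volume] fun x => Real.exp (b x)) (hl : 0 < l)
    (hQ : Q =ᵐ[volume] cube a l) : lpMean (fun x => r * p x) w Q ≠ 0 := by
  have hpm := hp.measurable
  have h0 : 0 < cubeModular p pinf b r 0 a l := by
    rw [cubeModular, setLIntegral_pos_iff (by fun_prop)]
    have e : (Function.support fun x => ENNReal.ofReal
        (Real.exp (r * p x * (b x - 0) - p x * cubeExp p pinf a l))) = univ := by
      ext x; simp [Real.exp_pos]
    rw [e, univ_inter]
    exact (volume_cube_ne_zero hl).bot_lt
  obtain ⟨k, -, hk, hk'⟩ := ENNReal.lt_iff_exists_real_btwn.1 h0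
  obtain ⟨k', hk0, h⟩ := hp.exists_le_lpMean hn hr hwb (ENNReal.ofReal_pos.1 hk)
  have := h a l 0 Q hl hQ hk'.le
  intro h0
  rw [h0, nonpos_iff_eq_zero, ENNReal.ofReal_eq_zero] at this
  exact absurd this (not_le.2 (by positivity))

end RegularExponent

lemma setAverage_log_inv_eq (hwb : w =ᵐ[volume] fun x => Real.exp (b x))
    (hQ : Q =ᵐ[volume] cube a l) :
    ⨍ y in Q, Real.log (w y)⁻¹ = -⨍ y in cube a l, b y := by
  rw [setAverage_congr hQ, ← average_neg]
  refine average_congr (ae_restrict_of_ae ?_)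
  filter_upwards [hwb] with y hy
  simp [hy]

lemma integrableOn_log_inv_iff (hwb : w =ᵐ[volume] fun x => Real.exp (b x))
    (hQ : Q =ᵐ[volume] cube a l) :
    IntegrableOn (fun y => Real.log (w y)⁻¹) Q ↔ IntegrableOn b (cube a l) := by
  rw [integrableOn_congr_set_ae hQ, IntegrableOn, IntegrableOn, ← integrable_neg_iff (f := b)]
  refine integrable_congr (ae_restrict_of_ae ?_)
  filter_upwards [hwb] with y hy
  simp [hy]

theorem isApInfty_iff_logCondition (hn : 1 ≤ n) (hp : RegularExponent p c P pinf K)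
    (hw : IsWeight w) (hwb : w =ᵐ[volume] fun x => Real.exp (b x)) :
    IsApInfty p w ↔ LogCondition p pinf b := by
  constructor
  · intro h
    refine ⟨fun a l hl => (integrableOn_log_inv_iff hwb Filter.EventuallyEq.rfl).1
      (h.integrable_log _ (isCube_cube hl)), ?_⟩
    obtain ⟨C, hC, hmod⟩ := hp.exists_cubeModular_le hn one_pos hwb (apInftyConst p w).toReal
    refine ⟨C, hC, fun a l hl => hmod a l _ (cube a l) hl Filter.EventuallyEq.rfl ?_⟩
    have h1 : lpMean p w (cube a l) *
        ENNReal.ofReal (Real.exp (⨍ y in cube a l, Real.log (w y)⁻¹)) ≤ apInftyConst p w :=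
      le_iSup₂_of_le (f := fun Q (_ : IsCube Q) => lpMean p w Q *
        ENNReal.ofReal (Real.exp (⨍ y in Q, Real.log (w y)⁻¹))) _ (isCube_cube hl) le_rfl
    rw [setAverage_log_inv_eq hwb Filter.EventuallyEq.rfl, Real.exp_neg,
      ENNReal.ofReal_inv_of_pos (Real.exp_pos _), ← div_eq_mul_inv,
      ENNReal.div_le_iff (by simp [Real.exp_pos]) ENNReal.ofReal_ne_top] at h1
    simp only [one_mul]
    refine h1.trans (le_of_eq ?_)
    rw [ENNReal.ofReal_mul ENNReal.toReal_nonneg, ENNReal.ofReal_toReal h.const_lt_top.ne]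
  · rintro ⟨hint, C, hC, hmod⟩
    obtain ⟨C', hC', hmean⟩ := hp.exists_lpMean_le hn one_pos hwb C
    refine ⟨hw, fun Q hQ => ?_, ?_⟩
    · obtain ⟨a, l, hl, hQ'⟩ := hQ.exists_ae_eq_cube
      exact (integrableOn_log_inv_iff hwb hQ').2 (hint a l hl)
    · refine lt_of_le_of_lt (iSup₂_le fun Q hQ => ?_) (ENNReal.ofReal_lt_top (r := C'))
      obtain ⟨a, l, hl, hQ'⟩ := hQ.exists_ae_eq_cube
      have h1 := hmean a l _ Q hl hQ' (hmod a l hl)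
      simp only [one_mul] at h1
      rw [setAverage_log_inv_eq hwb hQ']
      refine (mul_le_mul_left h1 _).trans (le_of_eq ?_)
      rw [← ENNReal.ofReal_mul (by positivity), mul_assoc, ← Real.exp_add, add_neg_cancel,
        Real.exp_zero, mul_one]

/-- The constant `m` is the logarithm of the normalized norm with exponent `p`, which is finite by
hypothesis and positive because `w` is positive almost everywhere. -/
theorem reverseHolderCondition_of_lpMean_le (hn : 1 ≤ n) (hp : RegularExponent p c P pinf K)
    (hb : Measurable b) (hwb : w =ᵐ[volume] fun x => Real.exp (b x)) {C : ℝ} (hr : 1 < r)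
    (h : ∀ Q, IsCube Q → lpNorm p (Q.indicator w) < ∞ ∧
      lpMean (fun x => r * p x) w Q ≤ ENNReal.ofReal C * lpMean p w Q) :
    ReverseHolderCondition p pinf b := by
  obtain ⟨C', hC', hup⟩ := hp.exists_cubeModular_le hn (by linarith : 0 < r) hwb C
  obtain ⟨k, hk, hlow⟩ := hp.exists_lpMean_le_small hn one_pos hwb
  refine ⟨r, C', k, hr, hC', hk, fun a l hl => ?_⟩
  have hQ : cube a l =ᵐ[volume] cube a l := Filter.EventuallyEq.rfl
  obtain ⟨hfin, hle⟩ := h _ (isCube_cube hl)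
  have h0 := hp.lpMean_ne_zero hn one_pos hb hwb hl hQ
  have h1 := (hp.lpNorm_indicator_one_ne hn one_pos hl hQ).1
  simp only [one_mul] at h0 h1 hlow
  have htop : lpMean p w (cube a l) ≠ ∞ := (ENNReal.div_lt_top hfin.ne h1).ne
  have e : ENNReal.ofReal (Real.exp (Real.log (lpMean p w (cube a l)).toReal)) =
      lpMean p w (cube a l) := by
    rw [Real.exp_log (ENNReal.toReal_pos h0 htop), ENNReal.ofReal_toReal htop]
  refine ⟨Real.log (lpMean p w (cube a l)).toReal, hup a l _ _ hl hQ ?_, hlow a l _ _ hl hQ e.le⟩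
  rwa [ENNReal.ofReal_mul' (Real.exp_pos _).le, e]

/-- Both normalized norms are compared with the same `exp m`. `LogCondition` serves only for the
finiteness of the norm of `w 1_Q`. -/
theorem exists_lpMean_le_of_reverseHolderCondition (hn : 1 ≤ n)
    (hp : RegularExponent p c P pinf K) (hwb : w =ᵐ[volume] fun x => Real.exp (b x))
    (hlog : LogCondition p pinf b) (h : ReverseHolderCondition p pinf b) :
    ∃ r C : ℝ, 1 < r ∧ 0 < C ∧ ∀ Q, IsCube Q → lpNorm p (Q.indicator w) < ∞ ∧
      lpMean (fun x => r * p x) w Q ≤ ENNReal.ofReal C * lpMean p w Q := by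
  obtain ⟨-, C₀, -, hmod⟩ := hlog
  obtain ⟨r, C, k, hr, hC, hk, h⟩ := h
  obtain ⟨C₁, -, hfin⟩ := hp.exists_lpMean_le hn one_pos hwb C₀
  obtain ⟨C', hC', hup⟩ := hp.exists_lpMean_le hn (by linarith : 0 < r) hwb C
  obtain ⟨k', hk', hlow⟩ := hp.exists_le_lpMean hn one_pos hwb hk
  refine ⟨r, C' / k', hr, by positivity, fun Q hQ => ?_⟩
  obtain ⟨a, l, hl, hQ'⟩ := hQ.exists_ae_eq_cube
  obtain ⟨m, hm1, hm2⟩ := h a l hl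
  have h1 := hfin a l _ Q hl hQ' (hmod a l hl)
  have h2 := hlow a l m Q hl hQ' hm2
  have h3 := (hp.lpNorm_indicator_one_ne hn one_pos hl hQ').2
  simp only [one_mul] at h1 h2 h3
  refine ⟨?_, (hup a l m Q hl hQ' hm1).trans ?_⟩
  · by_contra! htop
    rw [top_le_iff] at htop
    rw [lpMean, htop, ENNReal.top_div_of_ne_top h3, top_le_iff] at h1
    exact ENNReal.ofReal_ne_top h1
  · refine le_trans (le_of_eq ?_) (mul_le_mul_right h2 _)
    rw [← ENNReal.ofReal_mul (by positivity)]
    congr 1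
    field_simp

lemma IsWeight.exists_measurable_log (hw : IsWeight w) :
    ∃ b : EuclideanSpace ℝ (Fin n) → ℝ, Measurable b ∧
      w =ᵐ[volume] fun x => Real.exp (b x) := by
  refine ⟨fun x => Real.log (hw.aemeasurable.mk w x),
    Real.measurable_log.comp hw.aemeasurable.measurable_mk, ?_⟩
  filter_upwards [hw.ae_pos, hw.aemeasurable.ae_eq_mk] with x hx hxw
  rw [← hxw, Real.exp_log hx]

end Mean

end VariableWeights

theorem theorem2p32 {n : ℕ} (hn : 1 ≤ n) (p : EuclideanSpace ℝ (Fin n) → ℝ)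
    (hp : VariableWeights.IsExponent p) (hpLH : VariableWeights.LogHolder p)
    (w : EuclideanSpace ℝ (Fin n) → ℝ) (hw : VariableWeights.IsWeight w) :
    VariableWeights.IsApInfty p w ↔
      ∃ r C : ℝ, 1 < r ∧ 0 < C ∧
        ∀ Q : Set (EuclideanSpace ℝ (Fin n)), VariableWeights.IsCube Q →
          VariableWeights.lpNorm p (Q.indicator w) < ∞ ∧
          VariableWeights.lpMean (fun x => r * p x) w Q ≤
            ENNReal.ofReal C * VariableWeights.lpMean p w Q := by
  obtain ⟨c, P, pinf, K, hreg⟩ := VariableWeights.exists_regularExponent hn hp hpLH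
  obtain ⟨b, hb, hwb⟩ := hw.exists_measurable_log
  rw [VariableWeights.isApInfty_iff_logCondition hn hreg hw hwb]
  constructor
  · intro h
    exact VariableWeights.exists_lpMean_le_of_reverseHolderCondition hn hreg hwb h
      (h.reverseHolderCondition hn hreg hb)
  · rintro ⟨r, C, hr, -, h⟩
    exact (VariableWeights.reverseHolderCondition_of_lpMean_le hn hreg hb hwb hr h).logCondition
      hn hreg hb
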